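/- There is a constant $C$ such that every graph $G$ with $n\ge 1$ vertices and maximum degree at most $7$ that admits a proper edge-coloring with $7$ colors has a $2$-bend RAC drawing of area at most $C n^2$. Moreover, there is an algorithm which, given such a graph $G$ with $n$ vertices together with a proper $7$-edge-coloring of it, computes in $O(n)$ time a $2$-bend RAC drawing of $G$ with $O(n^2)$ area. Here graphs are finite and simple. A $2$-bend RAC drawing is a polyline drawing with all vertices and bends at points of the integer grid, in which distinct vertices are distinct points, every edge is a simple polygonal curve with at most two bends that passes through no vertex other than its ends, and any point shared by two distinct edges is either a common endvertex or a crossing of two segments in points interior to both, at an angle of $90^\circ$. Its area is that of the smallest enclosing axis-parallel rectangle, measured as the number of grid rows times the number of grid columns that it meets. The algorithm runs on a word RAM with words of $O(\log n)$ bits and unit-cost memory access, comparison, addition, subtraction, multiplication and integer division; the input is the list of the edges (in arbitrary order) with their colors, and the output consists of the coordinates of all vertices and bends. -/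

import Mathlib

/-! ### Polyline drawings on the integer grid -/

/-- The grid point `p`, seen as a point of the Euclidean plane. -/
def gridToPlane (p : ℤ × ℤ) : ℝ × ℝ := ((p.1 : ℝ), (p.2 : ℝ))

/-- The closed straight-line segment between the two grid points of the pair `s`. -/
def segSet (s : (ℤ × ℤ) × (ℤ × ℤ)) : Set (ℝ × ℝ) :=
  segment ℝ (gridToPlane s.1) (gridToPlane s.2)

/-- Two segments are perpendicular: their direction vectors have inner product zero. -/
def SegPerp (s t : (ℤ × ℤ) × (ℤ × ℤ)) : Prop :=
  (s.2.1 - s.1.1) * (t.2.1 - t.1.1) + (s.2.2 - s.1.2) * (t.2.2 - t.1.2) = 0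

/-- The consecutive segments of the polyline with the given list of corner points. -/
def polySegs (l : List (ℤ × ℤ)) : List ((ℤ × ℤ) × (ℤ × ℤ)) := l.zip l.tail

/-- The polyline is a simple curve: no segment is degenerate, consecutive segments meet only in
their common corner, and segments that are not consecutive are disjoint. -/
def IsSimplePolyline (l : List (ℤ × ℤ)) : Prop :=
  (∀ s ∈ polySegs l, s.1 ≠ s.2) ∧
  ∀ (i j : ℕ) (hi : i < (polySegs l).length) (hj : j < (polySegs l).length), i < j →
    ∀ p ∈ segSet ((polySegs l)[i]) ∩ segSet ((polySegs l)[j]),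
      j = i + 1 ∧ p = gridToPlane ((polySegs l)[j]).1

/-- A polyline drawing of the simple graph `G` with all vertices and all bends on grid points.
`bends d` lists the bends of the edge underlying the dart `d`, in the order in which they are met
when the edge is traversed from `d.fst` to `d.snd`. Vertices are distinct points, edges are simple
curves, and no edge passes through a vertex that is not one of its ends. -/
structure GridDrawing {V : Type*} (G : SimpleGraph V) where
  pos : V → ℤ × ℤ
  bends : G.Dart → List (ℤ × ℤ)
  bends_symm : ∀ d : G.Dart, bends d.symm = (bends d).reverse
  pos_injective : Function.Injective pos
  simple : ∀ d : G.Dart, IsSimplePolyline (pos d.fst :: (bends d ++ [pos d.snd]))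
  avoids_vertices : ∀ (d : G.Dart) (w : V), w ≠ d.fst → w ≠ d.snd →
    ∀ s ∈ polySegs (pos d.fst :: (bends d ++ [pos d.snd])), gridToPlane (pos w) ∉ segSet s

namespace GridDrawing

variable {V : Type*} {G : SimpleGraph V}

/-- The segments of the edge underlying the dart `d`. -/
def segs (Γ : GridDrawing G) (d : G.Dart) : List ((ℤ × ℤ) × (ℤ × ℤ)) :=
  polySegs (Γ.pos d.fst :: (Γ.bends d ++ [Γ.pos d.snd]))

/-- A `k`-bend drawing: every edge has at most `k` bends. -/
def IsBend (Γ : GridDrawing G) (k : ℕ) : Prop := ∀ d : G.Dart, (Γ.bends d).length ≤ k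

/-- A right-angle-crossing drawing: every point shared by two distinct edges is either (the position
of) a common endvertex, or a crossing of two segments in points interior to both (so not at a bend)
at which the two segments form an angle of 90 degrees. -/
def IsRAC (Γ : GridDrawing G) : Prop :=
  ∀ d₁ d₂ : G.Dart, d₁.edge ≠ d₂.edge →
    ∀ s ∈ Γ.segs d₁, ∀ t ∈ Γ.segs d₂, ∀ p ∈ segSet s ∩ segSet t,
      (∃ w : V, w ∈ d₁.edge ∧ w ∈ d₂.edge ∧ p = gridToPlane (Γ.pos w)) ∨
      (p ≠ gridToPlane s.1 ∧ p ≠ gridToPlane s.2 ∧ p ≠ gridToPlane t.1 ∧ p ≠ gridToPlane t.2 ∧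
        SegPerp s t)

/-- The drawing has area at most `A`: its vertices and bends lie in an axis-parallel rectangle of
the grid with `w + 1` columns and `h + 1` rows where `(w + 1) * (h + 1) ≤ A`. (Grid lines are
counted, so that degenerate rectangles do not have area zero.) -/
def AreaLE (Γ : GridDrawing G) (A : ℕ) : Prop :=
  ∃ (x₀ y₀ : ℤ) (w h : ℕ), (w + 1) * (h + 1) ≤ A ∧
    (∀ v, Γ.pos v ∈ Set.Icc x₀ (x₀ + w) ×ˢ Set.Icc y₀ (y₀ + h)) ∧
    ∀ d, ∀ b ∈ Γ.bends d, b ∈ Set.Icc x₀ (x₀ + w) ×ˢ Set.Icc y₀ (y₀ + h)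

end GridDrawing

/-! ### A word RAM with a step count

The memory consists of registers and arrays, numbered by natural numbers; a program, being a finite
object, names only finitely many of them. All words are natural numbers, and a run in which a word
larger than the bound `W` is stored, or a cell whose address is larger than `W` is written, is not
legal. So if `W` is polynomial in the input size then words have logarithmically many bits; this
covers intermediate results too, because the expressions of a program have constant size and hence
values at most polynomial in `W`. The arithmetic operations are addition, truncated subtraction,
multiplication and integer division (with quotient zero on division by zero), each at unit cost. -/

namespace WordRAM

structure State where
  reg : ℕ → ℕ
  arr : ℕ → ℕ → ℕ

/-- Expressions; `arr a i` reads the cell of the array `a` whose address is the value of `i`. -/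
inductive Expr where
  | const (k : ℕ)
  | reg (x : ℕ)
  | arr (a : ℕ) (i : Expr)
  | add (e₁ e₂ : Expr)
  | sub (e₁ e₂ : Expr)
  | mul (e₁ e₂ : Expr)
  | div (e₁ e₂ : Expr)

def Expr.eval (σ : State) : Expr → ℕ
  | .const k => k
  | .reg x => σ.reg x
  | .arr a i => σ.arr a (i.eval σ)
  | .add e₁ e₂ => e₁.eval σ + e₂.eval σ
  | .sub e₁ e₂ => e₁.eval σ - e₂.eval σ
  | .mul e₁ e₂ => e₁.eval σ * e₂.eval σ
  | .div e₁ e₂ => e₁.eval σ / e₂.eval σ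

/-- One step for each memory access, literal and arithmetic operation. -/
def Expr.cost : Expr → ℕ
  | .const _ => 1
  | .reg _ => 1
  | .arr _ i => i.cost + 1
  | .add e₁ e₂ => e₁.cost + e₂.cost + 1
  | .sub e₁ e₂ => e₁.cost + e₂.cost + 1
  | .mul e₁ e₂ => e₁.cost + e₂.cost + 1
  | .div e₁ e₂ => e₁.cost + e₂.cost + 1

inductive Test where
  | lt (e₁ e₂ : Expr)
  | eq (e₁ e₂ : Expr)
  | not (b : Test)
  | and (b₁ b₂ : Test)

def Test.Holds (σ : State) : Test → Prop
  | .lt e₁ e₂ => e₁.eval σ < e₂.eval σ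
  | .eq e₁ e₂ => e₁.eval σ = e₂.eval σ
  | .not b => ¬ b.Holds σ
  | .and b₁ b₂ => b₁.Holds σ ∧ b₂.Holds σ

def Test.cost : Test → ℕ
  | .lt e₁ e₂ => e₁.cost + e₂.cost + 1
  | .eq e₁ e₂ => e₁.cost + e₂.cost + 1
  | .not b => b.cost + 1
  | .and b₁ b₂ => b₁.cost + b₂.cost + 1

inductive Program where
  | skip
  | set (x : ℕ) (e : Expr)
  | store (a : ℕ) (i e : Expr)
  | seq (P Q : Program)
  | ite (b : Test) (P Q : Program)
  | while (b : Test) (P : Program)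

def State.setReg (σ : State) (x v : ℕ) : State where
  reg := Function.update σ.reg x v
  arr := σ.arr

def State.setArr (σ : State) (a i v : ℕ) : State where
  reg := σ.reg
  arr := Function.update σ.arr a (Function.update (σ.arr a) i v)

/-- `Runs W P σ t τ`: with words bounded by `W`, the program `P` started in the state `σ` halts in
the state `τ` after exactly `t` steps. -/
inductive Runs (W : ℕ) : Program → State → ℕ → State → Prop
  | skip (σ : State) : Runs W .skip σ 1 σ
  | set (x : ℕ) (e : Expr) (σ : State) (hv : e.eval σ ≤ W) :
      Runs W (.set x e) σ (e.cost + 1) (σ.setReg x (e.eval σ))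
  | store (a : ℕ) (i e : Expr) (σ : State) (hi : i.eval σ ≤ W) (hv : e.eval σ ≤ W) :
      Runs W (.store a i e) σ (i.cost + e.cost + 1) (σ.setArr a (i.eval σ) (e.eval σ))
  | seq {P Q : Program} {σ τ ρ : State} {t u : ℕ} (hP : Runs W P σ t τ) (hQ : Runs W Q τ u ρ) :
      Runs W (.seq P Q) σ (t + u) ρ
  | ite_true {b : Test} {P Q : Program} {σ τ : State} {t : ℕ} (hb : b.Holds σ)
      (hP : Runs W P σ t τ) : Runs W (.ite b P Q) σ (b.cost + t + 1) τ
  | ite_false {b : Test} {P Q : Program} {σ τ : State} {t : ℕ} (hb : ¬ b.Holds σ)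
      (hQ : Runs W Q σ t τ) : Runs W (.ite b P Q) σ (b.cost + t + 1) τ
  | while_true {b : Test} {P : Program} {σ τ ρ : State} {t u : ℕ} (hb : b.Holds σ)
      (hP : Runs W P σ t τ) (hloop : Runs W (.while b P) τ u ρ) :
      Runs W (.while b P) σ (b.cost + t + u + 1) ρ
  | while_false {b : Test} {P : Program} {σ : State} (hb : ¬ b.Holds σ) :
      Runs W (.while b P) σ (b.cost + 1) σ

end WordRAM

/-! ### Input and output of the drawing algorithm -/

/-- `e` lists every edge of `G` exactly once, each in an arbitrary one of its two orientations. -/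
def IsEdgeList {V : Type*} {G : SimpleGraph V} {m : ℕ} (e : Fin m → G.Dart) : Prop :=
  ∀ x ∈ G.edgeSet, ∃! i, (e i).edge = x

/-- The initial memory for a graph with vertices `0, …, n - 1`, edges `e 0, …, e (m - 1)` and an
edge-coloring `κ`: register `0` holds `n`, register `1` holds `m`, and the cell `i < m` of the arrays
`0`, `1`, `2` holds the two ends and the color of the edge `e i`. All other memory is zero. -/
def inputState {n m : ℕ} {G : SimpleGraph (Fin n)} (κ : G.lineGraph.Coloring (Fin 7))
    (e : Fin m → G.Dart) : WordRAM.State where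
  reg x := if x = 0 then n else if x = 1 then m else 0
  arr a i := if h : i < m then
      (if a = 0 then ((e ⟨i, h⟩).fst : ℕ)
      else if a = 1 then ((e ⟨i, h⟩).snd : ℕ)
      else if a = 2 then (κ ⟨(e ⟨i, h⟩).edge, (e ⟨i, h⟩).edge_mem⟩ : ℕ)
      else 0)
    else 0

/-- The final memory `τ` describes the drawing `Γ`: the arrays `3`, `4` hold the coordinates of the
vertices, the array `5` holds the number of bends of each edge `e i`, and the arrays `6 + 2 * j` and
`7 + 2 * j` hold the coordinates of its `j`-th bend (from the first to the second end of `e i`). -/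
def OutputsDrawing {n m : ℕ} {G : SimpleGraph (Fin n)} (e : Fin m → G.Dart) (τ : WordRAM.State)
    (Γ : GridDrawing G) : Prop :=
  (∀ v : Fin n, Γ.pos v = ((τ.arr 3 v : ℤ), (τ.arr 4 v : ℤ))) ∧
  ∀ i : Fin m, Γ.bends (e i) = (List.range (τ.arr 5 i)).map
    fun j => ((τ.arr (6 + 2 * j) i : ℤ), (τ.arr (7 + 2 * j) i : ℤ))

/-! The four colors from 2 to 5 can be drawn for any two orders of the vertices, and the other three
colors are used to choose these orders. Let `px` and `py` be injective numberings and put `v` at the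
center of the 8 by 8 cell in column `px v` and row `py v`; no two vertices share a row or a column
of cells.

An edge of color 2, 3, 4 or 5 (kind 0, 1, 2 or 3) leaves one end along an axis, turns into a grid
line reserved for its kind at the other end, and reaches that end by a short oblique segment. The
four kinds leave in the four axis directions, and each is a matching, so no half line and no
reserved line is claimed twice. An edge whose ends are consecutive in `px` (kind 4) goes obliquely
from both ends to the border column between their cells, which no other edge uses for a vertical
segment; kind 5 is the same for `py`. Oblique segments are met by other edges only in common ends,
and axis-parallel segments do not overlap, so what remains are crossings of horizontal with vertical
segments. This is `Layout.SegOf.allowed`, which rests on `HSeg.inter_HSeg`, `HSeg.inter_transpose`,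
`OSeg.inter_OSeg` and `OSeg.inter_HSeg`; exchanging the axes halves the work.

It remains to cover the colors 0, 1 and 6 by two linear forests; numbering the vertices along the
paths of the forests gives `px` and `py`. Start with color 0 as first and color 6 as second forest,
and insert the edges `ab` of color 1 one at a time. If `a` and `b` are not the two ends of one path
of the first forest, `ab` goes there (`joinPaths`). Otherwise, if they are not the two ends of one
path of the second forest, it goes there. Otherwise let `ac` be the edge of color 0 at `a` in the
first forest: closing the path with `ab` and removing `ac` leaves a path again (`rotate`), and `ac`
can be added to the second forest, where the path from `a` ends at `b` and not at `c`
(`ForestPair.exchange`). The degree of `c` in the second forest permits this because of the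
invariant that a vertex gets an additional edge there only when all vertices of its path in the
first forest are done, that is, their edges of color 1 have been treated.

With the other end stored at each end of a path, every insertion takes constant time, and
`Traversal` numbers the vertices in `2 * n + 1` rounds. As there are at most `7 * n` edges, the
total time is linear. The pure existence statement follows from the correctness of the same program.
-/

/-! ### Weakest preconditions and counting loops for word RAM programs -/

namespace WordRAM

@[simp] theorem State.setReg_reg (σ : State) (x v y : ℕ) :
    (σ.setReg x v).reg y = if y = x then v else σ.reg y := by
  simp [State.setReg, Function.update_apply]

@[simp] theorem State.setReg_arr (σ : State) (x v : ℕ) : (σ.setReg x v).arr = σ.arr := rfl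

@[simp] theorem State.setArr_reg (σ : State) (a i v : ℕ) : (σ.setArr a i v).reg = σ.reg := rfl

@[simp] theorem State.setArr_arr (σ : State) (a i v b : ℕ) :
    (σ.setArr a i v).arr b = if b = a then Function.update (σ.arr a) i v else σ.arr b := by
  simp [State.setArr, Function.update_apply]

/-- An upper bound for the number of steps of a program without loops. -/
def Program.cost : Program → ℕ
  | .skip => 1
  | .set _ e => e.cost + 1
  | .store _ i e => i.cost + e.cost + 1
  | .seq P Q => P.cost + Q.cost
  | .ite b P Q => b.cost + P.cost + Q.cost + 1
  | .while _ _ => 0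

/-- The weakest precondition of a program without loops, with words bounded by `W`. -/
def Program.wp (W : ℕ) : Program → (State → Prop) → State → Prop
  | .skip, Φ, σ => Φ σ
  | .set x e, Φ, σ => e.eval σ ≤ W ∧ Φ (σ.setReg x (e.eval σ))
  | .store a i e, Φ, σ => i.eval σ ≤ W ∧ e.eval σ ≤ W ∧ Φ (σ.setArr a (i.eval σ) (e.eval σ))
  | .seq P Q, Φ, σ => P.wp W (Q.wp W Φ) σ
  | .ite b P Q, Φ, σ => (b.Holds σ → P.wp W Φ σ) ∧ (¬ b.Holds σ → Q.wp W Φ σ)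
  | .while _ _, _, _ => False

/-- Started in `σ`, the program halts after at most `K` steps in a state satisfying `Φ`. -/
def RunsTo (W : ℕ) (P : Program) (σ : State) (K : ℕ) (Φ : State → Prop) : Prop :=
  ∃ t τ, Runs W P σ t τ ∧ t ≤ K ∧ Φ τ

/-- Reduces the analysis of a loop body to a formula that `simp` can unfold. Both branches of a
conditional are charged, so that the bound depends on the program text only and not on the state. -/
theorem RunsTo.of_wp {W : ℕ} {P : Program} {Φ : State → Prop} {σ : State} (h : P.wp W Φ σ) :
    RunsTo W P σ P.cost Φ := by
  induction P generalizing Φ σ with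
  | skip => exact ⟨_, _, .skip σ, le_rfl, h⟩
  | set x e => exact ⟨_, _, .set x e σ h.1, le_rfl, h.2⟩
  | store a i e => exact ⟨_, _, .store a i e σ h.1 h.2.1, le_rfl, h.2.2⟩
  | seq P Q ihP ihQ =>
    obtain ⟨t, τ, hP, ht, hτ⟩ := ihP h
    obtain ⟨u, ρ, hQ, hu, hρ⟩ := ihQ hτ
    exact ⟨_, _, .seq hP hQ, Nat.add_le_add ht hu, hρ⟩
  | ite b P Q ihP ihQ =>
    by_cases hb : b.Holds σ
    · obtain ⟨t, τ, hP, ht, hτ⟩ := ihP (h.1 hb)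
      exact ⟨_, _, .ite_true hb hP, by simp only [Program.cost]; omega, hτ⟩
    · obtain ⟨t, τ, hP, ht, hτ⟩ := ihQ (h.2 hb)
      exact ⟨_, _, .ite_false hb hP, by simp only [Program.cost]; omega, hτ⟩
  | _ => exact h.elim

theorem RunsTo.seq {W : ℕ} {P Q : Program} {σ : State} {K L : ℕ} {Φ Ψ : State → Prop}
    (hP : RunsTo W P σ K Φ) (hQ : ∀ τ, Φ τ → RunsTo W Q τ L Ψ) :
    RunsTo W (.seq P Q) σ (K + L) Ψ := by
  obtain ⟨t, τ, hP, ht, hτ⟩ := hP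
  obtain ⟨u, ρ, hQ, hu, hρ⟩ := hQ τ hτ
  exact ⟨_, _, .seq hP hQ, Nat.add_le_add ht hu, hρ⟩

theorem RunsTo.mono {W : ℕ} {P : Program} {σ : State} {K L : ℕ} {Φ Ψ : State → Prop}
    (hP : RunsTo W P σ K Φ) (hKL : K ≤ L) (h : ∀ τ, Φ τ → Ψ τ) : RunsTo W P σ L Ψ := by
  obtain ⟨t, τ, hP, ht, hτ⟩ := hP
  exact ⟨t, τ, hP, ht.trans hKL, h τ hτ⟩

/-- Run the body while register `2` counts from `0` up to the value of `N`. -/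
def forLoop (N : Expr) (body : Program) : Program :=
  .seq (.set 2 (.const 0))
    (.while (.lt (.reg 2) N) (.seq body (.set 2 (.add (.reg 2) (.const 1)))))

/-- The body is run `N` times; `I k` holds, with the counter set to `k`, before the round `k`. -/
theorem RunsTo.forLoop {W : ℕ} {e : Expr} {body : Program} {σ : State} (N : ℕ)
    (I : ℕ → State → Prop) (hN : N ≤ W) (he : ∀ k τ, I k τ → e.eval τ = N)
    (h0 : I 0 (σ.setReg 2 0))
    (hI : ∀ k τ, k < N → τ.reg 2 = k → I k τ →
      body.wp W (fun ρ => ρ.reg 2 = k ∧ I (k + 1) (ρ.setReg 2 (k + 1))) τ) :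
    RunsTo W (forLoop e body) σ ((N + 1) * (body.cost + e.cost + 10)) (I N) := by
  -- Induction on the number `j` of remaining rounds; the summand `e.cost + 3` pays for the final
  -- test, which fails.
  have key : ∀ j k τ, k + j = N → τ.reg 2 = k → I k τ →
      RunsTo W (.while (.lt (.reg 2) e) (.seq body (.set 2 (.add (.reg 2) (.const 1))))) τ
        (j * (body.cost + e.cost + 8) + (e.cost + 3)) (I N) := by
    intro j
    induction j with
    | zero =>
      intro k τ hk h2 hτ
      refine ⟨_, τ, .while_false ?_, ?_, ?_⟩
      · simp only [Test.Holds, Expr.eval, h2, he k τ hτ]; omega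
      · simp only [Test.cost, Expr.cost]; omega
      · rw [← hk]; simpa using hτ
    | succ j ih =>
      intro k τ hk h2 hτ
      obtain ⟨t, ρ, hr, ht, hρ2, hρ⟩ := RunsTo.of_wp (hI k τ (by omega) h2 hτ)
      have hs : Runs W (.set 2 (.add (.reg 2) (.const 1))) ρ 4 (ρ.setReg 2 (k + 1)) := by
        have := Runs.set (W := W) 2 (.add (.reg 2) (.const 1)) ρ
          (by simp only [Expr.eval, hρ2]; omega)
        simpa only [Expr.eval, Expr.cost, hρ2] using this
      obtain ⟨u, ρ', hr', hu, hρ'⟩ := ih (k + 1) _ (by omega) (by simp) hρ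
      refine ⟨_, ρ', .while_true ?_ (.seq hr hs) hr', ?_, hρ'⟩
      · simp only [Test.Holds, Expr.eval, h2, he k τ hτ]; omega
      · simp only [Test.cost, Expr.cost]
        rw [Nat.succ_mul]; omega
  obtain ⟨t, τ, hr, ht, hτ⟩ := key N 0 (σ.setReg 2 0) (by omega) (by simp) h0
  refine ⟨_, τ, .seq (.set 2 (.const 0) σ (by simp [Expr.eval])) hr, ?_, hτ⟩
  simp only [Expr.cost]
  nlinarith

end WordRAM

/-! ### Geometry of the drawing -/

/-- Two linear orders of the vertices, and a partition of the edges into six kinds of which the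
first four are matchings. -/
structure Layout (V : Type*) where
  px : V → ℤ
  py : V → ℤ
  edges : Set (Sym2 V)
  kind : Sym2 V → ℕ
  px_inj : Function.Injective px
  py_inj : Function.Injective py
  proper : ∀ e ∈ edges, ∀ f ∈ edges, ∀ v ∈ e, v ∈ f → kind e = kind f → kind e < 4 → e = f

namespace Layout

variable {V : Type*}

/-- The kind that takes the role of the given one when the axes are exchanged. -/
def swapKind (k : ℕ) : ℕ :=
  if k = 0 then 2 else if k = 1 then 3 else if k = 2 then 0 else if k = 3 then 1
  else if k = 4 then 5 else if k = 5 then 4 else k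

theorem swapKind_swapKind (k : ℕ) : swapKind (swapKind k) = k := by
  rcases lt_or_ge k 6 with h | h
  · interval_cases k <;> rfl
  · have h' : swapKind k = k := by
      unfold swapKind
      rw [if_neg, if_neg, if_neg, if_neg, if_neg, if_neg] <;> omega
    rw [h', h']

theorem swapKind_lt {k : ℕ} (h : swapKind k < 4) : k < 4 := by
  unfold swapKind at h; split_ifs at h <;> omega

/-- Exchange the two axes. -/
def transpose (L : Layout V) : Layout V where
  px := L.py
  py := L.px
  edges := L.edges
  kind e := swapKind (L.kind e)
  px_inj := L.py_inj
  py_inj := L.px_inj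
  proper e he f hf v hve hvf h hk :=
    L.proper e he f hf v hve hvf (by rw [← swapKind_swapKind (L.kind e), h, swapKind_swapKind])
      (swapKind_lt hk)

theorem transpose_transpose (L : Layout V) : L.transpose.transpose = L := by
  cases L; simp [transpose, swapKind_swapKind]

/-! ### Axis-parallel segments and their intersections -/

/-- The edge `e` has a horizontal segment from `(lo, row)` to `(hi, row)`. -/
inductive HSeg (L : Layout V) (e : Sym2 V) (lo hi row : ℤ) : Prop
  | left (r l : V) (he : e ∈ L.edges) (e_eq : e = s(r, l)) (hk : L.kind e = 0)
      (hlt : L.px l < L.px r) (hlo : lo = 8 * L.px l + 6) (hhi : hi = 8 * L.px r + 4)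
      (hrow : row = 8 * L.py r + 4)
  | right (l r : V) (he : e ∈ L.edges) (e_eq : e = s(l, r)) (hk : L.kind e = 1)
      (hlt : L.px l < L.px r) (hlo : lo = 8 * L.px l + 4) (hhi : hi = 8 * L.px r + 2)
      (hrow : row = 8 * L.py l + 4)
  | up (b t : V) (he : e ∈ L.edges) (e_eq : e = s(b, t)) (hk : L.kind e = 2)
      (hlt : L.py b < L.py t)
      (hx : (L.px b < L.px t ∧ lo = 8 * L.px b + 7 ∧ hi = 8 * L.px t + 4) ∨
        (L.px t < L.px b ∧ lo = 8 * L.px t + 4 ∧ hi = 8 * L.px b + 1))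
      (hrow : row = 8 * L.py b + 6)
  | down (t b : V) (he : e ∈ L.edges) (e_eq : e = s(t, b)) (hk : L.kind e = 3)
      (hlt : L.py b < L.py t)
      (hx : (L.px t < L.px b ∧ lo = 8 * L.px t + 7 ∧ hi = 8 * L.px b + 4) ∨
        (L.px b < L.px t ∧ lo = 8 * L.px b + 4 ∧ hi = 8 * L.px t + 1))
      (hrow : row = 8 * L.py t + 2)
  | between (u v : V) (he : e ∈ L.edges) (e_eq : e = s(u, v)) (hk : L.kind e = 5)
      (hnext : L.py v = L.py u + 1)
      (hx : (L.px u < L.px v ∧ lo = 8 * L.px u + 5 ∧ hi = 8 * L.px v + 5) ∨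
        (L.px v < L.px u ∧ lo = 8 * L.px v + 5 ∧ hi = 8 * L.px u + 5))
      (hrow : row = 8 * L.py u + 8)

theorem HSeg.lt {L : Layout V} {e : Sym2 V} {lo hi row : ℤ} (h : L.HSeg e lo hi row) :
    lo < hi := by
  cases h <;> omega

/-- Horizontal segments of distinct edges meet only in common ends. -/
theorem HSeg.inter_HSeg {L : Layout V} {e f : Sym2 V} {lo hi lo' hi' row : ℤ} (hef : e ≠ f)
    (h : L.HSeg e lo hi row) (h' : L.HSeg f lo' hi' row) {z : ℝ}
    (hz : (lo : ℝ) ≤ z ∧ z ≤ hi) (hz' : (lo' : ℝ) ≤ z ∧ z ≤ hi') :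
    ∃ v, v ∈ e ∧ v ∈ f ∧ z = ((8 * L.px v + 4 : ℤ) : ℝ) ∧ row = 8 * L.py v + 4 := by
  have key : ∀ v, v ∈ e → v ∈ f → e ∈ L.edges → f ∈ L.edges → L.kind e = L.kind f →
      L.kind e < 4 → False := fun v h1 h2 h3 h4 h5 h6 => hef (L.proper e h3 f h4 v h1 h2 h5 h6)
  have hpy : ∀ {v w}, L.py v = L.py w → v = w := fun h => L.py_inj h
  have h1 : (lo : ℝ) ≤ hi' := hz.1.trans hz'.2
  have h2 : (lo' : ℝ) ≤ hi := hz'.1.trans hz.2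
  norm_cast at h1 h2
  -- Modulo 8 the row is 4 for `left` and `right`, 6 for `up`, 2 for `down` and 0 for `between`. So
  -- `omega` refutes all pairs with different residues, and in the others equal rows give equal
  -- vertices.
  rcases h with ⟨r, l, he, e_eq, hk, hlt, hlo, hhi, hrow⟩ | ⟨l, r, he, e_eq, hk, hlt, hlo, hhi, hrow⟩ |
    ⟨b, t, he, e_eq, hk, hlt, hx, hrow⟩ | ⟨t, b, he, e_eq, hk, hlt, hx, hrow⟩ |
    ⟨u, v, he, e_eq, hk, hnext, hx, hrow⟩ <;>
  rcases h' with ⟨r', l', he', e_eq', hk', hlt', hlo', hhi', hrow'⟩ |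
    ⟨l', r', he', e_eq', hk', hlt', hlo', hhi', hrow'⟩ |
    ⟨b', t', he', e_eq', hk', hlt', hx', hrow'⟩ | ⟨t', b', he', e_eq', hk', hlt', hx', hrow'⟩ |
    ⟨u', v', he', e_eq', hk', hnext', hx', hrow'⟩ <;>
  first
  | (exfalso; omega)
  | skip
  · obtain rfl : r = r' := hpy (by omega)
    exact (key r (by simp [e_eq]) (by simp [e_eq']) he he' (by omega) (by omega)).elim
  -- At the same vertex, `left` and `right` point in opposite directions and share the center only.
  · obtain rfl : r = l' := hpy (by omega)
    refine ⟨r, by simp [e_eq], by simp [e_eq'], ?_, hrow⟩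
    rw [← hhi]; refine le_antisymm hz.2 ?_
    rw [hhi, ← hlo']; exact hz'.1
  · obtain rfl : l = r' := hpy (by omega)
    refine ⟨l, by simp [e_eq], by simp [e_eq'], ?_, hrow⟩
    rw [← hlo]; refine le_antisymm ?_ hz.1
    rw [hlo, ← hhi']; exact hz'.2
  · obtain rfl : l = l' := hpy (by omega)
    exact (key l (by simp [e_eq]) (by simp [e_eq']) he he' (by omega) (by omega)).elim
  · obtain rfl : b = b' := hpy (by omega)
    exact (key b (by simp [e_eq]) (by simp [e_eq']) he he' (by omega) (by omega)).elim
  · obtain rfl : t = t' := hpy (by omega)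
    exact (key t (by simp [e_eq]) (by simp [e_eq']) he he' (by omega) (by omega)).elim
  -- A border row determines the vertices on both of its sides, hence the edge.
  · obtain rfl : u = u' := hpy (by omega)
    obtain rfl : v = v' := hpy (by omega)
    exact (hef (e_eq.trans e_eq'.symm)).elim

/-- Where a horizontal and a vertical segment of distinct edges meet, the former does not end,
unless it is a common end of the edges. -/
theorem HSeg.inter_transpose {L : Layout V} {e f : Sym2 V} {lo hi row lo' hi' col : ℤ}
    (hef : e ≠ f) (h : L.HSeg e lo hi row) (h' : L.transpose.HSeg f lo' hi' col)
    (hc : lo ≤ col ∧ col ≤ hi) (hr : lo' ≤ row ∧ row ≤ hi') :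
    (∃ v, v ∈ e ∧ v ∈ f ∧ col = 8 * L.px v + 4 ∧ row = 8 * L.py v + 4) ∨ (lo < col ∧ col < hi) := by
  have key : ∀ v, v ∈ e → v ∈ f → e ∈ L.edges → f ∈ L.edges → L.kind e = L.kind f →
      L.kind e < 4 → False := fun v h1 h2 h3 h4 h5 h6 => hef (L.proper e h3 f h4 v h1 h2 h5 h6)
  have hpx : ∀ {v w}, L.px v = L.px w → v = w := fun h => L.px_inj h
  have hsw : ∀ {k : ℕ}, swapKind (L.kind f) = k → L.kind f = swapKind k := by
    rintro k rfl; rw [swapKind_swapKind]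
  by_cases hin : lo < col ∧ col < hi
  · exact .inr hin
  -- Now `col` is `lo` or `hi`. Ends of horizontal segments are 1, 2, 4, 5, 6 or 7 modulo 8 and
  -- columns of vertical ones are 0, 2, 4 or 6. A coincidence at 2 or 6 means two edges of the same
  -- matching at one vertex; at 4 the column passes through a vertex.
  rcases h' with ⟨r', l', he', e_eq', hk', hlt', hlo', hhi', hrow'⟩ |
    ⟨l', r', he', e_eq', hk', hlt', hlo', hhi', hrow'⟩ |
    ⟨b', t', he', e_eq', hk', hlt', hx', hrow'⟩ | ⟨t', b', he', e_eq', hk', hlt', hx', hrow'⟩ |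
    ⟨u', v', he', e_eq', hk', hnext', hx', hrow'⟩ <;>
  have hk'' := hsw hk' <;>
  norm_num [swapKind] at hk'' <;>
  simp only [transpose] at * <;>
  rcases h with ⟨r, l, he, e_eq, hk, hlt, hlo, hhi, hrow⟩ | ⟨l, r, he, e_eq, hk, hlt, hlo, hhi, hrow⟩ |
    ⟨b, t, he, e_eq, hk, hlt, hx, hrow⟩ | ⟨t, b, he, e_eq, hk, hlt, hx, hrow⟩ |
    ⟨u, v, he, e_eq, hk, hnext, hx, hrow⟩ <;>
  first
  | (exfalso; omega)
  | skip
  · obtain rfl : r = r' := hpx (by omega)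
    exact .inl ⟨r, by simp [e_eq], by simp [e_eq'], hrow', hrow⟩
  · obtain rfl : l = r' := hpx (by omega)
    exact .inl ⟨l, by simp [e_eq], by simp [e_eq'], hrow', hrow⟩
  · obtain rfl : t = r' := hpx (by omega)
    exact (key t (by simp [e_eq]) (by simp [e_eq']) he he' (by omega) (by omega)).elim
  -- The horizontal segment lies above `b`, while the vertical one leaves `b` downwards.
  · obtain rfl : b = r' := hpx (by omega)
    omega
  · obtain rfl : r = l' := hpx (by omega)
    exact .inl ⟨r, by simp [e_eq], by simp [e_eq'], hrow', hrow⟩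
  · obtain rfl : l = l' := hpx (by omega)
    exact .inl ⟨l, by simp [e_eq], by simp [e_eq'], hrow', hrow⟩
  · obtain rfl : t = l' := hpx (by omega)
    omega
  · obtain rfl : b = l' := hpx (by omega)
    exact (key b (by simp [e_eq]) (by simp [e_eq']) he he' (by omega) (by omega)).elim
  · obtain rfl : l = b' := hpx (by omega)
    exact (key l (by simp [e_eq]) (by simp [e_eq']) he he' (by omega) (by omega)).elim
  · obtain rfl : r = t' := hpx (by omega)
    exact (key r (by simp [e_eq]) (by simp [e_eq']) he he' (by omega) (by omega)).elim

/-! ### Oblique segments and their intersections -/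

/-- The edge `e` has an oblique segment which starts at its end `v` in the direction `(dx, dy)`. -/
inductive OSeg (L : Layout V) (e : Sym2 V) (v : V) (dx dy : ℤ) : Prop
  | zero (he : e ∈ L.edges) (hv : v ∈ e) (hk : L.kind e = 0) (hdx : dx = 2)
      (hdy : dy = 3 ∨ dy = -3)
  | one (he : e ∈ L.edges) (hv : v ∈ e) (hk : L.kind e = 1) (hdx : dx = -2)
      (hdy : dy = 3 ∨ dy = -3)
  | two (he : e ∈ L.edges) (hv : v ∈ e) (hk : L.kind e = 2) (hdx : dx = 3 ∨ dx = -3)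
      (hdy : dy = 2)
  | three (he : e ∈ L.edges) (hv : v ∈ e) (hk : L.kind e = 3) (hdx : dx = 3 ∨ dx = -3)
      (hdy : dy = -2)
  | next_x (w : V) (he : e ∈ L.edges) (e_eq : e = s(v, w)) (hk : L.kind e = 4)
      (hw : L.px w = L.px v + 1) (hdx : dx = 4) (hdy : dy = 1)
  | prev_x (w : V) (he : e ∈ L.edges) (e_eq : e = s(w, v)) (hk : L.kind e = 4)
      (hw : L.px v = L.px w + 1) (hdx : dx = -4) (hdy : dy = 1)
  | next_y (w : V) (he : e ∈ L.edges) (e_eq : e = s(v, w)) (hk : L.kind e = 5)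
      (hw : L.py w = L.py v + 1) (hdx : dx = 1) (hdy : dy = 4)
  | prev_y (w : V) (he : e ∈ L.edges) (e_eq : e = s(w, v)) (hk : L.kind e = 5)
      (hw : L.py v = L.py w + 1) (hdx : dx = 1) (hdy : dy = -4)

theorem OSeg.mem {L : Layout V} {e : Sym2 V} {v : V} {dx dy : ℤ} (h : L.OSeg e v dx dy) :
    v ∈ e := by
  cases h <;> simp [*]

theorem OSeg.transpose {L : Layout V} {e : Sym2 V} {v : V} {dx dy : ℤ} (h : L.OSeg e v dx dy) :
    L.transpose.OSeg e v dy dx := by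
  have hs : ∀ k, L.kind e = k → L.transpose.kind e = swapKind k := by rintro k rfl; rfl
  rcases h with ⟨he, hv, hk, hdx, hdy⟩ | ⟨he, hv, hk, hdx, hdy⟩ | ⟨he, hv, hk, hdx, hdy⟩ |
    ⟨he, hv, hk, hdx, hdy⟩ | ⟨w, he, e_eq, hk, hw, hdx, hdy⟩ | ⟨w, he, e_eq, hk, hw, hdx, hdy⟩ |
    ⟨w, he, e_eq, hk, hw, hdx, hdy⟩ | ⟨w, he, e_eq, hk, hw, hdx, hdy⟩
  · exact .two he hv (hs _ hk) hdy hdx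
  · exact .three he hv (hs _ hk) hdy hdx
  · exact .zero he hv (hs _ hk) hdy hdx
  · exact .one he hv (hs _ hk) hdy hdx
  · exact .next_y w he e_eq (hs _ hk) hw hdy hdx
  · exact .prev_y w he e_eq (hs _ hk) hw hdy hdx
  · exact .next_x w he e_eq (hs _ hk) hw hdy hdx
  · exact .prev_x w he e_eq (hs _ hk) hw hdy hdx

/-- An oblique segment is determined by its starting point and its direction. -/
theorem OSeg.unique {L : Layout V} {e f : Sym2 V} {v : V} {dx dy : ℤ} (h : L.OSeg e v dx dy)
    (h' : L.OSeg f v dx dy) : e = f := by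
  have key : v ∈ e → v ∈ f → e ∈ L.edges → f ∈ L.edges → L.kind e = L.kind f →
      L.kind e < 4 → e = f := fun h1 h2 h3 h4 h5 h6 => L.proper e h3 f h4 v h1 h2 h5 h6
  have hpx : ∀ {v w}, L.px v = L.px w → v = w := fun h => L.px_inj h
  have hpy : ∀ {v w}, L.py v = L.py w → v = w := fun h => L.py_inj h
  rcases h with ⟨he, hv, hk, hdx, hdy⟩ | ⟨he, hv, hk, hdx, hdy⟩ | ⟨he, hv, hk, hdx, hdy⟩ |
    ⟨he, hv, hk, hdx, hdy⟩ | ⟨w, he, e_eq, hk, hw, hdx, hdy⟩ | ⟨w, he, e_eq, hk, hw, hdx, hdy⟩ |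
    ⟨w, he, e_eq, hk, hw, hdx, hdy⟩ | ⟨w, he, e_eq, hk, hw, hdx, hdy⟩ <;>
  rcases h' with ⟨he', hv', hk', hdx', hdy'⟩ | ⟨he', hv', hk', hdx', hdy'⟩ |
    ⟨he', hv', hk', hdx', hdy'⟩ |
    ⟨he', hv', hk', hdx', hdy'⟩ | ⟨w', he', e_eq', hk', hw', hdx', hdy'⟩ |
    ⟨w', he', e_eq', hk', hw', hdx', hdy'⟩ |
    ⟨w', he', e_eq', hk', hw', hdx', hdy'⟩ | ⟨w', he', e_eq', hk', hw', hdx', hdy'⟩ <;>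
  first
  | (exfalso; omega)
  | exact key hv hv' he he' (by omega) (by omega)
  | exact e_eq.trans ((congrArg (fun x => s(v, x)) (hpx (by omega))).trans e_eq'.symm)
  | exact e_eq.trans ((congrArg (fun x => s(x, v)) (hpx (by omega))).trans e_eq'.symm)
  | exact e_eq.trans ((congrArg (fun x => s(v, x)) (hpy (by omega))).trans e_eq'.symm)
  | exact e_eq.trans ((congrArg (fun x => s(x, v)) (hpy (by omega))).trans e_eq'.symm)

/-- The possible directions of oblique segments. -/
def directions : List (ℤ × ℤ) :=
  [(2, 3), (2, -3), (-2, 3), (-2, -3), (3, 2), (-3, 2), (3, -2), (-3, -2), (4, 1), (-4, 1),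
    (1, 4), (1, -4)]

theorem OSeg.mem_directions {L : Layout V} {e : Sym2 V} {v : V} {dx dy : ℤ}
    (h : L.OSeg e v dx dy) : (dx, dy) ∈ directions := by
  rcases h with ⟨he, hv, hk, rfl, rfl | rfl⟩ | ⟨he, hv, hk, rfl, rfl | rfl⟩ |
    ⟨he, hv, hk, rfl | rfl, rfl⟩ |
    ⟨he, hv, hk, rfl | rfl, rfl⟩ | ⟨w, he, e_eq, hk, hw, rfl, rfl⟩ |
    ⟨w, he, e_eq, hk, hw, rfl, rfl⟩ |
    ⟨w, he, e_eq, hk, hw, rfl, rfl⟩ | ⟨w, he, e_eq, hk, hw, rfl, rfl⟩ <;> decide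

/-- Parallel directions are equal or opposite. Together with `OSeg.unique` this means that oblique
segments of distinct edges at one vertex share nothing else. -/
theorem directions_cross : ∀ p ∈ directions, ∀ q ∈ directions, p.1 * q.2 = p.2 * q.1 →
    p = q ∨ p = -q := by decide

/-- The value 5 separates oblique segments at different vertices: a common point would bound the sum
of the two coordinate differences by 10, but each difference is at least 8. -/
theorem directions_abs : ∀ p ∈ directions, |p.1| + |p.2| = 5 := by decide

theorem directions_ne : ∀ p ∈ directions, p.1 ≠ 0 ∧ p.2 ≠ 0 := by decide

/-- Oblique segments of distinct edges meet only in common ends. -/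
theorem OSeg.inter_OSeg {L : Layout V} {e f : Sym2 V} {v w : V} {dx dy dx' dy' : ℤ} (hef : e ≠ f)
    (h : L.OSeg e v dx dy) (h' : L.OSeg f w dx' dy') {t t' : ℝ} (ht : 0 ≤ t ∧ t ≤ 1)
    (ht' : 0 ≤ t' ∧ t' ≤ 1)
    (hx : ((8 * L.px v + 4 : ℤ) : ℝ) + t * dx = ((8 * L.px w + 4 : ℤ) : ℝ) + t' * dx')
    (hy : ((8 * L.py v + 4 : ℤ) : ℝ) + t * dy = ((8 * L.py w + 4 : ℤ) : ℝ) + t' * dy') :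
    v = w ∧ t = 0 := by
  have hd := h.mem_directions
  have hd' := h'.mem_directions
  by_cases hvw : v = w
  · subst hvw
    refine ⟨rfl, ?_⟩
    have hx : t * dx = t' * dx' := by linarith
    have hy : t * dy = t' * dy' := by linarith
    by_cases hc : dx * dy' = dy * dx'
    · rcases directions_cross _ hd _ hd' hc with hpq | hpq
      · simp only [Prod.mk.injEq] at hpq
        obtain ⟨rfl, rfl⟩ := hpq
        exact (hef (h.unique h')).elim
      · simp only [Prod.neg_mk, Prod.mk.injEq] at hpq
        obtain ⟨rfl, rfl⟩ := hpq
        have hne : (dx' : ℝ) ≠ 0 := by exact_mod_cast (directions_ne _ hd').1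
        have : (t + t') * (dx' : ℝ) = 0 := by push_cast at hx; linarith
        have := (mul_eq_zero.1 this).resolve_right hne
        linarith [ht.1, ht'.1]
    · have hc' : (dx * dy' - dy * dx' : ℝ) ≠ 0 := by
        rw [sub_ne_zero]; exact_mod_cast hc
      have : t * (dx * dy' - dy * dx' : ℝ) = 0 := by linear_combination dy' * hx - dx' * hy
      exact (mul_eq_zero.1 this).resolve_right hc'
  · exfalso
    have h1 := directions_abs _ hd
    have h2 := directions_abs _ hd'
    simp only at h1 h2
    have h3 : |((8 * L.px v - 8 * L.px w : ℤ) : ℝ)| ≤ |(dx : ℝ)| + |(dx' : ℝ)| := by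
      have : ((8 * L.px v - 8 * L.px w : ℤ) : ℝ) = t' * dx' - t * dx := by
        push_cast at hx ⊢; linarith
      rw [this]
      refine (abs_sub _ _).trans ?_
      rw [abs_mul, abs_mul, abs_of_nonneg ht.1, abs_of_nonneg ht'.1]
      nlinarith [abs_nonneg (dx : ℝ), abs_nonneg (dx' : ℝ)]
    have h4 : |((8 * L.py v - 8 * L.py w : ℤ) : ℝ)| ≤ |(dy : ℝ)| + |(dy' : ℝ)| := by
      have : ((8 * L.py v - 8 * L.py w : ℤ) : ℝ) = t' * dy' - t * dy := by
        push_cast at hy ⊢; linarith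
      rw [this]
      refine (abs_sub _ _).trans ?_
      rw [abs_mul, abs_mul, abs_of_nonneg ht.1, abs_of_nonneg ht'.1]
      nlinarith [abs_nonneg (dy : ℝ), abs_nonneg (dy' : ℝ)]
    have hnx : L.px v ≠ L.px w := fun h => hvw (L.px_inj h)
    have hny : L.py v ≠ L.py w := fun h => hvw (L.py_inj h)
    norm_cast at h3 h4
    have h5 : 8 ≤ |8 * L.px v - 8 * L.px w| := by
      rcases abs_cases (8 * L.px v - 8 * L.px w) with h | h <;> omega
    have h6 : 8 ≤ |8 * L.py v - 8 * L.py w| := by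
      rcases abs_cases (8 * L.py v - 8 * L.py w) with h | h <;> omega
    omega

/-- Oblique and horizontal segments of distinct edges meet only in common ends. -/
theorem OSeg.inter_HSeg {L : Layout V} {e f : Sym2 V} {v : V} {dx dy lo hi row : ℤ} (hef : e ≠ f)
    (h : L.OSeg e v dx dy) (h' : L.HSeg f lo hi row) {t : ℝ} (ht : 0 ≤ t ∧ t ≤ 1)
    (hx : (lo : ℝ) ≤ ((8 * L.px v + 4 : ℤ) : ℝ) + t * dx ∧
      ((8 * L.px v + 4 : ℤ) : ℝ) + t * dx ≤ hi)
    (hy : ((8 * L.py v + 4 : ℤ) : ℝ) + t * dy = row) : v ∈ f ∧ t = 0 := by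
  have hd := h.mem_directions
  have hny := (directions_ne _ hd).2
  obtain ⟨k, hk⟩ : ∃ k : ℤ, row = 8 * L.py v + 4 + k := ⟨row - (8 * L.py v + 4), by ring⟩
  have hkt : t * dy = k := by rw [hk] at hy; push_cast at hy; linarith
  have hpy : ∀ {v w}, L.py v = L.py w → v = w := fun h => L.py_inj h
  -- At height 2 above the center an oblique segment has the horizontal offset `2 * dx / dy`. Its
  -- absolute value reaches 3, where horizontal segments of kind 2 begin, only for the directions
  -- `(3, 2)` and `(-3, 2)` of this kind. The last clause is the mirror image for kind 3.
  have hD : ∀ p ∈ directions, p.2 ≤ 4 ∧ -4 ≤ p.2 ∧ (p.2 = 4 → p.1 = 1) ∧ (p.2 = -4 → p.1 = 1) ∧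
      (2 ≤ p.2 → 3 * p.2 ≤ 2 * p.1 ∨ 3 * p.2 ≤ -2 * p.1 → p.2 = 2 ∧ (p.1 = 3 ∨ p.1 = -3)) ∧
      (p.2 ≤ -2 → -3 * p.2 ≤ 2 * p.1 ∨ -3 * p.2 ≤ -2 * p.1 →
        p.2 = -2 ∧ (p.1 = 3 ∨ p.1 = -3)) := by decide
  obtain ⟨hd1, hd2, hd3, hd4, hd5, hd6⟩ := hD _ hd
  simp only at hd1 hd2 hd3 hd4 hd5 hd6
  have hd1' : (dy : ℝ) ≤ 4 := by exact_mod_cast hd1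
  have hd2' : (-4 : ℝ) ≤ dy := by exact_mod_cast hd2
  have hk4 : k ≤ 4 ∧ -4 ≤ k := by
    constructor
    · have : (k : ℝ) ≤ 4 := by nlinarith
      exact_mod_cast this
    · have : (-4 : ℝ) ≤ k := by nlinarith
      exact_mod_cast this
  -- Because of `k = t * dy` and `t ≤ 1`, the whole oblique segment rises at least as far as the
  -- row.
  have hle : ∀ j : ℤ, 0 ≤ j → j < k → j < dy := by
    intro j hj hjk
    by_contra hcon
    have h1 : (dy : ℝ) ≤ j := by exact_mod_cast not_lt.1 hcon
    have h2 : (j : ℝ) < k := by exact_mod_cast hjk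
    have h3 : (0 : ℝ) ≤ j := by exact_mod_cast hj
    nlinarith
  have hge : ∀ j : ℤ, j ≤ 0 → k < j → dy < j := by
    intro j hj hjk
    by_contra hcon
    have h1 : (j : ℝ) ≤ dy := by exact_mod_cast not_lt.1 hcon
    have h2 : (k : ℝ) < j := by exact_mod_cast hjk
    have h3 : (j : ℝ) ≤ 0 := by exact_mod_cast hj
    nlinarith
  have hzero : k = 0 → t = 0 := by
    rintro rfl
    simpa [hny] using hkt
  -- Division by `t > 0` turns an inequality for the meeting point into one for the direction.
  have hpos : ∀ a b : ℤ, k ≠ 0 → 0 ≤ a * (t * dx) + b * (k : ℝ) → 0 ≤ a * dx + b * dy := by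
    intro a b hk0 h0
    have ht0 : t ≠ 0 := by
      rintro rfl
      rw [zero_mul] at hkt
      exact hk0 (by exact_mod_cast hkt.symm)
    have h1 : 0 ≤ t * (a * dx + b * dy) := by rw [← hkt] at h0; linarith
    have := nonneg_of_mul_nonneg_right h1 (lt_of_le_of_ne ht.1 ht0.symm)
    exact_mod_cast this
  have key : v ∈ f → f ∈ L.edges → e ∈ L.edges → L.kind e = L.kind f → L.kind e < 4 → False :=
    fun h1 h2 h3 h4 h5 => hef (L.proper e h3 f h2 v h.mem h1 h4 h5)
  rcases h' with ⟨r, l, he, e_eq, hkf, hlt, hlo, hhi, hrow⟩ | ⟨l, r, he, e_eq, hkf, hlt, hlo, hhi, hrow⟩ |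
    ⟨b, w, he, e_eq, hkf, hlt, hlohi, hrow⟩ | ⟨w, b, he, e_eq, hkf, hlt, hlohi, hrow⟩ |
    ⟨u, w, he, e_eq, hkf, hnext, hlohi, hrow⟩
  · obtain rfl : r = v := hpy (by omega)
    exact ⟨by simp [e_eq], hzero (by omega)⟩
  · obtain rfl : l = v := hpy (by omega)
    exact ⟨by simp [e_eq], hzero (by omega)⟩
  -- The direction forced here makes `e` an edge of kind 2 at `b`, like `f`, against kind 2 being a
  -- matching.
  · obtain rfl : b = v := hpy (by omega)
    exfalso
    obtain rfl : k = 2 := by omega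
    have := hd5 (hle 1 (by norm_num) (by norm_num)) (by
      rcases hlohi with ⟨-, rfl, -⟩ | ⟨-, -, rfl⟩
      · have := hpos 2 (-3) (by norm_num) (by push_cast at hx ⊢; linarith)
        left; linarith
      · have := hpos (-2) (-3) (by norm_num) (by push_cast at hx ⊢; linarith)
        right; linarith)
    refine key (by simp [e_eq]) he ?_ ?_ ?_ <;> cases h <;> first | assumption | omega
  · obtain rfl : w = v := hpy (by omega)
    exfalso
    obtain rfl : k = -2 := by omega
    have := hd6 (by have := hge (-1) (by norm_num) (by norm_num); omega) (by
      rcases hlohi with ⟨-, rfl, -⟩ | ⟨-, -, rfl⟩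
      · have := hpos 2 3 (by norm_num) (by push_cast at hx ⊢; linarith)
        left; linarith
      · have := hpos (-2) 3 (by norm_num) (by push_cast at hx ⊢; linarith)
        right; linarith)
    refine key (by simp [e_eq]) he ?_ ?_ ?_ <;> cases h <;> first | assumption | omega
  · exfalso
    -- The border row is at offset 4 from its lower vertex and at offset -4 from its upper one. An
    -- oblique segment that gets there belongs to the edge drawn along this border.
    have hcases : (k = 4 ∧ u = v) ∨ (k = -4 ∧ w = v) := by
      rcases lt_or_ge 0 k with h0 | h0
      · exact .inl ⟨by omega, hpy (by omega)⟩
      · exact .inr ⟨by omega, hpy (by omega)⟩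
    rcases hcases with ⟨rfl, rfl⟩ | ⟨rfl, rfl⟩
    · have h4 : dy = 4 := by have := hle 3 (by norm_num) (by norm_num); omega
      obtain rfl := hd3 h4
      subst h4
      exact hef (h.unique (.next_y w he e_eq hkf hnext rfl rfl))
    · have h4 : dy = -4 := by have := hge (-3) (by norm_num) (by norm_num); omega
      obtain rfl := hd4 h4
      subst h4
      exact hef (h.unique (.prev_y u he e_eq hkf hnext rfl rfl))

/-- The position of a vertex. -/
def center (L : Layout V) (v : V) : ℤ × ℤ := (8 * L.px v + 4, 8 * L.py v + 4)

/-- The segments of the edges, in either orientation. -/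
inductive SegOf (L : Layout V) (e : Sym2 V) (s : (ℤ × ℤ) × (ℤ × ℤ)) : Prop
  | hor (lo hi row : ℤ) (h : L.HSeg e lo hi row)
      (hs : s = ((lo, row), (hi, row)) ∨ s = ((hi, row), (lo, row)))
  | ver (lo hi col : ℤ) (h : L.transpose.HSeg e lo hi col)
      (hs : s = ((col, lo), (col, hi)) ∨ s = ((col, hi), (col, lo)))
  | obl (v : V) (dx dy : ℤ) (h : L.OSeg e v dx dy)
      (hs : s = (L.center v, L.center v + (dx, dy)) ∨ s = (L.center v + (dx, dy), L.center v))

end Layout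

/-! ### Coordinates of the points of a segment -/

theorem mem_segSet {s : (ℤ × ℤ) × (ℤ × ℤ)} {p : ℝ × ℝ} :
    p ∈ segSet s ↔ ∃ t : ℝ, (0 ≤ t ∧ t ≤ 1) ∧ (s.1.1 : ℝ) + t * (s.2.1 - s.1.1) = p.1 ∧
      (s.1.2 : ℝ) + t * (s.2.2 - s.1.2) = p.2 := by
  rw [segSet, segment_eq_image']
  simp only [gridToPlane, Set.mem_image, Set.mem_Icc, Prod.ext_iff, Prod.fst_add, Prod.snd_add,
    Prod.smul_fst, Prod.smul_snd, Prod.fst_sub, Prod.snd_sub, smul_eq_mul]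

theorem segSet_swap (a b : ℤ × ℤ) : segSet (a, b) = segSet (b, a) := segment_symm ℝ _ _

theorem mem_segSet_hor {lo hi row : ℤ} (h : lo ≤ hi) {p : ℝ × ℝ}
    (hp : p ∈ segSet ((lo, row), (hi, row))) : ((lo : ℝ) ≤ p.1 ∧ p.1 ≤ hi) ∧ p.2 = row := by
  obtain ⟨t, ⟨ht0, ht1⟩, h1, h2⟩ := mem_segSet.1 hp
  simp only [sub_self, mul_zero, add_zero] at h1 h2
  have h : (lo : ℝ) ≤ hi := by exact_mod_cast h
  exact ⟨⟨by nlinarith, by nlinarith⟩, h2.symm⟩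

theorem mem_segSet_ver {lo hi col : ℤ} (h : lo ≤ hi) {p : ℝ × ℝ}
    (hp : p ∈ segSet ((col, lo), (col, hi))) : ((lo : ℝ) ≤ p.2 ∧ p.2 ≤ hi) ∧ p.1 = col := by
  obtain ⟨t, ⟨ht0, ht1⟩, h1, h2⟩ := mem_segSet.1 hp
  simp only [sub_self, mul_zero, add_zero] at h1 h2
  have h : (lo : ℝ) ≤ hi := by exact_mod_cast h
  exact ⟨⟨by nlinarith, by nlinarith⟩, h1.symm⟩

theorem mem_segSet_obl {c : ℤ × ℤ} {dx dy : ℤ} {p : ℝ × ℝ} (hp : p ∈ segSet (c, c + (dx, dy))) :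
    ∃ t : ℝ, (0 ≤ t ∧ t ≤ 1) ∧ p.1 = (c.1 : ℝ) + t * dx ∧ p.2 = (c.2 : ℝ) + t * dy := by
  obtain ⟨t, ht, h1, h2⟩ := mem_segSet.1 hp
  refine ⟨t, ht, ?_, ?_⟩
  · rw [← h1]; simp
  · rw [← h2]; simp

/-! ### All crossings are right-angled -/

namespace Layout

variable {V : Type*}

/-- The condition of `GridDrawing.IsRAC` for a common point `p` of two segments. -/
def Allowed (L : Layout V) (e f : Sym2 V) (s t : (ℤ × ℤ) × (ℤ × ℤ)) (p : ℝ × ℝ) : Prop :=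
  (∃ w : V, w ∈ e ∧ w ∈ f ∧ p = gridToPlane (L.center w)) ∨
    (p ≠ gridToPlane s.1 ∧ p ≠ gridToPlane s.2 ∧ p ≠ gridToPlane t.1 ∧ p ≠ gridToPlane t.2 ∧
      SegPerp s t)

theorem Allowed.symm {L : Layout V} {e f : Sym2 V} {s t : (ℤ × ℤ) × (ℤ × ℤ)} {p : ℝ × ℝ}
    (h : L.Allowed e f s t p) : L.Allowed f e t s p := by
  rcases h with ⟨w, h1, h2, h3⟩ | ⟨h1, h2, h3, h4, h5⟩
  · exact .inl ⟨w, h2, h1, h3⟩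
  · refine .inr ⟨h3, h4, h1, h2, ?_⟩
    unfold SegPerp at *
    linarith

/-- `HSeg.inter_transpose`, used once for the layout and once for its transpose, shows that a common
point which is not a common end is interior to both segments. -/
theorem allowed_hor_ver {L : Layout V} {e f : Sym2 V} (hef : e ≠ f) {s t : (ℤ × ℤ) × (ℤ × ℤ)}
    {lo hi row lo' hi' col : ℤ} (h : L.HSeg e lo hi row) (h' : L.transpose.HSeg f lo' hi' col)
    (hs : s = ((lo, row), (hi, row)) ∨ s = ((hi, row), (lo, row)))
    (ht : t = ((col, lo'), (col, hi')) ∨ t = ((col, hi'), (col, lo'))) {p : ℝ × ℝ}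
    (hp : ((lo : ℝ) ≤ p.1 ∧ p.1 ≤ hi) ∧ p.2 = row)
    (hp' : ((lo' : ℝ) ≤ p.2 ∧ p.2 ≤ hi') ∧ p.1 = col) : L.Allowed e f s t p := by
  obtain ⟨⟨h1, h2⟩, h3⟩ := hp
  obtain ⟨⟨h1', h2'⟩, h3'⟩ := hp'
  rw [h3'] at h1 h2
  rw [h3] at h1' h2'
  norm_cast at h1 h2 h1' h2'
  have hpeq : p = gridToPlane (col, row) := Prod.ext h3' h3
  rcases h.inter_transpose hef h' ⟨h1, h2⟩ ⟨h1', h2'⟩ with ⟨v, hve, hvf, hc, hr⟩ | hin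
  · exact .inl ⟨v, hve, hvf, by rw [hpeq, hc, hr]; rfl⟩
  rcases h'.inter_transpose hef.symm (by rwa [transpose_transpose]) ⟨h1', h2'⟩ ⟨h1, h2⟩ with
    ⟨v, hvf, hve, hr, hc⟩ | hin'
  · exact .inl ⟨v, hve, hvf, by rw [hpeq, hc, hr]; rfl⟩
  have hinj : ∀ a b : ℤ × ℤ, a ≠ b → gridToPlane a ≠ gridToPlane b := by
    intro a b hab h
    simp only [gridToPlane, Prod.mk.injEq, Int.cast_inj] at h
    exact hab (Prod.ext h.1 h.2)
  right
  rw [hpeq]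
  rcases hs with rfl | rfl <;> rcases ht with rfl | rfl <;>
    refine ⟨hinj _ _ ?_, hinj _ _ ?_, hinj _ _ ?_, hinj _ _ ?_, by simp [SegPerp]⟩ <;>
    simp only [ne_eq, Prod.mk.injEq, not_and_or] <;> omega

/-- Only a horizontal with a vertical segment can give a proper crossing; every other pair meets in
common ends. The vertical cases are the horizontal ones for `L.transpose`. -/
theorem SegOf.allowed {L : Layout V} {e f : Sym2 V} (hef : e ≠ f) {s t : (ℤ × ℤ) × (ℤ × ℤ)}
    (hs : L.SegOf e s) (ht : L.SegOf f t) {p : ℝ × ℝ} (hp : p ∈ segSet s ∩ segSet t) :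
    L.Allowed e f s t p := by
  have hH : ∀ {s : (ℤ × ℤ) × (ℤ × ℤ)} {lo hi row : ℤ}, lo < hi →
      (s = ((lo, row), (hi, row)) ∨ s = ((hi, row), (lo, row))) → p ∈ segSet s →
      ((lo : ℝ) ≤ p.1 ∧ p.1 ≤ hi) ∧ p.2 = row := by
    rintro s lo hi row hlt (rfl | rfl) h
    · exact mem_segSet_hor hlt.le h
    · exact mem_segSet_hor hlt.le (by rwa [segSet_swap])
  have hV : ∀ {s : (ℤ × ℤ) × (ℤ × ℤ)} {lo hi col : ℤ}, lo < hi →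
      (s = ((col, lo), (col, hi)) ∨ s = ((col, hi), (col, lo))) → p ∈ segSet s →
      ((lo : ℝ) ≤ p.2 ∧ p.2 ≤ hi) ∧ p.1 = col := by
    rintro s lo hi row hlt (rfl | rfl) h
    · exact mem_segSet_ver hlt.le h
    · exact mem_segSet_ver hlt.le (by rwa [segSet_swap])
  have hO : ∀ {s : (ℤ × ℤ) × (ℤ × ℤ)} {c : ℤ × ℤ} {dx dy : ℤ},
      (s = (c, c + (dx, dy)) ∨ s = (c + (dx, dy), c)) → p ∈ segSet s →
      ∃ t : ℝ, (0 ≤ t ∧ t ≤ 1) ∧ p.1 = (c.1 : ℝ) + t * dx ∧ p.2 = (c.2 : ℝ) + t * dy := by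
    rintro s c dx dy (rfl | rfl) h
    · exact mem_segSet_obl h
    · exact mem_segSet_obl (by rwa [segSet_swap])
  have hOH : ∀ {e f : Sym2 V} {s t : (ℤ × ℤ) × (ℤ × ℤ)} {v : V} {dx dy lo hi row : ℤ}, e ≠ f →
      L.OSeg e v dx dy → (s = (L.center v, L.center v + (dx, dy)) ∨
        s = (L.center v + (dx, dy), L.center v)) → L.HSeg f lo hi row →
      (t = ((lo, row), (hi, row)) ∨ t = ((hi, row), (lo, row))) → p ∈ segSet s → p ∈ segSet t →
      L.Allowed e f s t p := by
    intro e f s t v dx dy lo hi row hef h hs h' ht hps hpt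
    obtain ⟨z, hz, hx, hy⟩ := hO hs hps
    obtain ⟨h1, h2⟩ := hH h'.lt ht hpt
    rw [hx] at h1
    rw [hy] at h2
    obtain ⟨hvf, rfl⟩ := h.inter_HSeg hef h' hz h1 h2
    exact .inl ⟨v, h.mem, hvf, Prod.ext (by simpa [gridToPlane] using hx) (by simpa [gridToPlane] using hy)⟩
  have hOV : ∀ {e f : Sym2 V} {s t : (ℤ × ℤ) × (ℤ × ℤ)} {v : V} {dx dy lo hi col : ℤ}, e ≠ f →
      L.OSeg e v dx dy → (s = (L.center v, L.center v + (dx, dy)) ∨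
        s = (L.center v + (dx, dy), L.center v)) → L.transpose.HSeg f lo hi col →
      (t = ((col, lo), (col, hi)) ∨ t = ((col, hi), (col, lo))) → p ∈ segSet s → p ∈ segSet t →
      L.Allowed e f s t p := by
    intro e f s t v dx dy lo hi row hef h hs h' ht hps hpt
    obtain ⟨z, hz, hx, hy⟩ := hO hs hps
    obtain ⟨h1, h2⟩ := hV h'.lt ht hpt
    rw [hy] at h1
    rw [hx] at h2
    obtain ⟨hvf, rfl⟩ := h.transpose.inter_HSeg hef h' hz h1 h2
    exact .inl ⟨v, h.mem, hvf, Prod.ext (by simpa [gridToPlane] using hx) (by simpa [gridToPlane] using hy)⟩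
  rcases hs with ⟨lo, hi, row, h, hs⟩ | ⟨lo, hi, col, h, hs⟩ | ⟨v, dx, dy, h, hs⟩ <;>
  rcases ht with ⟨lo', hi', row', h', ht⟩ | ⟨lo', hi', col', h', ht⟩ | ⟨v', dx', dy', h', ht⟩
  · obtain ⟨h1, h2⟩ := hH h.lt hs hp.1
    obtain ⟨h3, h4⟩ := hH h'.lt ht hp.2
    obtain rfl : row = row' := by rw [h2] at h4; exact_mod_cast h4
    obtain ⟨v, hve, hvf, hx, hy⟩ := h.inter_HSeg hef h' h1 h3
    exact .inl ⟨v, hve, hvf, Prod.ext hx (by rw [h2, hy]; rfl)⟩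
  · exact allowed_hor_ver hef h h' hs ht (hH h.lt hs hp.1) (hV h'.lt ht hp.2)
  · exact (hOH hef.symm h' ht h hs hp.2 hp.1).symm
  · exact (allowed_hor_ver hef.symm h' h ht hs (hH h'.lt ht hp.2) (hV h.lt hs hp.1)).symm
  · obtain ⟨h1, h2⟩ := hV h.lt hs hp.1
    obtain ⟨h3, h4⟩ := hV h'.lt ht hp.2
    obtain rfl : col = col' := by rw [h2] at h4; exact_mod_cast h4
    obtain ⟨v, hve, hvf, hx, hy⟩ := h.inter_HSeg hef h' h1 h3
    exact .inl ⟨v, hve, hvf, Prod.ext (by rw [h2, hy]; rfl) hx⟩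
  · exact (hOV hef.symm h' ht h hs hp.2 hp.1).symm
  · exact hOH hef h hs h' ht hp.1 hp.2
  · exact hOV hef h hs h' ht hp.1 hp.2
  · obtain ⟨z, hz, hx, hy⟩ := hO hs hp.1
    obtain ⟨z', hz', hx', hy'⟩ := hO ht hp.2
    obtain ⟨rfl, rfl⟩ := h.inter_OSeg hef h' hz hz' (hx.symm.trans hx') (hy.symm.trans hy')
    exact .inl ⟨v, h.mem, h'.mem, Prod.ext (by simpa [gridToPlane] using hx) (by simpa [gridToPlane] using hy)⟩

/-- An axis-parallel segment on the center line of a vertex belongs to an edge at this vertex, and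
an oblique segment extends by at most 4 horizontally, whereas the vertices are at least 8 apart. -/
theorem SegOf.center_notMem {L : Layout V} {e : Sym2 V} {s : (ℤ × ℤ) × (ℤ × ℤ)}
    (hs : L.SegOf e s) {w : V} (hw : w ∉ e) : gridToPlane (L.center w) ∉ segSet s := by
  have hH : ∀ {L : Layout V} {lo hi row : ℤ}, L.HSeg e lo hi row → row ≠ 8 * L.py w + 4 := by
    intro L lo hi row h hrow
    rcases h with ⟨r, l, he, e_eq, hk, hlt, hlo, hhi, hrow'⟩ |
      ⟨l, r, he, e_eq, hk, hlt, hlo, hhi, hrow'⟩ |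
      ⟨b, t, he, e_eq, hk, hlt, hx, hrow'⟩ | ⟨t, b, he, e_eq, hk, hlt, hx, hrow'⟩ |
      ⟨u, v, he, e_eq, hk, hnext, hx, hrow'⟩
    · obtain rfl : r = w := L.py_inj (by omega)
      simp [e_eq] at hw
    · obtain rfl : l = w := L.py_inj (by omega)
      simp [e_eq] at hw
    all_goals omega
  intro hp
  rcases hs with ⟨lo, hi, row, h, hs⟩ | ⟨lo, hi, col, h, hs⟩ | ⟨v, dx, dy, h, hs⟩
  · have : (gridToPlane (L.center w)).2 = row := by
      rcases hs with rfl | rfl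
      · exact (mem_segSet_hor h.lt.le hp).2
      · exact (mem_segSet_hor h.lt.le (by rwa [segSet_swap])).2
    simp only [gridToPlane, center, Int.cast_inj] at this
    exact hH h this.symm
  · have : (gridToPlane (L.center w)).1 = col := by
      rcases hs with rfl | rfl
      · exact (mem_segSet_ver h.lt.le hp).2
      · exact (mem_segSet_ver h.lt.le (by rwa [segSet_swap])).2
    simp only [gridToPlane, center, Int.cast_inj] at this
    exact hH h this.symm
  · obtain ⟨t, ⟨ht0, ht1⟩, hx, -⟩ : ∃ t : ℝ, (0 ≤ t ∧ t ≤ 1) ∧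
        (gridToPlane (L.center w)).1 = ((L.center v).1 : ℝ) + t * dx ∧
        (gridToPlane (L.center w)).2 = ((L.center v).2 : ℝ) + t * dy := by
      rcases hs with rfl | rfl
      · exact mem_segSet_obl hp
      · exact mem_segSet_obl (by rwa [segSet_swap])
    have hD : ∀ p ∈ directions, p.1 ≤ 4 ∧ -4 ≤ p.1 := by decide
    obtain ⟨hd1, hd2⟩ := hD _ h.mem_directions
    simp only at hd1 hd2
    have hd1' : (dx : ℝ) ≤ 4 := by exact_mod_cast hd1
    have hd2' : (-4 : ℝ) ≤ dx := by exact_mod_cast hd2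
    have hne : L.px v ≠ L.px w := fun hvw => hw (L.px_inj hvw ▸ h.mem)
    simp only [gridToPlane, center] at hx
    have h1 : ((8 * L.px w - 8 * L.px v : ℤ) : ℝ) ≤ (4 : ℤ) := by push_cast at hx ⊢; nlinarith
    have h2 : ((-4 : ℤ) : ℝ) ≤ ((8 * L.px w - 8 * L.px v : ℤ) : ℝ) := by
      push_cast at hx ⊢; nlinarith
    norm_cast at h1 h2
    omega

end Layout

set_option linter.unusedSimpArgs false
set_option linter.unusedTactic false
set_option linter.unreachableTactic false

/-! ### The drawing -/

/-- A polyline with two bends that is a simple curve. -/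
structure SimplePath (a p q b : ℤ × ℤ) : Prop where
  ne₁ : a ≠ p
  ne₂ : p ≠ q
  ne₃ : q ≠ b
  inter₁ : ∀ z ∈ segSet (a, p), z ∈ segSet (p, q) → z = gridToPlane p
  inter₂ : ∀ z ∈ segSet (p, q), z ∈ segSet (q, b) → z = gridToPlane q
  inter₃ : ∀ z ∈ segSet (a, p), z ∉ segSet (q, b)

theorem SimplePath.reverse {a p q b : ℤ × ℤ} (h : SimplePath a p q b) : SimplePath b q p a where
  ne₁ := h.ne₃.symm
  ne₂ := h.ne₂.symm
  ne₃ := h.ne₁.symm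
  inter₁ z h1 h2 := h.inter₂ z (by rwa [segSet_swap]) (by rwa [segSet_swap])
  inter₂ z h1 h2 := h.inter₁ z (by rwa [segSet_swap]) (by rwa [segSet_swap])
  inter₃ z h1 h2 := h.inter₃ z (by rwa [segSet_swap]) (by rwa [segSet_swap])

theorem SimplePath.isSimplePolyline {a p q b : ℤ × ℤ} (h : SimplePath a p q b) :
    IsSimplePolyline [a, p, q, b] := by
  refine ⟨?_, ?_⟩
  · intro s hs
    simp only [polySegs, List.tail_cons, List.zip_cons_cons, List.zip_nil_right, List.mem_cons,
      List.not_mem_nil, or_false] at hs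
    rcases hs with rfl | rfl | rfl
    exacts [h.ne₁, h.ne₂, h.ne₃]
  · intro i j hi hj hij z hz
    have hlen : (polySegs [a, p, q, b]).length = 3 := rfl
    rw [hlen] at hi hj
    have hcases : (i = 0 ∧ j = 1) ∨ (i = 1 ∧ j = 2) ∨ (i = 0 ∧ j = 2) := by omega
    rcases hcases with ⟨rfl, rfl⟩ | ⟨rfl, rfl⟩ | ⟨rfl, rfl⟩
    · exact ⟨rfl, h.inter₁ z hz.1 hz.2⟩
    · exact ⟨rfl, h.inter₂ z hz.1 hz.2⟩
    · exact (h.inter₃ z hz.1 hz.2).elim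

/-- The edges of kind `k` between `P` and `Q` are drawn from `P` to `Q`, and not from `Q` to `P`. -/
def IsFirst (k : ℕ) (P Q : ℤ × ℤ) : Prop :=
  if k = 0 then Q.1 < P.1 else if k = 1 ∨ k = 4 then P.1 < Q.1
  else if k = 2 then Q.2 < P.2 else P.2 < Q.2

/-- The bends of an edge of kind `k` which is drawn from `P` to `Q`. -/
def canonicalBends (k : ℕ) (P Q : ℤ × ℤ) : (ℤ × ℤ) × (ℤ × ℤ) :=
  if k = 0 then ((Q.1 + 2, P.2), (Q.1 + 2, if Q.2 < P.2 then Q.2 + 3 else Q.2 - 3))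
  else if k = 1 then ((Q.1 - 2, P.2), (Q.1 - 2, if Q.2 < P.2 then Q.2 + 3 else Q.2 - 3))
  else if k = 2 then ((P.1, Q.2 + 2), (if Q.1 < P.1 then Q.1 + 3 else Q.1 - 3, Q.2 + 2))
  else if k = 3 then ((P.1, Q.2 - 2), (if Q.1 < P.1 then Q.1 + 3 else Q.1 - 3, Q.2 - 2))
  else if k = 4 then ((P.1 + 4, P.2 + 1), (P.1 + 4, Q.2 + 1))
  else ((P.1 + 1, P.2 + 4), (Q.1 + 1, P.2 + 4))

open Classical in
/-- The bends of an edge of kind `k` between `P` and `Q`, in the order from `P` to `Q`. -/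
noncomputable def bendsBetween (k : ℕ) (P Q : ℤ × ℤ) : List (ℤ × ℤ) :=
  if IsFirst k P Q then [(canonicalBends k P Q).1, (canonicalBends k P Q).2]
  else [(canonicalBends k Q P).2, (canonicalBends k Q P).1]

theorem isFirst_comm {k : ℕ} {P Q : ℤ × ℤ} (h1 : P.1 ≠ Q.1) (h2 : P.2 ≠ Q.2) :
    IsFirst k Q P ↔ ¬ IsFirst k P Q := by
  unfold IsFirst
  split_ifs <;> omega

/-- Allows `bends` to be defined on darts although each edge has one preferred direction of drawing.
-/
theorem bendsBetween_comm {k : ℕ} {P Q : ℤ × ℤ} (h1 : P.1 ≠ Q.1) (h2 : P.2 ≠ Q.2) :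
    bendsBetween k Q P = (bendsBetween k P Q).reverse := by
  by_cases h : IsFirst k P Q
  · have h' : ¬ IsFirst k Q P := by rw [isFirst_comm h1 h2]; exact not_not.2 h
    simp [bendsBetween, h, h']
  · have h' : IsFirst k Q P := by rwa [isFirst_comm h1 h2]
    simp [bendsBetween, h, h']

namespace Layout

variable {V : Type*}

/-- Edges have distinct ends, and those of the last two kinds join consecutive vertices in one of
the two orders. -/
structure Valid (L : Layout V) : Prop where
  ne : ∀ u v, s(u, v) ∈ L.edges → u ≠ v
  kind_lt : ∀ e ∈ L.edges, L.kind e < 6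
  kind_four : ∀ u v, s(u, v) ∈ L.edges → L.kind s(u, v) = 4 → L.px u < L.px v →
    L.px v = L.px u + 1
  kind_five : ∀ u v, s(u, v) ∈ L.edges → L.kind s(u, v) = 5 → L.py u < L.py v →
    L.py v = L.py u + 1

/-- With points parametrized by `t` and `r`, each condition is settled by linear arithmetic: bends
are offset by at most 4 from the center lines of the ends, and the ends differ by at least 8 in both
coordinates. -/
theorem simplePath_canonicalBends {L : Layout V} (hL : L.Valid) {u v : V}
    (h : s(u, v) ∈ L.edges) (hf : IsFirst (L.kind s(u, v)) (L.center u) (L.center v)) :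
    SimplePath (L.center u) (canonicalBends (L.kind s(u, v)) (L.center u) (L.center v)).1
      (canonicalBends (L.kind s(u, v)) (L.center u) (L.center v)).2 (L.center v) := by
  have hx : L.px u ≠ L.px v := fun e => hL.ne _ _ h (L.px_inj e)
  have hy : L.py u ≠ L.py v := fun e => hL.ne _ _ h (L.py_inj e)
  have h4 := hL.kind_four u v h
  have h5 := hL.kind_five u v h
  have h6 := hL.kind_lt _ h
  obtain ⟨k, hk⟩ : ∃ k, L.kind s(u, v) = k := ⟨_, rfl⟩
  rw [hk] at hf h4 h5 h6 ⊢
  unfold center at *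
  generalize L.px u = a at *
  generalize L.px v = b at *
  generalize L.py u = c at *
  generalize L.py v = d at *
  interval_cases k <;> simp only [IsFirst, canonicalBends] at * <;> norm_num at hf ⊢
  -- Replaces the conditional by a closed value in either case, so that only linear terms are left.
  · have hs : (d < c ∧ (if d < c then 8 * d + 4 + 3 else 8 * d + 4 - 3) = 8 * d + 7) ∨
        (c < d ∧ (if d < c then 8 * d + 4 + 3 else 8 * d + 4 - 3) = 8 * d + 1) := by
      split_ifs <;> omega
    rcases hs with ⟨hlt, hs⟩ | ⟨hlt, hs⟩ <;> rw [hs] <;>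
    have hlt' := (Int.cast_le (R := ℝ)).2 (Int.add_one_le_of_lt hlt) <;>
    push_cast at hlt' <;>
    refine ⟨?_, ?_, ?_, ?_, ?_, ?_⟩ <;>
    first
    | (simp only [ne_eq, Prod.mk.injEq, not_and_or]; omega)
    | (intro z h1 h2
       obtain ⟨t, ht, h1, h3⟩ := mem_segSet.1 h1
       obtain ⟨r, hr, h2, h4⟩ := mem_segSet.1 h2
       push_cast at h1 h2 h3 h4
       first
       | (exfalso; linarith)
       | exact Prod.ext (by simp only [gridToPlane]; push_cast; linarith)
          (by simp only [gridToPlane]; push_cast; linarith))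
  · have hs : (d < c ∧ (if d < c then 8 * d + 4 + 3 else 8 * d + 4 - 3) = 8 * d + 7) ∨
        (c < d ∧ (if d < c then 8 * d + 4 + 3 else 8 * d + 4 - 3) = 8 * d + 1) := by
      split_ifs <;> omega
    rcases hs with ⟨hlt, hs⟩ | ⟨hlt, hs⟩ <;> rw [hs] <;>
    have hlt' := (Int.cast_le (R := ℝ)).2 (Int.add_one_le_of_lt hlt) <;>
    push_cast at hlt' <;>
    refine ⟨?_, ?_, ?_, ?_, ?_, ?_⟩ <;>
    first
    | (simp only [ne_eq, Prod.mk.injEq, not_and_or]; omega)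
    | (intro z h1 h2
       obtain ⟨t, ht, h1, h3⟩ := mem_segSet.1 h1
       obtain ⟨r, hr, h2, h4⟩ := mem_segSet.1 h2
       push_cast at h1 h2 h3 h4
       first
       | (exfalso; linarith)
       | exact Prod.ext (by simp only [gridToPlane]; push_cast; linarith)
          (by simp only [gridToPlane]; push_cast; linarith))
  · have hs : (b < a ∧ (if b < a then 8 * b + 4 + 3 else 8 * b + 4 - 3) = 8 * b + 7) ∨
        (a < b ∧ (if b < a then 8 * b + 4 + 3 else 8 * b + 4 - 3) = 8 * b + 1) := by
      split_ifs <;> omega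
    rcases hs with ⟨hlt, hs⟩ | ⟨hlt, hs⟩ <;> rw [hs] <;>
    have hlt' := (Int.cast_le (R := ℝ)).2 (Int.add_one_le_of_lt hlt) <;>
    push_cast at hlt' <;>
    refine ⟨?_, ?_, ?_, ?_, ?_, ?_⟩ <;>
    first
    | (simp only [ne_eq, Prod.mk.injEq, not_and_or]; omega)
    | (intro z h1 h2
       obtain ⟨t, ht, h1, h3⟩ := mem_segSet.1 h1
       obtain ⟨r, hr, h2, h4⟩ := mem_segSet.1 h2
       push_cast at h1 h2 h3 h4
       first
       | (exfalso; linarith)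
       | exact Prod.ext (by simp only [gridToPlane]; push_cast; linarith)
          (by simp only [gridToPlane]; push_cast; linarith))
  · have hs : (b < a ∧ (if b < a then 8 * b + 4 + 3 else 8 * b + 4 - 3) = 8 * b + 7) ∨
        (a < b ∧ (if b < a then 8 * b + 4 + 3 else 8 * b + 4 - 3) = 8 * b + 1) := by
      split_ifs <;> omega
    rcases hs with ⟨hlt, hs⟩ | ⟨hlt, hs⟩ <;> rw [hs] <;>
    have hlt' := (Int.cast_le (R := ℝ)).2 (Int.add_one_le_of_lt hlt) <;>
    push_cast at hlt' <;>
    refine ⟨?_, ?_, ?_, ?_, ?_, ?_⟩ <;>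
    first
    | (simp only [ne_eq, Prod.mk.injEq, not_and_or]; omega)
    | (intro z h1 h2
       obtain ⟨t, ht, h1, h3⟩ := mem_segSet.1 h1
       obtain ⟨r, hr, h2, h4⟩ := mem_segSet.1 h2
       push_cast at h1 h2 h3 h4
       first
       | (exfalso; linarith)
       | exact Prod.ext (by simp only [gridToPlane]; push_cast; linarith)
          (by simp only [gridToPlane]; push_cast; linarith))
  · obtain rfl : b = a + 1 := h4 trivial hf
    -- The outer segments reach the border column in their bends only (`t = 1` and `r = 0`), and
    -- these have different heights.
    have hlt : (d : ℝ) + 1 ≤ c ∨ (c : ℝ) + 1 ≤ d := by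
      rcases lt_or_gt_of_ne hy with h | h
      · exact .inr (by exact_mod_cast h)
      · exact .inl (by exact_mod_cast h)
    refine ⟨?_, ?_, ?_, ?_, ?_, ?_⟩ <;>
    first
    | (simp only [ne_eq, Prod.mk.injEq, not_and_or]; omega)
    | (intro z h1 h2
       obtain ⟨t, ht, h1, h3⟩ := mem_segSet.1 h1
       obtain ⟨r, hr, h2, h4⟩ := mem_segSet.1 h2
       push_cast at h1 h2 h3 h4
       first
       | (exfalso; linarith)
       | exact Prod.ext (by simp only [gridToPlane]; push_cast; linarith)
          (by simp only [gridToPlane]; push_cast; linarith)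
       | (obtain rfl : t = 1 := by linarith
          exact Prod.ext (by simp only [gridToPlane]; push_cast; linarith)
            (by simp only [gridToPlane]; push_cast; linarith))
       | (obtain rfl : t = 1 := by linarith
          obtain rfl : r = 0 := by linarith
          rcases hlt with h | h <;> linarith))
  · obtain rfl : d = c + 1 := h5 trivial hf
    have hlt : (b : ℝ) + 1 ≤ a ∨ (a : ℝ) + 1 ≤ b := by
      rcases lt_or_gt_of_ne hx with h | h
      · exact .inr (by exact_mod_cast h)
      · exact .inl (by exact_mod_cast h)
    refine ⟨?_, ?_, ?_, ?_, ?_, ?_⟩ <;>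
    first
    | (simp only [ne_eq, Prod.mk.injEq, not_and_or]; omega)
    | (intro z h1 h2
       obtain ⟨t, ht, h1, h3⟩ := mem_segSet.1 h1
       obtain ⟨r, hr, h2, h4⟩ := mem_segSet.1 h2
       push_cast at h1 h2 h3 h4
       first
       | (exfalso; linarith)
       | exact Prod.ext (by simp only [gridToPlane]; push_cast; linarith)
          (by simp only [gridToPlane]; push_cast; linarith)
       | (obtain rfl : t = 1 := by linarith
          exact Prod.ext (by simp only [gridToPlane]; push_cast; linarith)
            (by simp only [gridToPlane]; push_cast; linarith))
       | (obtain rfl : t = 1 := by linarith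
          obtain rfl : r = 0 := by linarith
          rcases hlt with h | h <;> linarith))

/-- Vertical segments are described in the transposed layout, where kind 0 plays the role of kind 2
and so on. Thus the vertical part of an edge of kind 0 is an instance of `up`. -/
theorem segOf_canonicalBends {L : Layout V} (hL : L.Valid) {u v : V}
    (h : s(u, v) ∈ L.edges) (hf : IsFirst (L.kind s(u, v)) (L.center u) (L.center v)) :
    L.SegOf s(u, v)
        (L.center u, (canonicalBends (L.kind s(u, v)) (L.center u) (L.center v)).1) ∧
      L.SegOf s(u, v) ((canonicalBends (L.kind s(u, v)) (L.center u) (L.center v)).1,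
        (canonicalBends (L.kind s(u, v)) (L.center u) (L.center v)).2) ∧
      L.SegOf s(u, v)
        ((canonicalBends (L.kind s(u, v)) (L.center u) (L.center v)).2, L.center v) := by
  have hx : L.px u ≠ L.px v := fun e => hL.ne _ _ h (L.px_inj e)
  have hy : L.py u ≠ L.py v := fun e => hL.ne _ _ h (L.py_inj e)
  have h4 := hL.kind_four u v h
  have h5 := hL.kind_five u v h
  have h6 := hL.kind_lt _ h
  have hsw : ∀ k, L.kind s(u, v) = k → L.transpose.kind s(u, v) = swapKind k := by
    rintro k rfl; rfl
  obtain ⟨k, hk⟩ : ∃ k, L.kind s(u, v) = k := ⟨_, rfl⟩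
  rw [hk] at hf h4 h5 h6 ⊢
  interval_cases k <;> simp only [IsFirst, canonicalBends, center] at * <;> norm_num at hf ⊢
  · have hs : (L.py v < L.py u ∧ (if L.py v < L.py u then 8 * L.py v + 4 + 3 else 8 * L.py v + 4 - 3) = 8 * L.py v + 7) ∨
        (L.py u < L.py v ∧ (if L.py v < L.py u then 8 * L.py v + 4 + 3 else 8 * L.py v + 4 - 3) = 8 * L.py v + 1) := by
      split_ifs <;> omega
    rcases hs with ⟨hlt, hs⟩ | ⟨hlt, hs⟩ <;> rw [hs]
    · exact ⟨.hor (8 * L.px v + 6) (8 * L.px u + 4) (8 * L.py u + 4)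
          (.left u v h rfl hk hf rfl rfl rfl)
              (by simp only [center, Prod.mk_add_mk, Prod.mk.injEq, and_true, true_and, true_or] <;> omega),
        .ver (8 * L.py v + 7) (8 * L.py u + 4) (8 * L.px v + 6)
          (.up v u h Sym2.eq_swap (hsw _ hk) hf (.inl ⟨hlt, rfl, rfl⟩) rfl)
              (by simp only [center, Prod.mk_add_mk, Prod.mk.injEq, and_true, true_and, true_or] <;> omega),
        .obl v 2 (3) (.zero h (by simp) hk rfl (by simp))
            (by simp only [center, Prod.mk_add_mk, Prod.mk.injEq, and_true, true_and, true_or] <;> omega)⟩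
    · exact ⟨.hor (8 * L.px v + 6) (8 * L.px u + 4) (8 * L.py u + 4)
          (.left u v h rfl hk hf rfl rfl rfl)
              (by simp only [center, Prod.mk_add_mk, Prod.mk.injEq, and_true, true_and, true_or] <;> omega),
        .ver (8 * L.py u + 4) (8 * L.py v + 1) (8 * L.px v + 6)
          (.up v u h Sym2.eq_swap (hsw _ hk) hf (.inr ⟨hlt, rfl, rfl⟩) rfl)
              (by simp only [center, Prod.mk_add_mk, Prod.mk.injEq, and_true, true_and, true_or] <;> omega),
        .obl v 2 (-3) (.zero h (by simp) hk rfl (by simp))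
            (by simp only [center, Prod.mk_add_mk, Prod.mk.injEq, and_true, true_and, true_or] <;> omega)⟩
  · have hs : (L.py v < L.py u ∧ (if L.py v < L.py u then 8 * L.py v + 4 + 3 else 8 * L.py v + 4 - 3) = 8 * L.py v + 7) ∨
        (L.py u < L.py v ∧ (if L.py v < L.py u then 8 * L.py v + 4 + 3 else 8 * L.py v + 4 - 3) = 8 * L.py v + 1) := by
      split_ifs <;> omega
    rcases hs with ⟨hlt, hs⟩ | ⟨hlt, hs⟩ <;> rw [hs]
    · exact ⟨.hor (8 * L.px u + 4) (8 * L.px v + 2) (8 * L.py u + 4)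
          (.right u v h rfl hk hf rfl rfl rfl)
              (by simp only [center, Prod.mk_add_mk, Prod.mk.injEq, and_true, true_and, true_or] <;> omega),
        .ver (8 * L.py v + 7) (8 * L.py u + 4) (8 * L.px v + 2)
          (.down v u h Sym2.eq_swap (hsw _ hk) hf (.inl ⟨hlt, rfl, rfl⟩) rfl)
              (by simp only [center, Prod.mk_add_mk, Prod.mk.injEq, and_true, true_and, true_or] <;> omega),
        .obl v (-2) (3) (.one h (by simp) hk rfl (by simp))
            (by simp only [center, Prod.mk_add_mk, Prod.mk.injEq, and_true, true_and, true_or] <;> omega)⟩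
    · exact ⟨.hor (8 * L.px u + 4) (8 * L.px v + 2) (8 * L.py u + 4)
          (.right u v h rfl hk hf rfl rfl rfl)
              (by simp only [center, Prod.mk_add_mk, Prod.mk.injEq, and_true, true_and, true_or] <;> omega),
        .ver (8 * L.py u + 4) (8 * L.py v + 1) (8 * L.px v + 2)
          (.down v u h Sym2.eq_swap (hsw _ hk) hf (.inr ⟨hlt, rfl, rfl⟩) rfl)
              (by simp only [center, Prod.mk_add_mk, Prod.mk.injEq, and_true, true_and, true_or] <;> omega),
        .obl v (-2) (-3) (.one h (by simp) hk rfl (by simp))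
            (by simp only [center, Prod.mk_add_mk, Prod.mk.injEq, and_true, true_and, true_or] <;> omega)⟩
  · have hs : (L.px v < L.px u ∧ (if L.px v < L.px u then 8 * L.px v + 4 + 3 else 8 * L.px v + 4 - 3) = 8 * L.px v + 7) ∨
        (L.px u < L.px v ∧ (if L.px v < L.px u then 8 * L.px v + 4 + 3 else 8 * L.px v + 4 - 3) = 8 * L.px v + 1) := by
      split_ifs <;> omega
    rcases hs with ⟨hlt, hs⟩ | ⟨hlt, hs⟩ <;> rw [hs]
    · exact ⟨.ver (8 * L.py v + 6) (8 * L.py u + 4) (8 * L.px u + 4)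
          (.left u v h rfl (hsw _ hk) hf rfl rfl rfl)
              (by simp only [center, Prod.mk_add_mk, Prod.mk.injEq, and_true, true_and, true_or] <;> omega),
        .hor (8 * L.px v + 7) (8 * L.px u + 4) (8 * L.py v + 6)
          (.up v u h Sym2.eq_swap hk hf (.inl ⟨hlt, rfl, rfl⟩) rfl)
              (by simp only [center, Prod.mk_add_mk, Prod.mk.injEq, and_true, true_and, true_or] <;> omega),
        .obl v (3) 2 (.two h (by simp) hk (by simp) rfl)
            (by simp only [center, Prod.mk_add_mk, Prod.mk.injEq, and_true, true_and, true_or] <;> omega)⟩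
    · exact ⟨.ver (8 * L.py v + 6) (8 * L.py u + 4) (8 * L.px u + 4)
          (.left u v h rfl (hsw _ hk) hf rfl rfl rfl)
              (by simp only [center, Prod.mk_add_mk, Prod.mk.injEq, and_true, true_and, true_or] <;> omega),
        .hor (8 * L.px u + 4) (8 * L.px v + 1) (8 * L.py v + 6)
          (.up v u h Sym2.eq_swap hk hf (.inr ⟨hlt, rfl, rfl⟩) rfl)
              (by simp only [center, Prod.mk_add_mk, Prod.mk.injEq, and_true, true_and, true_or] <;> omega),
        .obl v (-3) 2 (.two h (by simp) hk (by simp) rfl)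
            (by simp only [center, Prod.mk_add_mk, Prod.mk.injEq, and_true, true_and, true_or] <;> omega)⟩
  · have hs : (L.px v < L.px u ∧ (if L.px v < L.px u then 8 * L.px v + 4 + 3 else 8 * L.px v + 4 - 3) = 8 * L.px v + 7) ∨
        (L.px u < L.px v ∧ (if L.px v < L.px u then 8 * L.px v + 4 + 3 else 8 * L.px v + 4 - 3) = 8 * L.px v + 1) := by
      split_ifs <;> omega
    rcases hs with ⟨hlt, hs⟩ | ⟨hlt, hs⟩ <;> rw [hs]
    · exact ⟨.ver (8 * L.py u + 4) (8 * L.py v + 2) (8 * L.px u + 4)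
          (.right u v h rfl (hsw _ hk) hf rfl rfl rfl)
              (by simp only [center, Prod.mk_add_mk, Prod.mk.injEq, and_true, true_and, true_or] <;> omega),
        .hor (8 * L.px v + 7) (8 * L.px u + 4) (8 * L.py v + 2)
          (.down v u h Sym2.eq_swap hk hf (.inl ⟨hlt, rfl, rfl⟩) rfl)
              (by simp only [center, Prod.mk_add_mk, Prod.mk.injEq, and_true, true_and, true_or] <;> omega),
        .obl v (3) (-2) (.three h (by simp) hk (by simp) rfl)
            (by simp only [center, Prod.mk_add_mk, Prod.mk.injEq, and_true, true_and, true_or] <;> omega)⟩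
    · exact ⟨.ver (8 * L.py u + 4) (8 * L.py v + 2) (8 * L.px u + 4)
          (.right u v h rfl (hsw _ hk) hf rfl rfl rfl)
              (by simp only [center, Prod.mk_add_mk, Prod.mk.injEq, and_true, true_and, true_or] <;> omega),
        .hor (8 * L.px u + 4) (8 * L.px v + 1) (8 * L.py v + 2)
          (.down v u h Sym2.eq_swap hk hf (.inr ⟨hlt, rfl, rfl⟩) rfl)
              (by simp only [center, Prod.mk_add_mk, Prod.mk.injEq, and_true, true_and, true_or] <;> omega),
        .obl v (-3) (-2) (.three h (by simp) hk (by simp) rfl)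
            (by simp only [center, Prod.mk_add_mk, Prod.mk.injEq, and_true, true_and, true_or] <;> omega)⟩
  · have hn := h4 trivial hf
    refine ⟨.obl u 4 1 (.next_x v h rfl hk hn rfl rfl)
        (by simp only [center, Prod.mk_add_mk, Prod.mk.injEq, and_true, true_and, true_or] <;> omega), ?_,
      .obl v (-4) 1 (.prev_x u h rfl hk hn rfl rfl)
          (by simp only [center, Prod.mk_add_mk, Prod.mk.injEq, and_true, true_and, true_or] <;> omega)⟩
    rcases lt_or_gt_of_ne hy with hlt | hlt
    · exact .ver (8 * L.py u + 5) (8 * L.py v + 5) (8 * L.px u + 8)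
        (.between u v h rfl (hsw _ hk) hn (.inl ⟨hlt, rfl, rfl⟩) rfl)
            (by simp only [center, Prod.mk_add_mk, Prod.mk.injEq, and_true, true_and, true_or] <;> omega)
    · exact .ver (8 * L.py v + 5) (8 * L.py u + 5) (8 * L.px u + 8)
        (.between u v h rfl (hsw _ hk) hn (.inr ⟨hlt, rfl, rfl⟩) rfl)
            (by simp only [center, Prod.mk_add_mk, Prod.mk.injEq, and_true, true_and, true_or] <;> omega)
  · have hn := h5 trivial hf
    refine ⟨.obl u 1 4 (.next_y v h rfl hk hn rfl rfl)
        (by simp only [center, Prod.mk_add_mk, Prod.mk.injEq, and_true, true_and, true_or] <;> omega), ?_,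
      .obl v 1 (-4) (.prev_y u h rfl hk hn rfl rfl)
          (by simp only [center, Prod.mk_add_mk, Prod.mk.injEq, and_true, true_and, true_or] <;> omega)⟩
    rcases lt_or_gt_of_ne hx with hlt | hlt
    · exact .hor (8 * L.px u + 5) (8 * L.px v + 5) (8 * L.py u + 8)
        (.between u v h rfl hk hn (.inl ⟨hlt, rfl, rfl⟩) rfl)
            (by simp only [center, Prod.mk_add_mk, Prod.mk.injEq, and_true, true_and, true_or] <;> omega)
    · exact .hor (8 * L.px v + 5) (8 * L.px u + 5) (8 * L.py u + 8)
        (.between u v h rfl hk hn (.inr ⟨hlt, rfl, rfl⟩) rfl)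
            (by simp only [center, Prod.mk_add_mk, Prod.mk.injEq, and_true, true_and, true_or] <;> omega)

/-- The two bends of an edge. -/
theorem exists_bendsBetween {L : Layout V} (hL : L.Valid) {u v : V} (h : s(u, v) ∈ L.edges) :
    ∃ p q, bendsBetween (L.kind s(u, v)) (L.center u) (L.center v) = [p, q] ∧
      SimplePath (L.center u) p q (L.center v) ∧ L.SegOf s(u, v) (L.center u, p) ∧
      L.SegOf s(u, v) (p, q) ∧ L.SegOf s(u, v) (q, L.center v) := by
  have swap : ∀ {e : Sym2 V} {a b : ℤ × ℤ}, L.SegOf e (a, b) → L.SegOf e (b, a) := by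
    intro e a b h
    rcases h with ⟨lo, hi, row, h, hs⟩ | ⟨lo, hi, col, h, hs⟩ | ⟨v, dx, dy, h, hs⟩
    · exact .hor lo hi row h (by simp only [Prod.mk.injEq] at hs ⊢; tauto)
    · exact .ver lo hi col h (by simp only [Prod.mk.injEq] at hs ⊢; tauto)
    · exact .obl v dx dy h (by simp only [Prod.mk.injEq] at hs ⊢; tauto)
  by_cases hf : IsFirst (L.kind s(u, v)) (L.center u) (L.center v)
  · exact ⟨_, _, by simp only [bendsBetween, hf, if_true],
      simplePath_canonicalBends hL h hf, segOf_canonicalBends hL h hf⟩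
  · have hf' : IsFirst (L.kind s(v, u)) (L.center v) (L.center u) := by
      rw [Sym2.eq_swap, isFirst_comm]
      · exact hf
      · have hx : L.px u ≠ L.px v := fun e => hL.ne _ _ h (L.px_inj e)
        simp only [center]; omega
      · have hy : L.py u ≠ L.py v := fun e => hL.ne _ _ h (L.py_inj e)
        simp only [center]; omega
    have h' : s(v, u) ∈ L.edges := by rwa [Sym2.eq_swap]
    obtain ⟨h1, h2, h3⟩ := segOf_canonicalBends hL h' hf'
    have h0 := simplePath_canonicalBends hL h' hf'
    rw [Sym2.eq_swap] at h0 h1 h2 h3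
    exact ⟨_, _, by simp only [bendsBetween, hf, if_false], h0.reverse, swap h3, swap h2, swap h1⟩

/-- The drawing given by a valid layout of the edges of a graph. -/
noncomputable def drawing {G : SimpleGraph V} (L : Layout V) (hL : L.Valid)
    (hG : L.edges = G.edgeSet) : GridDrawing G where
  pos := L.center
  bends d := bendsBetween (L.kind d.edge) (L.center d.fst) (L.center d.snd)
  bends_symm d := by
    have hd : s(d.fst, d.snd) ∈ L.edges := by rw [hG]; exact d.edge_mem
    have hne := hL.ne _ _ hd
    rw [SimpleGraph.Dart.edge_symm]
    refine bendsBetween_comm (P := L.center d.fst) (Q := L.center d.snd) ?_ ?_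
    · have hx : L.px d.fst ≠ L.px d.snd := fun e => hne (L.px_inj e)
      simp only [center]; omega
    · have hx : L.py d.fst ≠ L.py d.snd := fun e => hne (L.py_inj e)
      simp only [center]; omega
  pos_injective u v h := L.px_inj (by
    have := congrArg Prod.fst h
    simp only [center] at this
    omega)
  simple d := by
    obtain ⟨p, q, hpq, h, -⟩ := exists_bendsBetween hL (u := d.fst) (v := d.snd)
      (by rw [hG]; exact d.edge_mem)
    rw [show d.edge = s(d.fst, d.snd) from rfl, hpq]
    exact h.isSimplePolyline
  avoids_vertices d w hw1 hw2 := by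
    obtain ⟨p, q, hpq, -, h1, h2, h3⟩ := exists_bendsBetween hL (u := d.fst) (v := d.snd)
      (by rw [hG]; exact d.edge_mem)
    rw [show d.edge = s(d.fst, d.snd) from rfl, hpq]
    intro s hs
    have hw : w ∉ s(d.fst, d.snd) := by simp [hw1, hw2]
    simp only [polySegs, List.cons_append, List.nil_append, List.tail_cons, List.zip_cons_cons,
      List.zip_nil_right, List.mem_cons, List.not_mem_nil, or_false] at hs
    rcases hs with rfl | rfl | rfl
    exacts [h1.center_notMem hw, h2.center_notMem hw, h3.center_notMem hw]

variable {G : SimpleGraph V}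

theorem drawing_isBend (L : Layout V) (hL : L.Valid) (hG : L.edges = G.edgeSet) :
    (L.drawing hL hG).IsBend 2 := by
  intro d
  obtain ⟨p, q, hpq, -⟩ := exists_bendsBetween hL (u := d.fst) (v := d.snd)
    (by rw [hG]; exact d.edge_mem)
  change (bendsBetween (L.kind s(d.fst, d.snd)) _ _).length ≤ 2
  rw [hpq]
  rfl

theorem drawing_isRAC (L : Layout V) (hL : L.Valid) (hG : L.edges = G.edgeSet) :
    (L.drawing hL hG).IsRAC := by
  have hseg : ∀ d : G.Dart, ∀ s ∈ (L.drawing hL hG).segs d, L.SegOf d.edge s := by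
    intro d s hs
    obtain ⟨p, q, hpq, -, h1, h2, h3⟩ := exists_bendsBetween hL (u := d.fst) (v := d.snd)
      (by rw [hG]; exact d.edge_mem)
    change s ∈ polySegs (_ :: (bendsBetween (L.kind s(d.fst, d.snd)) _ _ ++ _)) at hs
    rw [hpq] at hs
    simp only [polySegs, List.cons_append, List.nil_append, List.tail_cons, List.zip_cons_cons,
      List.zip_nil_right, List.mem_cons, List.not_mem_nil, or_false] at hs
    rcases hs with rfl | rfl | rfl
    exacts [h1, h2, h3]
  intro d₁ d₂ hd s hs t ht p hp
  exact (hseg d₁ s hs).allowed hd (hseg d₂ t ht) hp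

/-- Each coordinate of a bend is within 4 of that of a vertex, so the square from 0 to `8 * n`
contains everything; `(8 * n + 1) ^ 2 ≤ 81 * n ^ 2` since `n` is positive. -/
theorem drawing_areaLE (L : Layout V) (hL : L.Valid) (hG : L.edges = G.edgeSet) {n : ℕ}
    (hn : 0 < n) (hx : ∀ v, 0 ≤ L.px v ∧ L.px v < n) (hy : ∀ v, 0 ≤ L.py v ∧ L.py v < n) :
    (L.drawing hL hG).AreaLE (81 * n ^ 2) := by
  refine ⟨0, 0, 8 * n, 8 * n, by nlinarith, ?_, ?_⟩
  · intro v
    have := hx v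
    have := hy v
    simp only [drawing, center, Set.mem_prod, Set.mem_Icc]
    push_cast
    omega
  · intro d b hb
    have h1 := hx d.fst
    have h2 := hx d.snd
    have h3 := hy d.fst
    have h4 := hy d.snd
    have key : ∀ u v, s(u, v) ∈ L.edges → IsFirst (L.kind s(u, v)) (L.center u) (L.center v) →
        (canonicalBends (L.kind s(u, v)) (L.center u) (L.center v)).1 ∈
          Set.Icc 0 (8 * (n : ℤ)) ×ˢ Set.Icc 0 (8 * (n : ℤ)) ∧
        (canonicalBends (L.kind s(u, v)) (L.center u) (L.center v)).2 ∈
          Set.Icc 0 (8 * (n : ℤ)) ×ˢ Set.Icc 0 (8 * (n : ℤ)) := by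
      intro u v huv hf
      have := hx u
      have := hx v
      have := hy u
      have := hy v
      unfold canonicalBends
      split_ifs <;> simp only [center, Set.mem_prod, Set.mem_Icc] <;> omega
    change b ∈ bendsBetween (L.kind s(d.fst, d.snd)) (L.center d.fst) (L.center d.snd) at hb
    have hd : s(d.fst, d.snd) ∈ L.edges := by rw [hG]; exact d.edge_mem
    rw [zero_add]
    push_cast
    by_cases hf : IsFirst (L.kind s(d.fst, d.snd)) (L.center d.fst) (L.center d.snd)
    · simp only [bendsBetween, hf, if_true, List.mem_cons, List.not_mem_nil, or_false] at hb
      rcases hb with rfl | rfl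
      exacts [(key _ _ hd hf).1, (key _ _ hd hf).2]
    · have hne := hL.ne _ _ hd
      have hxn : L.px d.fst ≠ L.px d.snd := fun e => hne (L.px_inj e)
      have hyn : L.py d.fst ≠ L.py d.snd := fun e => hne (L.py_inj e)
      have hf' := (isFirst_comm (by simp only [center]; omega)
        (by simp only [center]; omega)).2 hf
      simp only [bendsBetween, hf, if_false, List.mem_cons, List.not_mem_nil, or_false] at hb
      rw [Sym2.eq_swap] at hd hf' hb
      rcases hb with rfl | rfl
      exacts [(key _ _ hd hf').2, (key _ _ hd hf').1]

end Layout

/-! ### Linear forests given by partner arrays -/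

namespace PathForest

/-- The vertices `u` and `v` are partners in one of two arrays, in which the partner `v` of `u` is
stored as `v + 1` and `0` means that there is none. -/
def Adj (A B : ℕ → ℕ) (u v : ℕ) : Prop := A u = v + 1 ∨ B u = v + 1

def Conn (A B : ℕ → ℕ) : ℕ → ℕ → Prop := Relation.ReflTransGen (Adj A B)

/-- The vertex `u` has at most one neighbor. -/
def IsEnd (A B : ℕ → ℕ) (u : ℕ) : Prop := A u = 0 ∨ B u = 0

/-- The other end of the path with the end `u`, where `0` stands for `u` itself. -/
def other (E : ℕ → ℕ) (u : ℕ) : ℕ := if E u = 0 then u else E u - 1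

/-- Both `u` and `v` get the other one as partner. -/
def join (A : ℕ → ℕ) (u v : ℕ) : ℕ → ℕ :=
  Function.update (Function.update A u (v + 1)) v (u + 1)

theorem join_apply (A : ℕ → ℕ) (u v w : ℕ) :
    join A u v w = if w = v then u + 1 else if w = u then v + 1 else A w := by
  simp only [join, Function.update_apply]

/-- The graph of two arrays consists of paths, and `E` stores the other end of each path. -/
structure _root_.PathForest (A B E : ℕ → ℕ) : Prop where
  symm_left : ∀ u v, A u = v + 1 → A v = u + 1
  symm_right : ∀ u v, B u = v + 1 → B v = u + 1
  -- `E` is meaningful at ends only. Inner vertices may keep stale values, which need never be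
  -- updated.
  isEnd_other : ∀ u, IsEnd A B u → IsEnd A B (other E u)
  conn_other : ∀ u, IsEnd A B u → Conn A B u (other E u)
  eq_of_conn : ∀ u v, IsEnd A B u → IsEnd A B v → Conn A B u v → v = u ∨ v = other E u
  other_eq_self : ∀ u, IsEnd A B u → (other E u = u ↔ A u = 0 ∧ B u = 0)
  -- Excludes cycles, which are components without an end.
  exists_end : ∀ u, ∃ w, IsEnd A B w ∧ Conn A B u w

variable {A B E : ℕ → ℕ}

theorem adj_symm (hF : PathForest A B E) {u v : ℕ} (h : Adj A B u v) : Adj A B v u :=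
  h.imp (hF.symm_left u v) (hF.symm_right u v)

theorem conn_symm (hF : PathForest A B E) {u v : ℕ} (h : Conn A B u v) : Conn A B v u := by
  induction h with
  | refl => exact .refl
  | tail _ hs ih => exact (Relation.ReflTransGen.single (adj_symm hF hs)).trans ih

theorem other_other (hF : PathForest A B E) {u : ℕ} (h : IsEnd A B u) :
    other E (other E u) = u := by
  rcases hF.eq_of_conn _ _ (hF.isEnd_other u h) h (conn_symm hF (hF.conn_other u h)) with h' | h'
  · rw [← h', ← h']
  · exact h'.symm

theorem other_join {x y : ℕ} (u : ℕ) :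
    other (join E x y) u = if u = y then x else if u = x then y else other E u := by
  simp only [other, join_apply]
  split_ifs <;> simp_all

/-- Shows that the comparison with the stored other end is a constant-time test for whether a new
edge would close a cycle. -/
theorem not_conn_of_other_ne (hF : PathForest A B E) {a b : ℕ} (ha : IsEnd A B a)
    (hb : IsEnd A B b) (hab : a ≠ b) (h : other E a ≠ b) : ¬ Conn A B a b := fun hc =>
  (hF.eq_of_conn a b ha hb hc).elim (fun e => hab e.symm) fun e => h e.symm

theorem adj_join_right {a b : ℕ} (hB : B a = 0) (hB' : B b = 0) (hab : a ≠ b) {u v : ℕ} :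
    Adj A (join B a b) u v ↔ Adj A B u v ∨ (u = a ∧ v = b) ∨ (u = b ∧ v = a) := by
  simp only [Adj, join_apply]
  split_ifs with h1 h2
  · subst h1
    have : u ≠ a := hab.symm
    simp only [hB', this, true_and, false_and, false_or]
    omega
  · subst h2
    simp only [hB, h1, true_and, false_and, or_false]
    omega
  · simp [h1, h2]

/-- Induction along the walk: traversing the new edge back cancels the earlier traversal. -/
theorem conn_join_right {a b : ℕ} (hB : B a = 0) (hB' : B b = 0) (hab : a ≠ b) {u v : ℕ}
    (h : Conn A (join B a b) u v) :
    Conn A B u v ∨ (Conn A B u a ∧ Conn A B b v) ∨ (Conn A B u b ∧ Conn A B a v) := by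
  induction h with
  | refl => exact .inl .refl
  | tail _ hs ih =>
    rcases (adj_join_right hB hB' hab).1 hs with hs | ⟨rfl, rfl⟩ | ⟨rfl, rfl⟩
    · rcases ih with ih | ⟨h1, h2⟩ | ⟨h1, h2⟩
      · exact .inl (ih.tail hs)
      · exact .inr (.inl ⟨h1, h2.tail hs⟩)
      · exact .inr (.inr ⟨h1, h2.tail hs⟩)
    · rcases ih with ih | ⟨h1, h2⟩ | ⟨h1, h2⟩
      · exact .inr (.inl ⟨ih, .refl⟩)
      · exact .inr (.inl ⟨h1, .refl⟩)
      · exact .inl h1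
    · rcases ih with ih | ⟨h1, h2⟩ | ⟨h1, h2⟩
      · exact .inr (.inr ⟨ih, .refl⟩)
      · exact .inl h1
      · exact .inr (.inr ⟨h1, .refl⟩)

theorem conn_mono {A B A' B' : ℕ → ℕ} (h : ∀ u v, Adj A B u v → Adj A' B' u v) {u v : ℕ}
    (hc : Conn A B u v) : Conn A' B' u v :=
  Relation.ReflTransGen.mono h _ _ hc

/-- Since `a` and `b` had no partner in `B`, no other vertex points to them, and overwriting leaves
no dangling entry. -/
theorem symm_join {a b : ℕ} (hs : ∀ u v, B u = v + 1 → B v = u + 1) (hB : B a = 0) (hB' : B b = 0)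
    (u v : ℕ) (h : join B a b u = v + 1) : join B a b v = u + 1 := by
  have h0 : ∀ w, B w = v + 1 → v ≠ a ∧ v ≠ b := by
    intro w hw
    have := hs w v hw
    constructor <;> rintro rfl <;> omega
  simp only [join_apply] at h ⊢
  split_ifs at h with h1 h2
  · obtain rfl : a = v := by omega
    split_ifs <;> omega
  · obtain rfl : b = v := by omega
    split_ifs <;> omega
  · obtain ⟨h3, h4⟩ := h0 u h
    rw [if_neg h4, if_neg h3]
    exact hs u v h

/-- Join the ends of two paths. -/
theorem joinPaths (hF : PathForest A B E) {a b : ℕ} (hB : B a = 0) (hB' : B b = 0) (hab : a ≠ b)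
    (hne : other E a ≠ b) :
    PathForest A (join B a b) (join E (other E a) (other E b)) := by
  have ha : IsEnd A B a := .inr hB
  have hb : IsEnd A B b := .inr hB'
  have hnc := not_conn_of_other_ne hF ha hb hab hne
  -- The far ends `x` and `y` become the ends of the merged path; `x = a` if `a` is isolated, and
  -- likewise for `y`.
  obtain ⟨x, hx⟩ : ∃ x, other E a = x := ⟨_, rfl⟩
  obtain ⟨y, hy⟩ : ∃ y, other E b = y := ⟨_, rfl⟩
  have hxa : Conn A B a x := hx ▸ hF.conn_other a ha
  have hyb : Conn A B b y := hy ▸ hF.conn_other b hb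
  have hxe : IsEnd A B x := hx ▸ hF.isEnd_other a ha
  have hye : IsEnd A B y := hy ▸ hF.isEnd_other b hb
  have hox : other E x = a := hx ▸ other_other hF ha
  have hoy : other E y = b := hy ▸ other_other hF hb
  have hxy : x ≠ y := by
    rintro rfl
    exact hnc (hxa.trans (conn_symm hF hyb))
  have hxb : x ≠ b := by rintro rfl; exact hnc hxa
  have hya : y ≠ a := by rintro rfl; exact hnc (conn_symm hF hyb)
  rw [hx, hy]
  have hmono : ∀ {u v}, Conn A B u v → Conn A (join B a b) u v := fun h =>
    conn_mono (fun u v h => (adj_join_right hB hB' hab).2 (.inl h)) h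
  have hcab : Conn A (join B a b) a b :=
    .single ((adj_join_right hB hB' hab).2 (.inr (.inl ⟨rfl, rfl⟩)))
  have hcba : Conn A (join B a b) b a :=
    .single ((adj_join_right hB hB' hab).2 (.inr (.inr ⟨rfl, rfl⟩)))
  -- `a` stays an end exactly if it was isolated, because then the new edge is its only one; the
  -- same holds for `b`.
  have hend : ∀ u, IsEnd A (join B a b) u ↔ IsEnd A B u ∧ (u = a → x = a) ∧ (u = b → y = b) := by
    intro u
    simp only [IsEnd, join_apply]
    split_ifs with h1 h2
    · subst h1
      have := hF.other_eq_self u hb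
      rw [hy] at this
      constructor
      · intro h
        have : A u = 0 := by simpa using h
        exact ⟨.inl this, fun h => (hab h.symm).elim, fun _ => by tauto⟩
      · rintro ⟨-, -, h⟩
        exact .inl (this.1 (h rfl)).1
    · subst h2
      have := hF.other_eq_self u ha
      rw [hx] at this
      constructor
      · intro h
        have : A u = 0 := by simpa using h
        exact ⟨.inl this, fun h => by tauto, fun h => (hab h).elim⟩
      · rintro ⟨-, h, -⟩
        exact .inl (this.1 (h rfl)).1
    · simp [h1, h2]
  have hex : IsEnd A (join B a b) x := (hend x).2 ⟨hxe, fun h => h, fun h => (hxb h).elim⟩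
  have hey : IsEnd A (join B a b) y := (hend y).2 ⟨hye, fun h => (hya h).elim, fun h => h⟩
  have hax : ∀ u, IsEnd A (join B a b) u → Conn A B a u → u = x := by
    intro u hu hc
    obtain ⟨h1, h2, -⟩ := (hend u).1 hu
    rcases hF.eq_of_conn a u ha h1 hc with rfl | h
    · exact (h2 rfl).symm
    · rw [h, hx]
  have hby : ∀ u, IsEnd A (join B a b) u → Conn A B b u → u = y := by
    intro u hu hc
    obtain ⟨h1, -, h2⟩ := (hend u).1 hu
    rcases hF.eq_of_conn b u hb h1 hc with rfl | h
    · exact (h2 rfl).symm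
    · rw [h, hy]
  refine ⟨hF.symm_left, symm_join hF.symm_right hB hB', ?_, ?_, ?_, ?_, ?_⟩
  · intro u hu
    rw [other_join]
    split_ifs with h1 h2
    · exact hex
    · exact hey
    · have hu' := ((hend u).1 hu).1
      refine (hend _).2 ⟨hF.isEnd_other u hu', fun h => ?_, fun h => ?_⟩
      · rw [← h, other_other hF hu'] at hx
        exact (h2 hx).elim
      · rw [← h, other_other hF hu'] at hy
        exact (h1 hy).elim
  · intro u hu
    rw [other_join]
    split_ifs with h1 h2
    · rw [h1]; exact (hmono (conn_symm hF hyb)).trans (hcba.trans (hmono hxa))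
    · rw [h2]; exact (hmono (conn_symm hF hxa)).trans (hcab.trans (hmono hyb))
    · exact hmono (hF.conn_other u ((hend u).1 hu).1)
  · intro u v hu hv hc
    rw [other_join]
    rcases conn_join_right hB hB' hab hc with hc | ⟨h1, h2⟩ | ⟨h1, h2⟩
    · split_ifs with h1 h2
      · left; rw [h1] at hc ⊢; exact hby v hv (hyb.trans hc)
      · left; rw [h2] at hc ⊢; exact hax v hv (hxa.trans hc)
      · exact hF.eq_of_conn u v ((hend u).1 hu).1 ((hend v).1 hv).1 hc
    · obtain rfl := hax u hu (conn_symm hF h1)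
      obtain rfl := hby v hv h2
      rw [if_neg hxy, if_pos rfl]
      exact .inr rfl
    · obtain rfl := hby u hu (conn_symm hF h1)
      obtain rfl := hax v hv h2
      rw [if_pos rfl]
      exact .inr rfl
  · intro u hu
    have hu' := (hend u).1 hu
    have hself := hF.other_eq_self u hu'.1
    rw [other_join]
    split_ifs with h1 h2
    · subst h1
      simp only [hxy, false_iff, join_apply]
      rw [hoy] at hself
      by_cases h3 : u = b
      · simp [h3]
      · rw [if_neg h3, if_neg hya]
        exact fun h => h3 (hself.2 h).symm
    · subst h2
      simp only [hxy.symm, false_iff, join_apply]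
      rw [hox] at hself
      by_cases h3 : u = a
      · simp [h3, hab]
      · rw [if_neg hxb, if_neg h3]
        exact fun h => h3 (hself.2 h).symm
    · rw [hself, join_apply, if_neg, if_neg]
      · rintro rfl; exact h2 (hu'.2.1 rfl).symm
      · rintro rfl; exact h1 (hu'.2.2 rfl).symm
  · intro u
    obtain ⟨w, hw, hc⟩ := hF.exists_end u
    by_cases h1 : w = a
    · exact ⟨x, hex, hmono (hc.trans (h1 ▸ hxa))⟩
    by_cases h2 : w = b
    · exact ⟨y, hey, hmono (hc.trans (h2 ▸ hyb))⟩
    exact ⟨w, (hend w).2 ⟨hw, fun h => (h1 h).elim, fun h => (h2 h).elim⟩, hmono hc⟩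

/-- Neither `u` nor `v` has a partner. -/
def cut (A : ℕ → ℕ) (u v : ℕ) : ℕ → ℕ := Function.update (Function.update A u 0) v 0

theorem cut_apply (A : ℕ → ℕ) (u v w : ℕ) :
    cut A u v w = if w = v then 0 else if w = u then 0 else A w := by
  simp only [cut, Function.update_apply]

/-- Connection is unchanged when a path from `a` to `b` is closed and cut after the first edge. -/
theorem conn_rotate (hF : PathForest A B E) {a b c : ℕ} (hB : B a = 0) (hB' : B b = 0)
    (hab : a ≠ b) (hE : other E a = b) (hA : A a = c + 1) (hcb : c ≠ b) {u v : ℕ} :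
    Conn (cut A a c) (join B a b) u v ↔ Conn A B u v := by
  have ha : IsEnd A B a := .inr hB
  have hcab : Conn A B a b := hE ▸ hF.conn_other a ha
  have hAc := hF.symm_left a c hA
  constructor
  · intro h
    induction h with
    | refl => exact .refl
    | tail _ hs ih =>
      rcases (adj_join_right hB hB' hab).1 hs with hs | ⟨rfl, rfl⟩ | ⟨rfl, rfl⟩
      · refine ih.tail (hs.imp_left fun h => ?_)
        rw [cut_apply] at h
        split_ifs at h
        exact h
      · exact ih.trans hcab
      · exact ih.trans (conn_symm hF hcab)
  · have hba : Conn (cut A a c) (join B a b) b a :=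
      .single ((adj_join_right hB hB' hab).2 (.inr (.inr ⟨rfl, rfl⟩)))
    have hab' : Conn (cut A a c) (join B a b) a b :=
      .single ((adj_join_right hB hB' hab).2 (.inr (.inl ⟨rfl, rfl⟩)))
    -- The only old neighbor of `a` is `c`. Replacing `a` by `c` in a walk contracts the edge that
    -- is cut and leaves a walk of the new forest; `a` itself is attached again through `b`.
    have key : ∀ u v, Conn A B u v → Conn (cut A a c) (join B a b)
        (if u = a then c else u) (if v = a then c else v) := by
      intro u v h
      induction h with
      | refl => exact .refl
      | @tail v w _ hs ih =>
        refine ih.trans ?_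
        have hs' := adj_symm hF hs
        by_cases hv : v = a
        · subst hv
          have : w = c := by rcases hs with h | h <;> omega
          subst this
          rw [if_pos rfl]
          split_ifs <;> exact .refl
        by_cases hw : w = a
        · subst hw
          have : v = c := by rcases hs' with h | h <;> omega
          subst this
          rw [if_pos rfl]
          split_ifs <;> exact .refl
        rw [if_neg hv, if_neg hw]
        refine .single ((adj_join_right hB hB' hab).2 (.inl (hs.imp_left fun h => ?_)))
        rw [cut_apply, if_neg, if_neg hv]
        · exact h
        · rintro rfl; omega
    have hcb' : Conn (cut A a c) (join B a b) c b := by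
      have := key a b hcab
      rwa [if_pos rfl, if_neg hab.symm] at this
    have hbc' : Conn (cut A a c) (join B a b) b c := by
      have := key b a (conn_symm hF hcab)
      rwa [if_pos rfl, if_neg hab.symm] at this
    intro h
    have := key u v h
    split_ifs at this with h1 h2 h2
    · rw [h1, h2]; exact .refl
    · rw [h1]; exact (hab'.trans hbc').trans this
    · rw [h2]; exact this.trans (hcb'.trans hba)
    · exact this

/-- Close the path from `a` to `b`, and cut it after the first edge. -/
theorem rotate (hF : PathForest A B E) {a b c : ℕ} (hB : B a = 0) (hB' : B b = 0)
    (hab : a ≠ b) (hE : other E a = b) (hA : A a = c + 1) (hcb : c ≠ b) (hca : c ≠ a) :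
    PathForest (cut A a c) (join B a b) (join E a c) := by
  have ha : IsEnd A B a := .inr hB
  have hb : IsEnd A B b := .inr hB'
  have hcab : Conn A B a b := hE ▸ hF.conn_other a ha
  have hAc := hF.symm_left a c hA
  have hcac : Conn A B a c := .single (.inl hA)
  have hconn : ∀ {u v}, Conn (cut A a c) (join B a b) u v ↔ Conn A B u v :=
    conn_rotate hF hB hB' hab hE hA hcb
  have hcomp : ∀ u, IsEnd A B u → Conn A B a u → u = a ∨ u = b := fun u hu hc => by
    rw [← hE]; exact hF.eq_of_conn a u ha hu hc
  -- The only ends of this path are `a` and `b`, so `c` is inner; it becomes an end by the cut, in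
  -- place of `b`.
  have hcend : B c ≠ 0 := fun h => (hcomp c (.inr h) hcac).elim hca hcb
  have hAb : A b ≠ 0 := by
    intro h
    have h1 := (hF.other_eq_self b hb).2 ⟨h, hB'⟩
    rw [← hE, other_other hF ha, hE] at h1
    exact hab h1
  have hend : ∀ u, IsEnd (cut A a c) (join B a b) u ↔ u = a ∨ u = c ∨ (IsEnd A B u ∧ u ≠ b) := by
    intro u
    simp only [IsEnd, join_apply, cut_apply]
    by_cases h1 : u = c
    · simp [h1]
    by_cases h2 : u = a
    · simp [h2]
    by_cases h3 : u = b
    · subst h3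
      simp [h1, h2, hAb]
    · simp [h1, h2, h3]
  have hother : ∀ u, IsEnd A B u → u ≠ a → u ≠ b →
      other E u ≠ a ∧ other E u ≠ b ∧ other E u ≠ c := by
    intro u hu h1 h2
    have hc := conn_symm hF (hF.conn_other u hu)
    have key : ¬ Conn A B a (other E u) := fun h => (hcomp u hu (h.trans hc)).elim h1 h2
    exact ⟨fun h => key (h ▸ .refl), fun h => key (h ▸ hcab), fun h => key (h ▸ hcac)⟩
  refine ⟨?_, symm_join hF.symm_right hB hB', ?_, ?_, ?_, ?_, ?_⟩
  · intro u v h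
    rw [cut_apply] at h ⊢
    split_ifs at h with h1 h2
    have := hF.symm_left u v h
    rw [if_neg, if_neg]
    · exact this
    · rintro rfl; omega
    · rintro rfl; omega
  · intro u hu
    rw [other_join]
    split_ifs with h1 h2
    · exact (hend _).2 (.inl rfl)
    · exact (hend _).2 (.inr (.inl rfl))
    · obtain ⟨hu, hub⟩ := (((hend u).1 hu).resolve_left h2).resolve_left h1
      exact (hend _).2 (.inr (.inr ⟨hF.isEnd_other u hu, (hother u hu h2 hub).2.1⟩))
  · intro u hu
    rw [other_join, hconn]
    split_ifs with h1 h2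
    · rw [h1]; exact conn_symm hF hcac
    · rw [h2]; exact hcac
    · obtain ⟨hu, hub⟩ := (((hend u).1 hu).resolve_left h2).resolve_left h1
      exact hF.conn_other u hu
  · intro u v hu hv hc
    rw [hconn] at hc
    have hv' : Conn A B a v → v = a ∨ v = c := by
      intro h
      rcases (hend v).1 hv with h1 | h1 | ⟨h1, h2⟩
      · exact .inl h1
      · exact .inr h1
      · exact .inl ((hcomp v h1 h).resolve_right h2)
    rw [other_join]
    split_ifs with h1 h2
    · rw [h1] at hc ⊢
      exact (hv' (hcac.trans hc)).symm
    · rw [h2] at hc ⊢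
      exact hv' hc
    · obtain ⟨hu, hub⟩ := (((hend u).1 hu).resolve_left h2).resolve_left h1
      have hnc : ¬ Conn A B a u := fun h => (hcomp u hu h).elim h2 hub
      rcases (hend v).1 hv with h3 | h3 | ⟨h3, -⟩
      · exact (hnc (conn_symm hF (h3 ▸ hc))).elim
      · exact (hnc (hcac.trans (conn_symm hF (h3 ▸ hc)))).elim
      · exact hF.eq_of_conn u v hu h3 hc
  · intro u hu
    rw [other_join, join_apply, cut_apply]
    by_cases h1 : u = c
    · simp [h1, hca.symm, hcb, hca, hcend]
    by_cases h2 : u = a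
    · simp [h2, hca.symm, hca, hab]
    obtain ⟨hu, hub⟩ := (((hend u).1 hu).resolve_left h2).resolve_left h1
    simp only [h1, h2, hub, if_false]
    exact hF.other_eq_self u hu
  · intro u
    obtain ⟨w, hw, hc⟩ := hF.exists_end u
    by_cases h1 : w = b
    · exact ⟨a, (hend a).2 (.inl rfl), hconn.2 (hc.trans (h1 ▸ conn_symm hF hcab))⟩
    · exact ⟨w, (hend w).2 (.inr (.inr ⟨hw, h1⟩)), hconn.2 hc⟩

end PathForest

/-! ### Two forests that cover three matchings -/

/-- `M c u v` says that an edge of color `c` joins `u` and `v`, where edges of the same color form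
matchings. -/
structure IsEdgeColored (M : ℕ → ℕ → ℕ → Prop) : Prop where
  symm : ∀ c u v, M c u v → M c v u
  unique : ∀ c u v w, M c u v → M c u w → v = w
  ne : ∀ c u v, M c u v → u ≠ v
  color_unique : ∀ c d u v, M c u v → M d u v → c = d

open PathForest in
/-- Two forests that cover the edges of the colors `0` and `6`, and those edges of the color `1`
whose ends satisfy `D`. -/
structure ForestPair (M : ℕ → ℕ → ℕ → Prop) (D : ℕ → Prop) (A₁ A₂ E B₁ B₂ F : ℕ → ℕ) : Prop where
  left : PathForest A₁ A₂ E
  right : PathForest B₁ B₂ F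
  color_zero : ∀ u v, A₁ u = v + 1 → M 0 u v
  ne_left : ∀ u v, Adj A₁ A₂ u v → u ≠ v
  ne_right : ∀ u v, Adj B₁ B₂ u v → u ≠ v
  -- Hence a vertex that is not done has a free second slot in the first forest and is an end there.
  done_left : ∀ u, A₂ u ≠ 0 → D u
  -- Stated for the whole path of `u` in the first forest, because `exchange` also needs the second
  -- slot of the neighbor `c` of an undone vertex.
  done_right : ∀ u v, B₂ u ≠ 0 → Conn A₁ A₂ u v → D v
  cover_zero : ∀ u v, M 0 u v → Adj A₁ A₂ u v ∨ Adj B₁ B₂ u v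
  cover_one : ∀ u v, M 1 u v → D u → Adj A₁ A₂ u v ∨ Adj B₁ B₂ u v
  cover_six : ∀ u v, M 6 u v → Adj B₁ B₂ u v

namespace ForestPair

open PathForest

variable {M : ℕ → ℕ → ℕ → Prop} {D : ℕ → Prop} {A₁ A₂ E B₁ B₂ F : ℕ → ℕ}

/-- Every component is a single vertex or a single edge, so the partner array itself stores the
other ends. -/
theorem _root_.PathForest.of_matching {A : ℕ → ℕ} (hs : ∀ u v, A u = v + 1 → A v = u + 1)
    (hne : ∀ u, A u ≠ u + 1) : PathForest A (fun _ => 0) A := by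
  have hend : ∀ u, IsEnd A (fun _ => 0) u := fun u => .inr rfl
  have hadj : ∀ u v, Adj A (fun _ => 0) u v ↔ A u = v + 1 := fun u v => by simp [Adj]
  refine ⟨hs, by simp, fun u _ => hend _, ?_, ?_, ?_, fun u => ⟨u, hend u, .refl⟩⟩
  · intro u _
    unfold other
    split_ifs with h
    · exact .refl
    · exact .single ((hadj _ _).2 (by omega))
  · intro u v _ hv h
    clear hv
    unfold other
    induction h with
    | refl => exact .inl rfl
    | @tail v w _ hs' ih =>
      rw [hadj] at hs'
      split_ifs at ih ⊢ with h0
      · rcases ih with rfl | rfl <;> omega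
      · rcases ih with rfl | h
        · right; omega
        · have := hs u v (by omega)
          left; omega
  · intro u _
    have := hne u
    unfold other
    split_ifs with h0
    · simp [h0]
    · constructor
      · intro h; omega
      · intro h; exact (h0 h.1).elim

theorem of_matchings (hM : IsEdgeColored M) {A B : ℕ → ℕ} (hA : ∀ u v, A u = v + 1 ↔ M 0 u v)
    (hB : ∀ u v, B u = v + 1 ↔ M 6 u v) :
    ForestPair M (fun _ => False) A (fun _ => 0) A B (fun _ => 0) B where
  left := .of_matching (fun u v h => (hA _ _).2 (hM.symm _ _ _ ((hA _ _).1 h)))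
    fun u h => hM.ne _ _ _ ((hA _ _).1 h) rfl
  right := .of_matching (fun u v h => (hB _ _).2 (hM.symm _ _ _ ((hB _ _).1 h)))
    fun u h => hM.ne _ _ _ ((hB _ _).1 h) rfl
  color_zero u v := (hA u v).1
  ne_left u v h := by
    rcases h with h | h
    · exact hM.ne _ _ _ ((hA _ _).1 h)
    · simp at h
  ne_right u v h := by
    rcases h with h | h
    · exact hM.ne _ _ _ ((hB _ _).1 h)
    · simp at h
  done_left u h := h rfl
  done_right u v h := (h rfl).elim
  cover_zero u v h := .inl (.inl ((hA _ _).2 h))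
  cover_one u v _ h := h.elim
  cover_six u v h := .inl ((hB _ _).2 h)

theorem ne_join {A B : ℕ → ℕ} {a b : ℕ} (h : ∀ u v, Adj A B u v → u ≠ v) (hB : B a = 0)
    (hB' : B b = 0) (hab : a ≠ b) (u v : ℕ) (hc : Adj A (join B a b) u v) : u ≠ v := by
  rcases (adj_join_right hB hB' hab).1 hc with hc | ⟨rfl, rfl⟩ | ⟨rfl, rfl⟩
  exacts [h u v hc, hab, hab.symm]

section step

variable {a b : ℕ}

theorem right_eq_zero (h : ForestPair M D A₁ A₂ E B₁ B₂ F) (ha : ¬ D a) : B₂ a = 0 := by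
  by_contra hc
  exact ha (h.done_right a a hc .refl)

theorem left_eq_zero (h : ForestPair M D A₁ A₂ E B₁ B₂ F) (ha : ¬ D a) : A₂ a = 0 := by
  by_contra hc
  exact ha (h.done_left a hc)

/-- The vertices `a` and `b` that become done are each other's only partners in color 1. -/
theorem cover_one_step (hM : IsEdgeColored M) (hab : M 1 a b) {S : ℕ → ℕ → Prop}
    (hS : ∀ u v, M 1 u v → D u → S u v) (h1 : S a b) (h2 : S b a) (u v : ℕ) (huv : M 1 u v)
    (hD : D u ∨ u = a ∨ u = b) : S u v := by
  rcases hD with hD | rfl | rfl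
  · exact hS u v huv hD
  · rwa [hM.unique _ _ _ _ huv hab]
  · rwa [hM.unique _ _ _ _ huv (hM.symm _ _ _ hab)]

/-- Put an edge of color `1` into the first forest. -/
theorem join_left (hM : IsEdgeColored M) (h : ForestPair M D A₁ A₂ E B₁ B₂ F) (hab : M 1 a b)
    (ha : ¬ D a) (hb : ¬ D b) (hE : other E a ≠ b) :
    ForestPair M (fun u => D u ∨ u = a ∨ u = b) A₁ (join A₂ a b)
      (join E (other E a) (other E b)) B₁ B₂ F := by
  have hA := h.left_eq_zero ha
  have hA' := h.left_eq_zero hb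
  have hne := hM.ne _ _ _ hab
  have hadj : ∀ {u v}, Adj A₁ (join A₂ a b) u v ↔ _ := adj_join_right hA hA' hne
  refine ⟨joinPaths h.left hA hA' hne hE, h.right, h.color_zero, ne_join h.ne_left hA hA' hne,
    h.ne_right, ?_, ?_, ?_, ?_, h.cover_six⟩
  · intro u hu
    rw [join_apply] at hu
    split_ifs at hu with h1 h2
    · exact .inr (.inr h1)
    · exact .inr (.inl h2)
    · exact .inl (h.done_left u hu)
  -- Only the paths of the undone vertices `a` and `b` are merged, and by `done_right` no vertex on
  -- them uses its slot in `B₂`.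
  · intro u v hu hc
    rcases conn_join_right hA hA' hne hc with hc | ⟨hc, -⟩ | ⟨hc, -⟩
    · exact .inl (h.done_right u v hu hc)
    · exact (ha (h.done_right u a hu hc)).elim
    · exact (hb (h.done_right u b hu hc)).elim
  · exact fun u v huv => (h.cover_zero u v huv).imp_left fun h => hadj.2 (.inl h)
  · exact cover_one_step hM hab
      (fun u v huv hD => (h.cover_one u v huv hD).imp_left fun h => hadj.2 (.inl h))
      (.inl (hadj.2 (.inr (.inl ⟨rfl, rfl⟩)))) (.inl (hadj.2 (.inr (.inr ⟨rfl, rfl⟩))))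

/-- All vertices of the path with the ends `a` and `b` other than these are done. -/
theorem done_of_conn (h : ForestPair M D A₁ A₂ E B₁ B₂ F) (ha : ¬ D a)
    (hE : other E a = b) {v : ℕ} (hc : Conn A₁ A₂ a v) : D v ∨ v = a ∨ v = b := by
  -- With a free second slot `v` is an end of the path; otherwise `done_left` applies.
  by_cases hv : A₂ v = 0
  · rw [← hE]
    exact .inr (h.left.eq_of_conn a v (.inr (h.left_eq_zero ha)) (.inr hv) hc)
  · exact .inl (h.done_left v hv)

/-- Put an edge of color `1` into the second forest. -/
theorem join_right (hM : IsEdgeColored M) (h : ForestPair M D A₁ A₂ E B₁ B₂ F) (hab : M 1 a b)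
    (ha : ¬ D a) (hb : ¬ D b) (hE : other E a = b) (hF : other F a ≠ b) :
    ForestPair M (fun u => D u ∨ u = a ∨ u = b) A₁ A₂ E B₁ (join B₂ a b)
      (join F (other F a) (other F b)) := by
  have hB := h.right_eq_zero ha
  have hB' := h.right_eq_zero hb
  have hne := hM.ne _ _ _ hab
  have hadj : ∀ {u v}, Adj B₁ (join B₂ a b) u v ↔ _ := adj_join_right hB hB' hne
  have hcab : Conn A₁ A₂ a b := hE ▸ h.left.conn_other a (.inr (h.left_eq_zero ha))
  refine ⟨h.left, joinPaths h.right hB hB' hne hF, h.color_zero, h.ne_left,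
    ne_join h.ne_right hB hB' hne, fun u hu => .inl (h.done_left u hu), ?_, ?_, ?_, ?_⟩
  -- `a` and `b` are the ends of one path of the first forest, all of which is done from now on.
  · intro u v hu hc
    rw [join_apply] at hu
    split_ifs at hu with h1 h2
    · exact h.done_of_conn ha hE (hcab.trans (h1 ▸ hc))
    · exact h.done_of_conn ha hE (h2 ▸ hc)
    · exact .inl (h.done_right u v hu hc)
  · exact fun u v huv => (h.cover_zero u v huv).imp_right fun h => hadj.2 (.inl h)
  · exact cover_one_step hM hab
      (fun u v huv hD => (h.cover_one u v huv hD).imp_right fun h => hadj.2 (.inl h))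
      (.inr (hadj.2 (.inr (.inl ⟨rfl, rfl⟩)))) (.inr (hadj.2 (.inr (.inr ⟨rfl, rfl⟩))))
  · exact fun u v huv => hadj.2 (.inl (h.cover_six u v huv))

/-- The path from `a` to `b` leaves `a` through the first slot, as the second one is free. Its first
edge has color 0 and so differs from `ab`, which has color 1. -/
theorem exists_left (hM : IsEdgeColored M) (h : ForestPair M D A₁ A₂ E B₁ B₂ F) (hab : M 1 a b)
    (ha : ¬ D a) (hE : other E a = b) : ∃ c, A₁ a = c + 1 ∧ c ≠ b ∧ c ≠ a := by
  have hA := h.left_eq_zero ha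
  have hne := hM.ne _ _ _ hab
  obtain ⟨c, hc⟩ : ∃ c, A₁ a = c + 1 := by
    refine Nat.exists_eq_succ_of_ne_zero fun h0 => hne ?_
    rw [← hE, (h.left.other_eq_self a (.inr hA)).2 ⟨h0, hA⟩]
  refine ⟨c, hc, ?_, (h.ne_left a c (.inl hc)).symm⟩
  rintro rfl
  exact zero_ne_one (hM.color_unique _ _ _ _ (h.color_zero a c hc) hab)

/-- Put an edge of color `1` into the first forest, and an adjacent edge of color `0` from there
into the second forest. -/
theorem exchange (hM : IsEdgeColored M) (h : ForestPair M D A₁ A₂ E B₁ B₂ F) (hab : M 1 a b)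
    (ha : ¬ D a) (hb : ¬ D b) (hE : other E a = b) (hF : other F a = b) {c : ℕ}
    (hc : A₁ a = c + 1) (hcb : c ≠ b) (hca : c ≠ a) :
    ForestPair M (fun u => D u ∨ u = a ∨ u = b) (cut A₁ a c) (join A₂ a b) (join E a c)
      B₁ (join B₂ a c) (join F (other F a) (other F c)) := by
  have hA := h.left_eq_zero ha
  have hA' := h.left_eq_zero hb
  have hB := h.right_eq_zero ha
  have hne := hM.ne _ _ _ hab
  have hcac : Conn A₁ A₂ a c := .single (.inl hc)
  -- Were this slot in use, `done_right` would make `a` done, since `a` lies on the path of `c`.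
  have hB' : B₂ c = 0 := by
    by_contra h0
    exact ha (h.done_right c a h0 (conn_symm h.left hcac))
  have hcab : Conn A₁ A₂ a b := hE ▸ h.left.conn_other a (.inr hA)
  have hadjA : ∀ {u v}, Adj (cut A₁ a c) (join A₂ a b) u v ↔ _ := adj_join_right hA hA' hne
  have hadjB : ∀ {u v}, Adj B₁ (join B₂ a c) u v ↔ _ := adj_join_right hB hB' hca.symm
  have hAc := h.left.symm_left a c hc
  have hmoved : ∀ u v, Adj A₁ A₂ u v →
      Adj (cut A₁ a c) (join A₂ a b) u v ∨ Adj B₁ (join B₂ a c) u v := by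
    intro u v huv
    rcases huv with huv | huv
    · by_cases h1 : u = a
      · subst h1
        obtain rfl : c = v := by omega
        exact .inr (hadjB.2 (.inr (.inl ⟨rfl, rfl⟩)))
      by_cases h2 : u = c
      · subst h2
        obtain rfl : a = v := by omega
        exact .inr (hadjB.2 (.inr (.inr ⟨rfl, rfl⟩)))
      refine .inl (hadjA.2 (.inl (.inl ?_)))
      rw [cut_apply, if_neg h2, if_neg h1, huv]
    · exact .inl (hadjA.2 (.inl (.inr huv)))
  have hkeep : ∀ u v, Adj A₁ A₂ u v ∨ Adj B₁ B₂ u v →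
      Adj (cut A₁ a c) (join A₂ a b) u v ∨ Adj B₁ (join B₂ a c) u v := by
    rintro u v (h | h)
    · exact hmoved u v h
    · exact .inr (hadjB.2 (.inl h))
  have hcut : ∀ u v, cut A₁ a c u = v + 1 → A₁ u = v + 1 := by
    intro u v huv
    rw [cut_apply] at huv
    split_ifs at huv
    exact huv
  -- In the second forest the path from `a` ends at `b`, which is not `c`; hence `ac` closes no
  -- cycle there.
  refine ⟨rotate h.left hA hA' hne hE hc hcb hca, joinPaths h.right hB hB' hca.symm (hF ▸ hcb.symm),
    fun u v huv => h.color_zero u v (hcut u v huv),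
    ne_join (fun u v huv => h.ne_left u v (huv.imp_left (hcut u v))) hA hA' hne,
    ne_join h.ne_right hB hB' hca.symm, ?_, ?_, ?_, ?_, ?_⟩
  · intro u hu
    rw [join_apply] at hu
    split_ifs at hu with h1 h2
    · exact .inr (.inr h1)
    · exact .inr (.inl h2)
    · exact .inl (h.done_left u hu)
  · intro u v hu huv
    -- The rotation preserves the components of the first forest, so `done_right` need be checked
    -- for the old ones only.
    rw [conn_rotate h.left hA hA' hne hE hc hcb] at huv
    rw [join_apply] at hu
    split_ifs at hu with h1 h2
    · exact h.done_of_conn ha hE (hcac.trans (h1 ▸ huv))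
    · exact h.done_of_conn ha hE (h2 ▸ huv)
    · exact .inl (h.done_right u v hu huv)
  · exact fun u v huv => hkeep u v (h.cover_zero u v huv)
  · exact cover_one_step hM hab (fun u v huv hD => hkeep u v (h.cover_one u v huv hD))
      (.inl (hadjA.2 (.inr (.inl ⟨rfl, rfl⟩)))) (.inl (hadjA.2 (.inr (.inr ⟨rfl, rfl⟩))))
  · exact fun u v huv => hadjB.2 (.inl (h.cover_six u v huv))

end step

end ForestPair

/-! ### Ordering the vertices along the paths of a forest -/

open PathForest in
/-- The state of the traversal: the vertices `u` with `P u ≠ 0` have been visited and are numbered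
from `1` to `count`, the vertex to be visited next is `cur - 1` unless `cur = 0`, and all ends less
than `s` have been treated. -/
structure Traversal (A B : ℕ → ℕ) (n : ℕ) (P : ℕ → ℕ) (s cur count : ℕ) : Prop where
  inj : ∀ u v, P u ≠ 0 → P u = P v → u = v
  le_count : ∀ u, P u ≤ count
  surj : ∀ c, 1 ≤ c → c ≤ count → ∃ u, P u = c
  lt : ∀ u, P u ≠ 0 → u < n
  consecutive : ∀ v w, P v ≠ 0 → Adj A B v w →
    (P w ≠ 0 ∧ (P v = P w + 1 ∨ P w = P v + 1)) ∨ (cur = w + 1 ∧ P v = count)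
  -- Guarantees that at most one neighbor of the current vertex is still unvisited.
  cur_spec : ∀ w, cur = w + 1 → w < n ∧ P w = 0 ∧ (IsEnd A B w ∨ ∃ v, Adj A B w v ∧ P v ≠ 0)
  scan : ∀ u, u < s → IsEnd A B u → P u ≠ 0 ∨ cur = u + 1
  scan_le : s ≤ n

namespace Traversal

open PathForest

variable {A B E P : ℕ → ℕ} {n s cur count : ℕ}

theorem init (A B : ℕ → ℕ) (n : ℕ) : Traversal A B n (fun _ => 0) 0 0 0 := by
  refine ⟨?_, ?_, ?_, ?_, ?_, ?_, ?_, n.zero_le⟩ <;> simp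
  omega

/-- The numbers from 1 to `count` are taken by distinct vertices below `n`. -/
theorem count_le (h : Traversal A B n P s cur count) : count ≤ n := by
  choose f hf using fun c : Fin count => h.surj (c + 1) (by omega) c.2
  have hf' : ∀ c, f c < n := fun c => h.lt _ (by rw [hf]; omega)
  have : Function.Injective fun c => (⟨f c, hf' c⟩ : Fin n) := by
    intro c d hcd
    have h1 := hf c
    rw [Fin.mk.inj hcd, hf d] at h1
    exact Fin.ext (by omega)
  simpa using Fintype.card_le_of_injective _ this

/-- Visit the vertex `c`. -/
theorem visit (hF : PathForest A B E) (hne : ∀ u v, Adj A B u v → u ≠ v) (hA : ∀ u, A u ≤ n)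
    (hB : ∀ u, B u ≤ n) {c nxt : ℕ} (h : Traversal A B n P s (c + 1) count)
    (hnxt : (A c ≠ 0 ∧ P (A c - 1) = 0 ∧ nxt = A c) ∨ (¬ (A c ≠ 0 ∧ P (A c - 1) = 0) ∧
      ((B c ≠ 0 ∧ P (B c - 1) = 0 ∧ nxt = B c) ∨ (¬ (B c ≠ 0 ∧ P (B c - 1) = 0) ∧ nxt = 0)))) :
    Traversal A B n (Function.update P c (count + 1)) s nxt (count + 1) := by
  obtain ⟨hcn, hPc, hc⟩ := h.cur_spec c rfl
  have hP : ∀ u, u ≠ c → Function.update P c (count + 1) u = P u := fun u hu =>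
    Function.update_of_ne hu _ _
  have hPc' : Function.update P c (count + 1) c = count + 1 := Function.update_self _ _ _
  have hle : ∀ u, Function.update P c (count + 1) u ≤ count + 1 := by
    intro u
    have := h.le_count u
    by_cases hu : u = c
    · rw [hu, hPc']
    · rw [hP u hu]; omega
  have hnadj : ∀ w, nxt = w + 1 → Adj A B c w ∧ P w = 0 := by
    intro w hw
    rcases hnxt with ⟨h1, h2, h3⟩ | ⟨-, ⟨h1, h2, h3⟩ | ⟨-, h3⟩⟩
    · have h4 : A c = w + 1 := by omega
      exact ⟨.inl h4, by rw [h4] at h2; exact h2⟩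
    · have h4 : B c = w + 1 := by omega
      exact ⟨.inr h4, by rw [h4] at h2; exact h2⟩
    · omega
  refine ⟨?_, hle, ?_, ?_, ?_, ?_, ?_, h.scan_le⟩
  · intro u v hu huv
    have h1 := h.le_count u
    have h2 := h.le_count v
    by_cases hu' : u = c <;> by_cases hv' : v = c
    · rw [hu', hv']
    · rw [hu', hPc', hP v hv'] at huv; omega
    · rw [hv', hPc', hP u hu'] at huv; omega
    · rw [hP u hu', hP v hv'] at huv
      rw [hP u hu'] at hu
      exact h.inj u v hu huv
  · intro d hd hd'
    rcases Nat.lt_or_ge count d with hcd | hcd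
    · exact ⟨c, by rw [hPc']; omega⟩
    · obtain ⟨u, hu⟩ := h.surj d hd hcd
      refine ⟨u, ?_⟩
      rw [hP u, hu]
      rintro rfl; omega
  · intro u hu
    by_cases hu' : u = c
    · rwa [hu']
    · rw [hP u hu'] at hu; exact h.lt u hu
  · intro v w hv hvw
    by_cases hvc : v = c
    · subst hvc
      have hwv := (hne v w hvw).symm
      rw [hPc', hP w hwv]
      by_cases hw : P w = 0
      · right
        refine ⟨?_, rfl⟩
        rcases hvw with h1 | h1
        · rcases hnxt with ⟨-, -, h3⟩ | ⟨h3, -⟩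
          · omega
          · exact (h3 ⟨by omega, by rw [h1]; exact hw⟩).elim
        · rcases hnxt with ⟨h2, h3, h4⟩ | ⟨-, ⟨-, -, h3⟩ | ⟨h3, -⟩⟩
          -- Both partners of the current vertex would be unvisited, although it is an end or has a
          -- visited neighbor.
          · rcases hc with (h5 | h5) | ⟨x, h5 | h5, h6⟩
            · omega
            · omega
            · rw [h5] at h3; exact (h6 h3).elim
            · obtain rfl : x = w := by omega
              exact (h6 hw).elim
          · omega
          · exact (h3 ⟨by omega, by rw [h1]; exact hw⟩).elim
      -- A visited neighbor of the current vertex is the one visited last, with number `count`.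
      · rcases h.consecutive w v hw (adj_symm hF hvw) with ⟨h1, -⟩ | ⟨-, h1⟩
        · exact (h1 hPc).elim
        · exact .inl ⟨hw, .inl (by omega)⟩
    · rw [hP v hvc] at hv ⊢
      rcases h.consecutive v w hv hvw with ⟨h1, h2⟩ | ⟨h1, h2⟩
      · rw [hP w (by rintro rfl; exact h1 hPc)]
        exact .inl ⟨h1, h2⟩
      · obtain rfl : c = w := by omega
        rw [hPc', h2]
        exact .inl ⟨by omega, .inr rfl⟩
  · intro w hw
    obtain ⟨h1, h2⟩ := hnadj w hw
    have hwc := (hne c w h1).symm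
    refine ⟨?_, by rw [hP w hwc]; exact h2, .inr ⟨c, adj_symm hF h1, by rw [hPc']; omega⟩⟩
    have := hA c
    have := hB c
    rcases h1 with h1 | h1 <;> omega
  · intro u hu hend
    left
    by_cases huc : u = c
    · rw [huc, hPc']; omega
    · rw [hP u huc]
      exact (h.scan u hu hend).resolve_right (by omega)

/-- Treat the vertex `s`. -/
theorem next (h : Traversal A B n P s 0 count) (hs : s < n) {cur' : ℕ}
    (hcur : (P s = 0 ∧ IsEnd A B s ∧ cur' = s + 1) ∨ (¬ (P s = 0 ∧ IsEnd A B s) ∧ cur' = 0)) :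
    Traversal A B n P (s + 1) cur' count := by
  refine ⟨h.inj, h.le_count, h.surj, h.lt, ?_, ?_, ?_, hs⟩
  · intro v w hv hvw
    exact .inl ((h.consecutive v w hv hvw).resolve_right (by omega))
  · intro w hw
    rcases hcur with ⟨h1, h2, h3⟩ | ⟨-, h3⟩
    · obtain rfl : s = w := by omega
      exact ⟨hs, h1, .inl h2⟩
    · omega
  · intro u hu hend
    by_cases hus : u = s
    · subst hus
      rcases hcur with ⟨h1, h2, h3⟩ | ⟨h1, -⟩
      · exact .inr h3
      · exact .inl fun h => h1 ⟨h, hend⟩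
    · exact .inl ((h.scan u (by omega) hend).resolve_right (by omega))

/-- All ends have been scanned, every path has an end, and with `cur = 0` being visited spreads to
neighbors. -/
theorem visited (hF : PathForest A B E) (hA : ∀ u, A u ≤ n)
    (hB : ∀ u, B u ≤ n) (h : Traversal A B n P n 0 count) {u : ℕ} (hu : u < n) : P u ≠ 0 := by
  obtain ⟨w, hw, hc⟩ := hF.exists_end u
  have hwn : w < n := by
    clear hw
    induction hc with
    | refl => exact hu
    | @tail v w _ hs _ =>
      have := hA v
      have := hB v
      rcases hs with hs | hs <;> omega
  have hPw := (h.scan w hwn hw).resolve_right (by omega)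
  have hc' := conn_symm hF hc
  clear hc hu
  induction hc' with
  | refl => exact hPw
  | tail _ hs ih => exact ((h.consecutive _ _ ih hs).resolve_right (by omega)).1

end Traversal

/-! ### The algorithm: computing two forests -/

open PathForest

namespace WordRAM

/-- Make the values of the registers `x` and `y` partners in the array `a`. -/
def joinProgram (a x y : ℕ) : Program :=
  .seq (.store a (.reg x) (.add (.reg y) (.const 1)))
    (.store a (.reg y) (.add (.reg x) (.const 1)))

/-- Remove the partners of the values of the registers `x` and `y` in the array `a`. -/
def cutProgram (a x y : ℕ) : Program :=
  .seq (.store a (.reg x) (.const 0)) (.store a (.reg y) (.const 0))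

/-- Write the other end of the path with the end `x` into register `r`. -/
def otherProgram (r a x : ℕ) : Program :=
  .ite (.eq (.arr a (.reg x)) (.const 0)) (.set r (.reg x))
    (.set r (.sub (.arr a (.reg x)) (.const 1)))

def State.join (σ : State) (a u v : ℕ) : State := (σ.setArr a u (v + 1)).setArr a v (u + 1)

def State.cut (σ : State) (a u v : ℕ) : State := (σ.setArr a u 0).setArr a v 0

@[simp] theorem State.join_reg (σ : State) (a u v : ℕ) : (σ.join a u v).reg = σ.reg := rfl

@[simp] theorem State.cut_reg (σ : State) (a u v : ℕ) : (σ.cut a u v).reg = σ.reg := rfl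

@[simp] theorem State.join_arr (σ : State) (a u v b : ℕ) :
    (σ.join a u v).arr b = if b = a then PathForest.join (σ.arr a) u v else σ.arr b := by
  simp only [State.join, State.setArr_arr, PathForest.join]
  split_ifs <;> simp_all

@[simp] theorem State.cut_arr (σ : State) (a u v b : ℕ) :
    (σ.cut a u v).arr b = if b = a then PathForest.cut (σ.arr a) u v else σ.arr b := by
  simp only [State.cut, State.setArr_arr, PathForest.cut]
  split_ifs <;> simp_all

@[simp] theorem wp_joinProgram {W a x y : ℕ} {Φ : State → Prop} {σ : State} :
    (joinProgram a x y).wp W Φ σ ↔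
      (σ.reg x + 1 ≤ W ∧ σ.reg y + 1 ≤ W) ∧ Φ (σ.join a (σ.reg x) (σ.reg y)) := by
  simp only [joinProgram, Program.wp, Expr.eval, State.join, State.setArr_reg]
  constructor
  · rintro ⟨h1, h2, h3, h4, h5⟩
    exact ⟨⟨h4, h2⟩, h5⟩
  · rintro ⟨⟨h1, h2⟩, h3⟩
    exact ⟨by omega, h2, by omega, h1, h3⟩

@[simp] theorem wp_cutProgram {W a x y : ℕ} {Φ : State → Prop} {σ : State} :
    (cutProgram a x y).wp W Φ σ ↔
      (σ.reg x ≤ W ∧ σ.reg y ≤ W) ∧ Φ (σ.cut a (σ.reg x) (σ.reg y)) := by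
  simp [cutProgram, Program.wp, Expr.eval, State.cut, and_assoc]

@[simp] theorem wp_otherProgram {W r a x : ℕ} {Φ : State → Prop} {σ : State} :
    (otherProgram r a x).wp W Φ σ ↔ other (σ.arr a) (σ.reg x) ≤ W ∧
      Φ (σ.setReg r (other (σ.arr a) (σ.reg x))) := by
  simp only [otherProgram, Program.wp, Expr.eval, Test.Holds, other]
  split_ifs with h <;> simp [h]

/-- Read the ends and the color of the current edge into the registers `3`, `4` and `5`. -/
def loadEdge : Program :=
  .seq (.set 3 (.arr 0 (.reg 2))) (.seq (.set 4 (.arr 1 (.reg 2))) (.set 5 (.arr 2 (.reg 2))))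

/-- The partners in the colors `0` and `6`. -/
def matchingsBody : Program :=
  .seq loadEdge
    (.seq (.ite (.eq (.reg 5) (.const 0)) (.seq (joinProgram 10 3 4) (joinProgram 12 3 4)) .skip)
      (.ite (.eq (.reg 5) (.const 6)) (.seq (joinProgram 13 3 4) (joinProgram 15 3 4)) .skip))

/-- Distribute the edges of color `1` over the two forests. -/
def forestsBody : Program :=
  .seq loadEdge (.ite (.eq (.reg 5) (.const 1))
    (.ite (.eq (.arr 12 (.reg 3)) (.add (.reg 4) (.const 1)))
      (.ite (.eq (.arr 15 (.reg 3)) (.add (.reg 4) (.const 1)))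
        (.seq (.set 6 (.sub (.arr 10 (.reg 3)) (.const 1)))
          (.seq (otherProgram 7 15 3) (.seq (otherProgram 8 15 6)
            (.seq (cutProgram 10 3 6) (.seq (joinProgram 11 3 4) (.seq (joinProgram 12 3 6)
              (.seq (joinProgram 14 3 6) (joinProgram 15 7 8))))))))
        (.seq (otherProgram 7 15 3) (.seq (otherProgram 8 15 4)
          (.seq (joinProgram 14 3 4) (joinProgram 15 7 8)))))
      (.seq (otherProgram 7 12 3) (.seq (otherProgram 8 12 4)
        (.seq (joinProgram 11 3 4) (joinProgram 12 7 8)))))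
    .skip)

end WordRAM

/-- One of the first `k` edges joins `u` and `v` and has color `c`, where the arrays `U`, `V` and
`C` hold the ends and the colors of the edges. -/
def EdgeRel (U V C : ℕ → ℕ) (k c u v : ℕ) : Prop :=
  ∃ j < k, C j = c ∧ ((U j = u ∧ V j = v) ∨ (U j = v ∧ V j = u))

/-- One of the first `k` edges has color `1` and the end `u`. -/
def IsDone (U V C : ℕ → ℕ) (k u : ℕ) : Prop := ∃ j < k, C j = 1 ∧ (U j = u ∨ V j = u)

/-- The arrays list `m` edges, without repetition, of a properly edge-colored graph with the
vertices `0, …, n - 1`. -/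
structure IsInput (n m : ℕ) (U V C : ℕ → ℕ) : Prop where
  fst_lt : ∀ j < m, U j < n
  snd_lt : ∀ j < m, V j < n
  color_le : ∀ j < m, C j ≤ 6
  inj : ∀ i < m, ∀ j < m, (U i = U j ∧ V i = V j) ∨ (U i = V j ∧ V i = U j) → i = j
  colored : IsEdgeColored (EdgeRel U V C m)

theorem edgeRel_succ {U V C : ℕ → ℕ} {k c u v : ℕ} : EdgeRel U V C (k + 1) c u v ↔
    EdgeRel U V C k c u v ∨ (C k = c ∧ ((U k = u ∧ V k = v) ∨ (U k = v ∧ V k = u))) := by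
  constructor
  · rintro ⟨j, hj, h⟩
    rcases Nat.lt_succ_iff_lt_or_eq.1 hj with hj | rfl
    · exact .inl ⟨j, hj, h⟩
    · exact .inr h
  · rintro (⟨j, hj, h⟩ | h)
    · exact ⟨j, by omega, h⟩
    · exact ⟨k, by omega, h⟩

theorem isDone_succ {U V C : ℕ → ℕ} {k u : ℕ} : IsDone U V C (k + 1) u ↔
    IsDone U V C k u ∨ (C k = 1 ∧ (U k = u ∨ V k = u)) := by
  constructor
  · rintro ⟨j, hj, h⟩
    rcases Nat.lt_succ_iff_lt_or_eq.1 hj with hj | rfl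
    · exact .inl ⟨j, hj, h⟩
    · exact .inr h
  · rintro (⟨j, hj, h⟩ | h)
    · exact ⟨j, by omega, h⟩
    · exact ⟨k, by omega, h⟩

theorem EdgeRel.mono {U V C : ℕ → ℕ} {k l c u v : ℕ} (hkl : k ≤ l) (h : EdgeRel U V C k c u v) :
    EdgeRel U V C l c u v := by
  obtain ⟨j, hj, h⟩ := h
  exact ⟨j, by omega, h⟩

/-- By `ha` and `hb` an entry that gets overwritten already held the new value, as is the case in a
matching. -/
theorem join_eq_iff {A : ℕ → ℕ} {R : ℕ → ℕ → Prop} (h : ∀ u v, A u = v + 1 ↔ R u v) {a b : ℕ}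
    (ha : ∀ v, R a v → v = b) (hb : ∀ v, R b v → v = a) (u v : ℕ) :
    join A a b u = v + 1 ↔ R u v ∨ (a = u ∧ b = v) ∨ (a = v ∧ b = u) := by
  rw [join_apply]
  split_ifs with h1 h2
  · subst h1
    constructor
    · intro h; omega
    · rintro (h | h | h)
      · rw [hb v h]
      · omega
      · omega
  · subst h2
    constructor
    · intro h; omega
    · rintro (h | h | h)
      · rw [ha v h]
      · omega
      · omega
  · rw [h]
    constructor
    · exact .inl
    · rintro (h | h | h)
      · exact h
      · omega
      · omega

theorem join_le {A : ℕ → ℕ} {n a b : ℕ} (h : ∀ u, A u ≤ n) (ha : a < n) (hb : b < n) (u : ℕ) :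
    join A a b u ≤ n := by
  have := h u
  rw [join_apply]
  split_ifs <;> omega

theorem cut_le {A : ℕ → ℕ} {n a b : ℕ} (h : ∀ u, A u ≤ n) (u : ℕ) : cut A a b u ≤ n := by
  have := h u
  rw [cut_apply]
  split_ifs <;> omega

theorem other_lt {E : ℕ → ℕ} {n u : ℕ} (h : ∀ u, E u ≤ n) (hu : u < n) : other E u < n := by
  have := h u
  unfold other
  split_ifs <;> omega

namespace WordRAM

/-- The state still holds the input. -/
def HoldsInput (n m : ℕ) (U V C : ℕ → ℕ) (σ : State) : Prop :=
  σ.reg 0 = n ∧ σ.reg 1 = m ∧ σ.arr 0 = U ∧ σ.arr 1 = V ∧ σ.arr 2 = C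

variable {n m W : ℕ} {U V C : ℕ → ℕ}

/-- Arrays 12 and 15 are to hold the other ends; for a matching these coincide with the partners in
10 and 13. -/
def MatchingsInv (n m : ℕ) (U V C : ℕ → ℕ) (k : ℕ) (σ : State) : Prop :=
  HoldsInput n m U V C σ ∧
  (∀ u v, σ.arr 10 u = v + 1 ↔ EdgeRel U V C k 0 u v) ∧
  (∀ u v, σ.arr 13 u = v + 1 ↔ EdgeRel U V C k 6 u v) ∧
  σ.arr 12 = σ.arr 10 ∧ σ.arr 15 = σ.arr 13 ∧ σ.arr 11 = (fun _ => 0) ∧ σ.arr 14 = (fun _ => 0) ∧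
  σ.arr 16 = (fun _ => 0) ∧ σ.arr 17 = (fun _ => 0)

theorem runsTo_matchings (hI : IsInput n m U V C) (hW : 16 * n + 16 ≤ W) (hm : m ≤ W) {σ : State}
    (hσ : MatchingsInv n m U V C 0 σ) :
    RunsTo W (forLoop (.reg 1) matchingsBody) σ ((m + 1) * (matchingsBody.cost + 11))
      (MatchingsInv n m U V C m) := by
  refine RunsTo.forLoop m (MatchingsInv n m U V C) hm (fun k τ h => h.1.2.1) ?_ ?_
  · simpa [MatchingsInv, HoldsInput] using hσ
  · rintro k τ hk h2 ⟨⟨hr0, hr1, h0, h1, h2'⟩, h10, h13, h12, h15, h11, h14, h16, h17⟩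
    have hu := hI.fst_lt k hk
    have hv := hI.snd_lt k hk
    have hc := hI.color_le k hk
    have hrel : ∀ c, C k = c → (∀ v, EdgeRel U V C k c (U k) v → v = V k) ∧
        (∀ v, EdgeRel U V C k c (V k) v → v = U k) := by
      intro c hc
      constructor
      · intro v h
        exact hI.colored.unique c _ _ _ (h.mono hk.le) ⟨k, hk, hc, .inl ⟨rfl, rfl⟩⟩
      · intro v h
        exact hI.colored.unique c _ _ _ (h.mono hk.le) ⟨k, hk, hc, .inr ⟨rfl, rfl⟩⟩
    simp only [matchingsBody, loadEdge, Program.wp, Expr.eval, Test.Holds, wp_joinProgram,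
      MatchingsInv, HoldsInput]
    simp [h2, h0, h1, h2', hr0, hr1, h12, h15, h11, h14, h16, h17]
    have hjoin : ∀ (c : ℕ) (A : ℕ → ℕ), C k = c →
        (∀ u v, A u = v + 1 ↔ EdgeRel U V C k c u v) → ∀ u v,
        join A (U k) (V k) u = v + 1 ↔ EdgeRel U V C (k + 1) c u v := by
      intro c A hc hA u v
      rw [join_eq_iff hA (hrel c hc).1 (hrel c hc).2, edgeRel_succ]
      simp [hc]
    have hskip : ∀ (c : ℕ) (A : ℕ → ℕ), C k ≠ c →
        (∀ u v, A u = v + 1 ↔ EdgeRel U V C k c u v) → ∀ u v,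
        A u = v + 1 ↔ EdgeRel U V C (k + 1) c u v := by
      intro c A hc hA u v
      rw [hA, edgeRel_succ]
      simp [hc]
    refine ⟨by omega, by omega, by omega, fun h => ⟨by omega, fun h' => by omega,
      fun h' => ⟨hjoin _ _ h h10, hskip _ _ h' h13⟩⟩,
      fun h => ⟨fun h' => ⟨by omega, hskip _ _ h h10, hjoin _ _ h' h13⟩,
      fun h' => ⟨hskip _ _ h h10, hskip _ _ h' h13⟩⟩⟩

/-- Arrays 10 to 12 are `A₁`, `A₂` and `E`, arrays 13 to 15 are `B₁`, `B₂` and `F`. The bounds by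
`n` keep words small, and 16 and 17 stay empty for the numberings. -/
def ForestsInv (n m : ℕ) (U V C : ℕ → ℕ) (k : ℕ) (σ : State) : Prop :=
  HoldsInput n m U V C σ ∧
  ForestPair (EdgeRel U V C m) (IsDone U V C k) (σ.arr 10) (σ.arr 11) (σ.arr 12) (σ.arr 13)
    (σ.arr 14) (σ.arr 15) ∧
  (∀ u, σ.arr 10 u ≤ n) ∧ (∀ u, σ.arr 11 u ≤ n) ∧ (∀ u, σ.arr 12 u ≤ n) ∧
  (∀ u, σ.arr 13 u ≤ n) ∧ (∀ u, σ.arr 14 u ≤ n) ∧ (∀ u, σ.arr 15 u ≤ n) ∧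
  σ.arr 16 = (fun _ => 0) ∧ σ.arr 17 = (fun _ => 0)

theorem MatchingsInv.forestsInv (hI : IsInput n m U V C) {σ : State}
    (h : MatchingsInv n m U V C m σ) : ForestsInv n m U V C 0 σ := by
  obtain ⟨hB, h10, h13, h12, h15, h11, h14, h16, h17⟩ := h
  have hlt : ∀ c u v, EdgeRel U V C m c u v → v < n := by
    rintro c u v ⟨j, hj, -, ⟨-, rfl⟩ | ⟨rfl, -⟩⟩
    exacts [hI.snd_lt j hj, hI.fst_lt j hj]
  have hle : ∀ (c : ℕ) (A : ℕ → ℕ), (∀ u v, A u = v + 1 ↔ EdgeRel U V C m c u v) →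
      ∀ u, A u ≤ n := by
    intro c A hA u
    by_contra h
    have := hlt _ _ _ ((hA u (A u - 1)).1 (by omega))
    omega
  have hD : IsDone U V C 0 = fun _ => False := by
    funext u
    simp [IsDone]
  unfold ForestsInv
  rw [hD, h11, h12, h14, h15]
  exact ⟨hB, .of_matchings hI.colored h10 h13, hle _ _ h10, by simp, hle _ _ h10, hle _ _ h13,
    by simp, hle _ _ h13, h16, h17⟩

theorem runsTo_forests (hI : IsInput n m U V C) (hW : 16 * n + 16 ≤ W) (hm : m ≤ W) {σ : State}
    (hσ : ForestsInv n m U V C 0 σ) :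
    RunsTo W (forLoop (.reg 1) forestsBody) σ ((m + 1) * (forestsBody.cost + 11))
      (ForestsInv n m U V C m) := by
  refine RunsTo.forLoop m (ForestsInv n m U V C) hm (fun k τ h => h.1.2.1) ?_ ?_
  · simpa [ForestsInv, HoldsInput] using hσ
  · rintro k τ hk h2 ⟨⟨hr0, hr1, h0, h1, h2'⟩, hP, h10, h11, h12, h13, h14, h15, h16, h17⟩
    have hu := hI.fst_lt k hk
    have hv := hI.snd_lt k hk
    have hc := hI.color_le k hk
    simp only [forestsBody, loadEdge, Program.wp, Expr.eval, Test.Holds, wp_joinProgram,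
      wp_cutProgram, wp_otherProgram, ForestsInv, HoldsInput]
    simp [h2, h0, h1, h2', hr0, hr1, h16, h17]
    have hE := fun u (h : u < n) => other_lt h12 h
    have hF := fun u (h : u < n) => other_lt h15 h
    have huW := hE _ hu
    have hvW := hE _ hv
    have huW' := hF _ hu
    have hvW' := hF _ hv
    -- The program compares `E a` with `b + 1` directly; the value 0, which stands for `a` itself,
    -- does no harm as `a ≠ b`.
    have hother : ∀ (E : ℕ → ℕ), U k ≠ V k → (other E (U k) = V k ↔ E (U k) = V k + 1) := by
      intro E hne
      unfold other
      split_ifs <;> omega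
    refine ⟨by omega, by omega, by omega, fun hc1 => ?_, fun hc1 => ?_⟩
    · have hab : EdgeRel U V C m 1 (U k) (V k) := ⟨k, hk, hc1, .inl ⟨rfl, rfl⟩⟩
      have hne := hI.colored.ne _ _ _ hab
      have hD : IsDone U V C (k + 1) = fun u => IsDone U V C k u ∨ u = U k ∨ u = V k := by
        funext u
        rw [isDone_succ]
        simp [hc1, eq_comm]
      have hnd : ∀ j < k, C j = 1 → ∀ u v, ((U j = u ∧ V j = v) ∨ (U j = v ∧ V j = u)) →
          ¬ ((U k = u ∧ V k = v) ∨ (U k = v ∧ V k = u)) := by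
        intro j hj _ u v h1 h2
        have := hI.inj j (by omega) k hk (by omega)
        omega
      -- By properness an earlier edge of color 1 at `U k` would have the same ends as the edge `k`,
      -- but no edge is listed twice.
      have ha : ¬ IsDone U V C k (U k) := by
        rintro ⟨j, hj, hj1, h | h⟩
        · have := hI.colored.unique 1 _ _ _ ⟨j, by omega, hj1, .inl ⟨h, rfl⟩⟩ hab
          exact hnd j hj hj1 _ _ (.inl ⟨h, this⟩) (.inl ⟨rfl, rfl⟩)
        · have := hI.colored.unique 1 _ _ _ ⟨j, by omega, hj1, .inr ⟨rfl, h⟩⟩ hab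
          exact hnd j hj hj1 _ _ (.inr ⟨this, h⟩) (.inl ⟨rfl, rfl⟩)
      have hb : ¬ IsDone U V C k (V k) := by
        have hba := hI.colored.symm _ _ _ hab
        rintro ⟨j, hj, hj1, h | h⟩
        · have := hI.colored.unique 1 _ _ _ ⟨j, by omega, hj1, .inl ⟨h, rfl⟩⟩ hba
          exact hnd j hj hj1 _ _ (.inl ⟨h, this⟩) (.inr ⟨rfl, rfl⟩)
        · have := hI.colored.unique 1 _ _ _ ⟨j, by omega, hj1, .inr ⟨rfl, h⟩⟩ hba
          exact hnd j hj hj1 _ _ (.inr ⟨this, h⟩) (.inr ⟨rfl, rfl⟩)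
      rw [hD]
      refine ⟨fun hE1 => ?_, fun hE1 => ?_⟩
      · have hE2 := (hother _ hne).2 hE1
        refine ⟨fun hF1 => ?_, fun hF1 => ?_⟩
        · have hF2 := (hother _ hne).2 hF1
          obtain ⟨c, hc', hcb, hca⟩ := hP.exists_left hI.colored hab ha hE2
          have hcn : c < n := by have := h10 (U k); omega
          have hcW := hF _ hcn
          rw [hc', Nat.add_sub_cancel]
          exact ⟨by omega, by omega, by omega, by omega, by omega, by omega, by omega,
            hP.exchange hI.colored hab ha hb hE2 hF2 hc' hcb hca, cut_le h10, join_le h11 hu hv,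
            join_le h12 hu hcn, h13, join_le h14 hu hcn, join_le h15 huW' hcW⟩
        · exact ⟨by omega, by omega, by omega, by omega,
            hP.join_right hI.colored hab ha hb hE2 (mt (hother _ hne).1 hF1), h10, h11, h12, h13,
            join_le h14 hu hv, join_le h15 huW' hvW'⟩
      · exact ⟨by omega, by omega, by omega, by omega,
          hP.join_left hI.colored hab ha hb (mt (hother _ hne).1 hE1), h10, join_le h11 hu hv,
          join_le h12 huW hvW, h13, h14, h15⟩
    · have hD : IsDone U V C (k + 1) = IsDone U V C k := by
        funext u
        rw [isDone_succ]
        simp [hc1]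
      rw [hD]
      exact ⟨hP, h10, h11, h12, h13, h14, h15⟩

end WordRAM

/-! ### The algorithm: ordering the vertices -/

open PathForest

namespace WordRAM

/-- One step of the traversal of the forest in the arrays `a` and `b`, numbering the vertices in
the array `p`. -/
def traverseBody (a b p : ℕ) : Program :=
  .ite (.eq (.reg 7) (.const 0))
    (.ite (.lt (.reg 6) (.reg 0))
      (.seq (.ite (.and (.eq (.arr p (.reg 6)) (.const 0))
          (.not (.and (.not (.eq (.arr a (.reg 6)) (.const 0)))
            (.not (.eq (.arr b (.reg 6)) (.const 0))))))
          (.set 7 (.add (.reg 6) (.const 1))) .skip)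
        (.set 6 (.add (.reg 6) (.const 1))))
      .skip)
    (.seq (.set 9 (.sub (.reg 7) (.const 1)))
      (.seq
        (.ite (.and (.not (.eq (.arr a (.reg 9)) (.const 0)))
            (.eq (.arr p (.sub (.arr a (.reg 9)) (.const 1))) (.const 0)))
          (.set 7 (.arr a (.reg 9)))
          (.ite (.and (.not (.eq (.arr b (.reg 9)) (.const 0)))
              (.eq (.arr p (.sub (.arr b (.reg 9)) (.const 1))) (.const 0)))
            (.set 7 (.arr b (.reg 9)))
            (.set 7 (.const 0))))
        (.seq (.store p (.reg 9) (.add (.reg 8) (.const 1)))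
          (.set 8 (.add (.reg 8) (.const 1))))))

def traverseProgram (a b p : ℕ) : Program :=
  .seq (.set 6 (.const 0)) (.seq (.set 7 (.const 0)) (.seq (.set 8 (.const 0))
    (forLoop (.add (.mul (.const 2) (.reg 0)) (.const 1)) (traverseBody a b p))))

end WordRAM

/-- The function `P` numbers the vertices such that neighbors in the forest get consecutive
numbers. -/
structure IsNumbering (A B : ℕ → ℕ) (n : ℕ) (P : ℕ → ℕ) : Prop where
  pos : ∀ u < n, 1 ≤ P u
  le : ∀ u < n, P u ≤ n
  inj : ∀ u < n, ∀ v < n, P u = P v → u = v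
  consecutive : ∀ u < n, ∀ v, Adj A B u v → P u = P v + 1 ∨ P v = P u + 1

theorem Traversal.isNumbering {A B E P : ℕ → ℕ} {n count : ℕ} (hF : PathForest A B E)
    (hA : ∀ u, A u ≤ n) (hB : ∀ u, B u ≤ n) (h : Traversal A B n P n 0 count) :
    IsNumbering A B n P where
  pos u hu := Nat.one_le_iff_ne_zero.2 (h.visited hF hA hB hu)
  le u _ := (h.le_count u).trans h.count_le
  inj u hu v _ := h.inj u v (h.visited hF hA hB hu)
  consecutive u hu v huv :=
    ((h.consecutive u v (h.visited hF hA hB hu) huv).resolve_right (by omega)).2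

namespace WordRAM

variable {n m W : ℕ}

/-- Until the traversal is finished, each round visits a vertex or advances the scan, so the sum of
registers 8 and 6 grows. It never exceeds `2 * n`, which is why `2 * n + 1` rounds suffice. -/
def TraverseInv (n m : ℕ) (f : ℕ → ℕ → ℕ) (a b p k : ℕ) (σ : State) : Prop :=
  (σ.reg 0 = n ∧ σ.reg 1 = m ∧ ∀ x, x ≠ p → σ.arr x = f x) ∧
  Traversal (f a) (f b) n (σ.arr p) (σ.reg 6) (σ.reg 7) (σ.reg 8) ∧
  (k ≤ σ.reg 8 + σ.reg 6 ∨ (σ.reg 7 = 0 ∧ σ.reg 6 = n))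

theorem runsTo_traverse (hW : 16 * n + 16 ≤ W) {a b p : ℕ} (hap : a ≠ p) (hbp : b ≠ p) {σ : State}
    {E : ℕ → ℕ} (hF : PathForest (σ.arr a) (σ.arr b) E)
    (hne : ∀ u v, Adj (σ.arr a) (σ.arr b) u v → u ≠ v) (hA : ∀ u, σ.arr a u ≤ n)
    (hB : ∀ u, σ.arr b u ≤ n) (hσ : σ.reg 0 = n) (hp : σ.arr p = fun _ => 0) :
    RunsTo W (traverseProgram a b p) σ
      (6 + (2 * n + 2) * ((traverseBody a b p).cost + 15))
      (fun τ => (τ.reg 0 = n ∧ τ.reg 1 = σ.reg 1 ∧ ∀ x, x ≠ p → τ.arr x = σ.arr x) ∧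
        IsNumbering (σ.arr a) (σ.arr b) n (τ.arr p)) := by
  have hstart : RunsTo W (.seq (.set 6 (.const 0)) (.seq (.set 7 (.const 0)) (.set 8 (.const 0))))
      σ 6 (fun τ => τ = ((σ.setReg 6 0).setReg 7 0).setReg 8 0) :=
    RunsTo.of_wp (by simp [Program.wp, Expr.eval])
  obtain ⟨t, τ, hr, ht, rfl⟩ := hstart
  have hloop : RunsTo W (forLoop (.add (.mul (.const 2) (.reg 0)) (.const 1)) (traverseBody a b p))
      (((σ.setReg 6 0).setReg 7 0).setReg 8 0) ((2 * n + 2) * ((traverseBody a b p).cost + 15))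
      (TraverseInv n (σ.reg 1) σ.arr a b p (2 * n + 1)) := by
    refine RunsTo.forLoop (2 * n + 1) (TraverseInv n (σ.reg 1) σ.arr a b p) (by omega) ?_ ?_ ?_
    · intro k τ h
      simp [Expr.eval, h.1.1]
    · simpa [TraverseInv, hσ, hp] using Traversal.init (σ.arr a) (σ.arr b) n
    · rintro k τ hk h2 ⟨⟨hr0, hr1, harr⟩, hT, hprog⟩
      have hcn := hT.count_le
      have hsn := hT.scan_le
      have hta := harr a hap
      have htb := harr b hbp
      simp only [traverseBody, Program.wp, Expr.eval, Test.Holds, TraverseInv]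
      simp [h2, hr0, hr1, hta, htb]
      have hupd : ∀ f : ℕ → ℕ, ∀ x, ¬ x = p → (if x = p then f else τ.arr x) = σ.arr x :=
        fun f x hx => by rw [if_neg hx]; exact harr x hx
      generalize τ.reg 6 = s at *
      generalize τ.reg 8 = count at *
      obtain ⟨cur, h7⟩ : ∃ cur, τ.reg 7 = cur := ⟨_, rfl⟩
      rw [h7] at hT hprog ⊢
      refine ⟨?_, fun hcur => ?_⟩
      · rintro rfl
        refine ⟨fun hs => ⟨fun h1 h2 => ⟨by omega, harr, hT.next hs (.inl ⟨h1, ?_, rfl⟩), by omega⟩,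
          fun h1 => ⟨by omega, harr, hT.next hs (.inr ⟨?_, rfl⟩), by omega⟩⟩,
          fun hs => ⟨harr, hT, by omega⟩⟩
        · unfold IsEnd; tauto
        · unfold IsEnd; tauto
      · obtain ⟨c, rfl⟩ := Nat.exists_eq_succ_of_ne_zero hcur
        rw [Nat.succ_eq_add_one, Nat.add_sub_cancel]
        have hv := fun nxt => hT.visit (nxt := nxt) hF hne hA hB
        have hc := (hT.cur_spec c rfl).1
        have := hA c
        have := hB c
        refine ⟨by omega, fun h1 h2 => ⟨by omega, by omega, by omega, hupd _,
          hv _ (.inl ⟨h1, h2, rfl⟩), by omega⟩, fun h1 => ⟨fun h2 h3 => ⟨by omega, by omega,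
          by omega, hupd _, hv _ (.inr ⟨fun h => h1 h.1 h.2, .inl ⟨h2, h3, rfl⟩⟩), by omega⟩,
          fun h2 => ⟨by omega, by omega, hupd _,
          hv _ (.inr ⟨fun h => h1 h.1 h.2, .inr ⟨fun h => h2 h.1 h.2, rfl⟩⟩), by omega⟩⟩⟩
  obtain ⟨t', ρ, hr', ht', hρ, hT, hprog⟩ := hloop
  have hcn := hT.count_le
  have hsn := hT.scan_le
  obtain ⟨h7, h6⟩ := hprog.resolve_left (by omega)
  rw [h6, h7] at hT
  have hrr : ∃ t, Runs W (traverseProgram a b p) σ t ρ ∧ t ≤ 6 + t' := by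
    cases hr with
    | seq h1 h23 =>
      cases h23 with
      | seq h2 h3 => exact ⟨_, .seq h1 (.seq h2 (.seq h3 hr')), by omega⟩
  obtain ⟨t, hrun, ht⟩ := hrr
  exact ⟨t, ρ, hrun, by omega, hρ, hT.isNumbering hF hA hB⟩

end WordRAM

/-! ### The algorithm: output -/

namespace WordRAM

/-- The coordinates of the vertices. -/
def positionsBody : Program :=
  .seq (.store 3 (.reg 2) (.sub (.mul (.const 8) (.arr 16 (.reg 2))) (.const 4)))
    (.store 4 (.reg 2) (.sub (.mul (.const 8) (.arr 17 (.reg 2))) (.const 4)))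

/-- Write the value of register `q`, moved by `3` towards that of `p`, into register `10`. -/
def shiftProgram (p q : ℕ) : Program :=
  .ite (.lt (.reg q) (.reg p)) (.set 10 (.add (.reg q) (.const 3)))
    (.set 10 (.sub (.reg q) (.const 3)))

def storeFour (a b c d : ℕ) (e f g h : Expr) : Program :=
  .seq (.store a (.reg 2) e) (.seq (.store b (.reg 2) f)
    (.seq (.store c (.reg 2) g) (.store d (.reg 2) h)))

/-- Compute the bends of an edge of kind `k` which is drawn from the point in the registers
`xp` and `yp` to the point in the registers `xq` and `yq`, and store them in the given arrays. -/
def bendsProgram (k xp yp xq yq a b c d : ℕ) : Program :=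
  match k with
  | 0 => .seq (shiftProgram yp yq) (storeFour a b c d (.add (.reg xq) (.const 2)) (.reg yp)
      (.add (.reg xq) (.const 2)) (.reg 10))
  | 1 => .seq (shiftProgram yp yq) (storeFour a b c d (.sub (.reg xq) (.const 2)) (.reg yp)
      (.sub (.reg xq) (.const 2)) (.reg 10))
  | 2 => .seq (shiftProgram xp xq) (storeFour a b c d (.reg xp) (.add (.reg yq) (.const 2))
      (.reg 10) (.add (.reg yq) (.const 2)))
  | 3 => .seq (shiftProgram xp xq) (storeFour a b c d (.reg xp) (.sub (.reg yq) (.const 2))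
      (.reg 10) (.sub (.reg yq) (.const 2)))
  | 4 => storeFour a b c d (.add (.reg xp) (.const 4)) (.add (.reg yp) (.const 1))
      (.add (.reg xp) (.const 4)) (.add (.reg yq) (.const 1))
  | _ => storeFour a b c d (.add (.reg xp) (.const 1)) (.add (.reg yp) (.const 4))
      (.add (.reg xq) (.const 1)) (.add (.reg yp) (.const 4))

def firstTest (k : ℕ) : Test :=
  match k with
  | 0 => .lt (.reg 8) (.reg 6)
  | 1 => .lt (.reg 6) (.reg 8)
  | 2 => .lt (.reg 9) (.reg 7)
  | 3 => .lt (.reg 7) (.reg 9)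
  | 4 => .lt (.reg 6) (.reg 8)
  | _ => .lt (.reg 7) (.reg 9)

/-- Draw the current edge, which is of kind `k` and has its ends at the points in the registers
from `6` to `9`. -/
def drawProgram (k : ℕ) : Program :=
  .ite (firstTest k) (bendsProgram k 6 7 8 9 6 7 8 9) (bendsProgram k 8 9 6 7 8 9 6 7)

def edgesBody : Program :=
  .seq loadEdge (.seq (.set 6 (.arr 3 (.reg 3))) (.seq (.set 7 (.arr 4 (.reg 3)))
    (.seq (.set 8 (.arr 3 (.reg 4))) (.seq (.set 9 (.arr 4 (.reg 4)))
    (.seq (.store 5 (.reg 2) (.const 2))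
    (.ite (.eq (.reg 5) (.const 2)) (drawProgram 0)
    (.ite (.eq (.reg 5) (.const 3)) (drawProgram 1)
    (.ite (.eq (.reg 5) (.const 4)) (drawProgram 2)
    (.ite (.eq (.reg 5) (.const 5)) (drawProgram 3)
    (.ite (.and (.not (.eq (.reg 6) (.add (.reg 8) (.const 8))))
        (.not (.eq (.reg 8) (.add (.reg 6) (.const 8)))))
      (drawProgram 5) (drawProgram 4)))))))))))

/-- The grid point with the given coordinates. -/
def point (x y : ℕ) : ℤ × ℤ := (x, y)

@[simp] theorem wp_shiftProgram {W p q : ℕ} {Φ : State → Prop} {σ : State} :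
    (shiftProgram p q).wp W Φ σ ↔
      (if σ.reg q < σ.reg p then σ.reg q + 3 else σ.reg q - 3) ≤ W ∧
        Φ (σ.setReg 10 (if σ.reg q < σ.reg p then σ.reg q + 3 else σ.reg q - 3)) := by
  simp only [shiftProgram, Program.wp, Expr.eval, Test.Holds]
  split_ifs with h
  · simp [h]
  · simp [h]

/-- The values of the four expressions depend on registers only, so that earlier stores do not
affect them; as the arrays are distinct, no result is overwritten. -/
theorem wp_storeFour {W a b c d x y z w : ℕ} {e f g h : Expr} {Φ : State → Prop} {σ : State}
    (hab : a ≠ b) (hac : a ≠ c) (had : a ≠ d) (hbc : b ≠ c) (hbd : b ≠ d) (hcd : c ≠ d)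
    (hi : σ.reg 2 ≤ W) (hx : x ≤ W) (hy : y ≤ W) (hz : z ≤ W) (hw : w ≤ W)
    (he : ∀ τ : State, τ.reg = σ.reg → e.eval τ = x) (hf : ∀ τ : State, τ.reg = σ.reg → f.eval τ = y)
    (hg : ∀ τ : State, τ.reg = σ.reg → g.eval τ = z) (hh : ∀ τ : State, τ.reg = σ.reg → h.eval τ = w)
    (hΦ : ∀ τ : State, τ.reg = σ.reg →
      (∀ x, x ≠ a → x ≠ b → x ≠ c → x ≠ d → τ.arr x = σ.arr x) →
      (∀ x j, j ≠ σ.reg 2 → τ.arr x j = σ.arr x j) →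
      τ.arr a (σ.reg 2) = x → τ.arr b (σ.reg 2) = y → τ.arr c (σ.reg 2) = z →
      τ.arr d (σ.reg 2) = w → Φ τ) :
    (storeFour a b c d e f g h).wp W Φ σ := by
  have hset : ∀ (τ : State) (a i v x j : ℕ), j ≠ i → (τ.setArr a i v).arr x j = τ.arr x j := by
    intro τ a i v x j hj
    rw [State.setArr_arr]
    split_ifs with h
    · rw [Function.update_of_ne hj, h]
    · rfl
  simp only [storeFour, Program.wp, Expr.eval, State.setArr_reg]
  rw [he σ rfl, hf (σ.setArr _ _ _) rfl, hg ((σ.setArr _ _ _).setArr _ _ _) rfl,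
    hh (((σ.setArr _ _ _).setArr _ _ _).setArr _ _ _) rfl]
  refine ⟨hi, hx, hi, hy, hi, hz, hi, hw, hΦ _ rfl (fun x h1 h2 h3 h4 => ?_) (fun x j hj => ?_)
    ?_ ?_ ?_ ?_⟩
  · simp only [State.setArr_arr, if_neg h1, if_neg h2, if_neg h3, if_neg h4]
  · rw [hset _ _ _ _ _ _ hj, hset _ _ _ _ _ _ hj, hset _ _ _ _ _ _ hj, hset _ _ _ _ _ _ hj]
  · simp only [State.setArr_arr, if_neg hab, if_neg hac, if_neg had, if_true, Function.update_self]
  · simp only [State.setArr_arr, if_neg hbc, if_neg hbd, if_true, Function.update_self]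
  · simp only [State.setArr_arr, if_neg hcd, if_true, Function.update_self]
  · simp only [State.setArr_arr, if_true, Function.update_self]

/-- Coordinates of vertices are at least 4, so truncated subtraction of 3 agrees with subtraction of
integers. -/
theorem cast_shift {p q : ℕ} (hq : 3 ≤ q) :
    (((if q < p then q + 3 else q - 3 : ℕ)) : ℤ) = if (q : ℤ) < p then (q : ℤ) + 3 else q - 3 := by
  split_ifs <;> omega

theorem wp_bendsProgram {W k xp yp xq yq a b c d : ℕ} {Φ : State → Prop} {σ : State} (hk : k < 6)
    (hab : a ≠ b) (hac : a ≠ c) (had : a ≠ d) (hbc : b ≠ c) (hbd : b ≠ d) (hcd : c ≠ d)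
    (hx : 4 ≤ σ.reg xq ∧ σ.reg xq + 4 ≤ W) (hy : 4 ≤ σ.reg yq ∧ σ.reg yq + 4 ≤ W)
    (hxp : σ.reg xp + 4 ≤ W) (hyp : σ.reg yp + 4 ≤ W) (h10 : xp ≠ 10 ∧ yp ≠ 10 ∧ xq ≠ 10 ∧ yq ≠ 10)
    (hi : σ.reg 2 ≤ W)
    (hΦ : ∀ τ : State, (∀ r, r ≠ 10 → τ.reg r = σ.reg r) →
      (∀ x, x ≠ a → x ≠ b → x ≠ c → x ≠ d → τ.arr x = σ.arr x) →
      (∀ x j, j ≠ σ.reg 2 → τ.arr x j = σ.arr x j) →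
      (point (τ.arr a (σ.reg 2)) (τ.arr b (σ.reg 2)),
        point (τ.arr c (σ.reg 2)) (τ.arr d (σ.reg 2))) =
        canonicalBends k (point (σ.reg xp) (σ.reg yp)) (point (σ.reg xq) (σ.reg yq)) → Φ τ) :
    (bendsProgram k xp yp xq yq a b c d).wp W Φ σ := by
  obtain ⟨h1, h2, h3, h4⟩ := h10
  have hsx : (if σ.reg xq < σ.reg xp then σ.reg xq + 3 else σ.reg xq - 3) ≤ W := by
    split_ifs <;> omega
  have hsy : (if σ.reg yq < σ.reg yp then σ.reg yq + 3 else σ.reg yq - 3) ≤ W := by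
    split_ifs <;> omega
  have key : ∀ (ρ : State) (e f g h : Expr) (x y z w : ℕ), ρ.arr = σ.arr →
      (∀ r, r ≠ 10 → ρ.reg r = σ.reg r) → x ≤ W → y ≤ W → z ≤ W → w ≤ W →
      (∀ τ : State, τ.reg = ρ.reg → e.eval τ = x) → (∀ τ : State, τ.reg = ρ.reg → f.eval τ = y) →
      (∀ τ : State, τ.reg = ρ.reg → g.eval τ = z) → (∀ τ : State, τ.reg = ρ.reg → h.eval τ = w) →
      (point x y, point z w) =
        canonicalBends k (point (σ.reg xp) (σ.reg yp)) (point (σ.reg xq) (σ.reg yq)) →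
      (storeFour a b c d e f g h).wp W Φ ρ := by
    intro ρ e f g h x y z w hρ hr hx hy hz hw he hf hg hh hb
    have h2 := hr 2 (by norm_num)
    refine wp_storeFour hab hac had hbc hbd hcd (by omega) hx hy hz hw he hf hg hh ?_
    intro τ ht ho hj e1 e2 e3 e4
    rw [h2] at hj e1 e2 e3 e4
    refine hΦ τ (fun r hr10 => by rw [ht, hr r hr10]) (by rwa [hρ] at ho) (by rwa [hρ] at hj) ?_
    rw [e1, e2, e3, e4, hb]
  interval_cases k
  · simp only [bendsProgram, Program.wp, wp_shiftProgram]
    refine ⟨hsy, key _ _ _ _ _ (σ.reg xq + 2) (σ.reg yp) (σ.reg xq + 2) _ rfl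
      (fun r hr => by simp [hr]) (by omega) (by omega) (by omega) hsy
      (fun τ ht => by simp [Expr.eval, ht, h3]) (fun τ ht => by simp [Expr.eval, ht, h2])
      (fun τ ht => by simp [Expr.eval, ht, h3])
      (fun τ ht => by simp only [Expr.eval, ht, State.setReg_reg, if_true]) ?_⟩
    simp [canonicalBends, point, cast_shift (by omega : 3 ≤ σ.reg yq)]
  · simp only [bendsProgram, Program.wp, wp_shiftProgram]
    refine ⟨hsy, key _ _ _ _ _ (σ.reg xq - 2) (σ.reg yp) (σ.reg xq - 2) _ rfl
      (fun r hr => by simp [hr]) (by omega) (by omega) (by omega) hsy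
      (fun τ ht => by simp [Expr.eval, ht, h3]) (fun τ ht => by simp [Expr.eval, ht, h2])
      (fun τ ht => by simp [Expr.eval, ht, h3])
      (fun τ ht => by simp only [Expr.eval, ht, State.setReg_reg, if_true]) ?_⟩
    simp [canonicalBends, point, cast_shift (by omega : 3 ≤ σ.reg yq),
      Nat.cast_sub (by omega : 2 ≤ σ.reg xq)]
  · simp only [bendsProgram, Program.wp, wp_shiftProgram]
    refine ⟨hsx, key _ _ _ _ _ (σ.reg xp) (σ.reg yq + 2) _ (σ.reg yq + 2) rfl
      (fun r hr => by simp [hr]) (by omega) (by omega) hsx (by omega)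
      (fun τ ht => by simp [Expr.eval, ht, h1]) (fun τ ht => by simp [Expr.eval, ht, h4])
      (fun τ ht => by simp only [Expr.eval, ht, State.setReg_reg, if_true])
      (fun τ ht => by simp [Expr.eval, ht, h4]) ?_⟩
    simp [canonicalBends, point, cast_shift (by omega : 3 ≤ σ.reg xq)]
  · simp only [bendsProgram, Program.wp, wp_shiftProgram]
    refine ⟨hsx, key _ _ _ _ _ (σ.reg xp) (σ.reg yq - 2) _ (σ.reg yq - 2) rfl
      (fun r hr => by simp [hr]) (by omega) (by omega) hsx (by omega)
      (fun τ ht => by simp [Expr.eval, ht, h1]) (fun τ ht => by simp [Expr.eval, ht, h4])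
      (fun τ ht => by simp only [Expr.eval, ht, State.setReg_reg, if_true])
      (fun τ ht => by simp [Expr.eval, ht, h4]) ?_⟩
    simp [canonicalBends, point, cast_shift (by omega : 3 ≤ σ.reg xq),
      Nat.cast_sub (by omega : 2 ≤ σ.reg yq)]
  · simp only [bendsProgram]
    refine key _ _ _ _ _ (σ.reg xp + 4) (σ.reg yp + 1) (σ.reg xp + 4) (σ.reg yq + 1) rfl
      (fun r hr => rfl) (by omega) (by omega) (by omega) (by omega)
      (fun τ ht => by simp [Expr.eval, ht]) (fun τ ht => by simp [Expr.eval, ht])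
      (fun τ ht => by simp [Expr.eval, ht]) (fun τ ht => by simp [Expr.eval, ht]) ?_
    simp [canonicalBends, point]
  · simp only [bendsProgram]
    refine key _ _ _ _ _ (σ.reg xp + 1) (σ.reg yp + 4) (σ.reg xq + 1) (σ.reg yp + 4) rfl
      (fun r hr => rfl) (by omega) (by omega) (by omega) (by omega)
      (fun τ ht => by simp [Expr.eval, ht]) (fun τ ht => by simp [Expr.eval, ht])
      (fun τ ht => by simp [Expr.eval, ht]) (fun τ ht => by simp [Expr.eval, ht]) ?_
    simp [canonicalBends, point]

/-- The kind of an edge of color `c` between vertices with the first coordinates `x` and `y`. -/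
def kindOf (c x y : ℕ) : ℕ :=
  if c = 2 then 0 else if c = 3 then 1 else if c = 4 then 2 else if c = 5 then 3
  else if x ≠ y + 8 ∧ y ≠ x + 8 then 5 else 4

theorem wp_drawProgram {W k : ℕ} {Φ : State → Prop} {σ : State} (hk : k < 6)
    (h6 : 4 ≤ σ.reg 6 ∧ σ.reg 6 + 4 ≤ W) (h7 : 4 ≤ σ.reg 7 ∧ σ.reg 7 + 4 ≤ W)
    (h8 : 4 ≤ σ.reg 8 ∧ σ.reg 8 + 4 ≤ W) (h9 : 4 ≤ σ.reg 9 ∧ σ.reg 9 + 4 ≤ W)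
    (hi : σ.reg 2 ≤ W)
    (hΦ : ∀ τ : State, (∀ r, r ≠ 10 → τ.reg r = σ.reg r) →
      (∀ x, x < 6 → τ.arr x = σ.arr x) →
      (∀ x j, j ≠ σ.reg 2 → τ.arr x j = σ.arr x j) →
      bendsBetween k (point (σ.reg 6) (σ.reg 7)) (point (σ.reg 8) (σ.reg 9)) =
        [point (τ.arr 6 (σ.reg 2)) (τ.arr 7 (σ.reg 2)),
          point (τ.arr 8 (σ.reg 2)) (τ.arr 9 (σ.reg 2))] → Φ τ) :
    (drawProgram k).wp W Φ σ := by
  have htest : (firstTest k).Holds σ ↔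
      IsFirst k (point (σ.reg 6) (σ.reg 7)) (point (σ.reg 8) (σ.reg 9)) := by
    interval_cases k <;> simp [firstTest, Test.Holds, IsFirst, Expr.eval, point]
  refine ⟨fun h => ?_, fun h => ?_⟩
  · refine wp_bendsProgram hk (by norm_num) (by norm_num) (by norm_num) (by norm_num) (by norm_num)
      (by norm_num) h8 h9 h6.2 h7.2 (by norm_num) hi fun τ h1 h2 h3 h4 => hΦ τ h1
        (fun x hx => h2 x (by omega) (by omega) (by omega) (by omega)) h3 ?_
    rw [htest] at h
    simp only [bendsBetween, h, if_true, ← h4]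
  -- The edge is drawn from its second end here. Passing the arrays in the order 8, 9, 6, 7 stores
  -- the bends in the order seen from the first end.
  · refine wp_bendsProgram hk (by norm_num) (by norm_num) (by norm_num) (by norm_num) (by norm_num)
      (by norm_num) h6 h7 h8.2 h9.2 (by norm_num) hi fun τ h1 h2 h3 h4 => hΦ τ h1
        (fun x hx => h2 x (by omega) (by omega) (by omega) (by omega)) h3 ?_
    rw [htest] at h
    simp only [bendsBetween, h, if_false, ← h4]

variable {n m W : ℕ} {U V C : ℕ → ℕ}

/-- Vertex numbers start from 1, so `8 * P v - 4` is the center of the cell with index `P v - 1`. -/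
def PositionsInv (n m : ℕ) (U V C P Q : ℕ → ℕ) (k : ℕ) (σ : State) : Prop :=
  HoldsInput n m U V C σ ∧ σ.arr 16 = P ∧ σ.arr 17 = Q ∧
    ∀ v < k, σ.arr 3 v = 8 * P v - 4 ∧ σ.arr 4 v = 8 * Q v - 4

theorem runsTo_positions (hW : 16 * n + 16 ≤ W) {P Q : ℕ → ℕ} (hP : ∀ u < n, P u ≤ n)
    (hQ : ∀ u < n, Q u ≤ n) {σ : State} (hσ : PositionsInv n m U V C P Q 0 σ) :
    RunsTo W (forLoop (.reg 0) positionsBody) σ ((n + 1) * (positionsBody.cost + 11))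
      (PositionsInv n m U V C P Q n) := by
  refine RunsTo.forLoop n (PositionsInv n m U V C P Q) (by omega) (fun k τ h => h.1.1) ?_ ?_
  · simpa [PositionsInv, HoldsInput] using hσ
  · rintro k τ hk h2 ⟨⟨hr0, hr1, h0, h1, h2'⟩, h16, h17, h⟩
    have := hP k hk
    have := hQ k hk
    simp only [positionsBody, Program.wp, Expr.eval, PositionsInv, HoldsInput]
    simp only [State.setArr_arr, State.setArr_reg, State.setReg_reg, State.setReg_arr]
    simp only [h2, h0, h1, h2', hr0, hr1, h16, h17]
    norm_num
    refine ⟨by omega, by omega, by omega, by omega, fun v hv => ?_⟩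
    simp only [Function.update_apply]
    by_cases hvk : v = k
    · simp [hvk]
    · simp only [if_neg hvk]
      exact h v (by omega)

/-- The first `k` edges have been drawn, where the arrays `X` and `Y` hold the coordinates of the
vertices. -/
def EdgesInv (n m : ℕ) (U V C X Y : ℕ → ℕ) (k : ℕ) (σ : State) : Prop :=
  HoldsInput n m U V C σ ∧ σ.arr 3 = X ∧ σ.arr 4 = Y ∧
    ∀ j < k, σ.arr 5 j = 2 ∧
      bendsBetween (kindOf (C j) (X (U j)) (X (V j))) (point (X (U j)) (Y (U j)))
        (point (X (V j)) (Y (V j))) =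
      [point (σ.arr 6 j) (σ.arr 7 j), point (σ.arr 8 j) (σ.arr 9 j)]

theorem runsTo_edges (hI : IsInput n m U V C) (hW : 16 * n + 16 ≤ W) (hm : m ≤ W) {X Y : ℕ → ℕ}
    (hX : ∀ u < n, 4 ≤ X u ∧ X u ≤ 8 * n) (hY : ∀ u < n, 4 ≤ Y u ∧ Y u ≤ 8 * n) {σ : State}
    (hσ : EdgesInv n m U V C X Y 0 σ) :
    RunsTo W (forLoop (.reg 1) edgesBody) σ ((m + 1) * (edgesBody.cost + 11))
      (EdgesInv n m U V C X Y m) := by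
  refine RunsTo.forLoop m (EdgesInv n m U V C X Y) hm (fun k τ h => h.1.2.1) ?_ ?_
  · simpa [EdgesInv, HoldsInput] using hσ
  · rintro k τ hk h2 ⟨⟨hr0, hr1, h0, h1, h2'⟩, h3, h4, h⟩
    have hu := hI.fst_lt k hk
    have hv := hI.snd_lt k hk
    have hc := hI.color_le k hk
    have hxu := hX _ hu
    have hxv := hX _ hv
    have hyu := hY _ hu
    have hyv := hY _ hv
    have key : ∀ κ ρ, κ = kindOf (C k) (X (U k)) (X (V k)) →
        ρ = ((((((((τ.setReg 3 (U k)).setReg 4 (V k)).setReg 5 (C k)).setReg 6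
          (X (U k))).setReg 7 (Y (U k))).setReg 8 (X (V k))).setReg 9 (Y (V k))).setArr 5 k 2) →
        (drawProgram κ).wp W (fun ρ => ρ.reg 2 = k ∧
          EdgesInv n m U V C X Y (k + 1) (ρ.setReg 2 (k + 1))) ρ := by
      intro κ ρ hκ hρ
      have hκ6 : κ < 6 := by
        rw [hκ]; unfold kindOf; split_ifs <;> omega
      have hr : ρ.reg 0 = n ∧ ρ.reg 1 = m ∧ ρ.reg 2 = k ∧ ρ.reg 6 = X (U k) ∧ ρ.reg 7 = Y (U k) ∧
          ρ.reg 8 = X (V k) ∧ ρ.reg 9 = Y (V k) := by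
        rw [hρ]; simp [hr0, hr1, h2]
      have ha : ρ.arr 0 = U ∧ ρ.arr 1 = V ∧ ρ.arr 2 = C ∧ ρ.arr 3 = X ∧ ρ.arr 4 = Y ∧
          ρ.arr 5 k = 2 ∧ ∀ x j, j ≠ k → ρ.arr x j = τ.arr x j := by
        rw [hρ]
        refine ⟨by simp [h0], by simp [h1], by simp [h2'], by simp [h3], by simp [h4], by simp, ?_⟩
        intro x j hj
        simp only [State.setArr_arr, State.setReg_arr]
        split_ifs with hx <;> simp [hj, hx]
      obtain ⟨r0, r1, r2, r6, r7, r8, r9⟩ := hr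
      obtain ⟨a0, a1, a2, a3, a4, a5, ha⟩ := ha
      refine wp_drawProgram hκ6 (by omega) (by omega) (by omega) (by omega) (by omega) ?_
      intro π hπr hπa hπj hb
      rw [r6, r7, r8, r9, r2] at hb
      rw [r2] at hπj
      refine ⟨by rw [hπr 2 (by norm_num), r2], ⟨?_, ?_, ?_, ?_, ?_⟩, ?_, ?_, ?_⟩
      · simp [hπr, r0]
      · simp [hπr, r1]
      · simp [hπa, a0]
      · simp [hπa, a1]
      · simp [hπa, a2]
      · simp [hπa, a3]
      · simp [hπa, a4]
      · intro j hj
        simp only [State.setReg_arr]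
        by_cases hjk : j = k
        · subst hjk
          rw [hπa 5 (by norm_num), ← hκ]
          exact ⟨a5, hb⟩
        · have := h j (by omega)
          simp only [hπj _ j hjk, ha _ j hjk]
          exact this
    simp only [edgesBody, loadEdge, Program.wp, Expr.eval, Test.Holds]
    simp only [State.setReg_reg, State.setReg_arr, State.setArr_reg, h0, h1, h2', h3, h4]
    norm_num [h2]
    refine ⟨by omega, by omega, by omega, by omega, by omega, by omega, by omega, by omega,
      by omega, ?_⟩
    refine ⟨fun c2 => key _ _ (by simp [kindOf, c2]) rfl, fun c2 =>
      ⟨fun c3 => key _ _ (by simp [kindOf, c3]) rfl, fun c3 =>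
      ⟨fun c4 => key _ _ (by simp [kindOf, c4]) rfl, fun c4 =>
      ⟨fun c5 => key _ _ (by simp [kindOf, c5]) rfl, fun c5 =>
      ⟨fun d e => key _ _ ?_ rfl, fun d => key _ _ ?_ rfl⟩⟩⟩⟩⟩
    · simp only [kindOf, if_neg c2, if_neg c3, if_neg c4, if_neg c5]
      rw [if_pos ⟨d, e⟩]
    · simp only [kindOf, if_neg c2, if_neg c3, if_neg c4, if_neg c5]
      rw [if_neg fun hd => hd.2 (d hd.1)]

end WordRAM

/-! ### The algorithm -/

namespace WordRAM

/-- The drawing algorithm. -/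
def drawGraph : Program :=
  .seq (forLoop (.reg 1) matchingsBody) (.seq (forLoop (.reg 1) forestsBody)
    (.seq (traverseProgram 10 11 16) (.seq (traverseProgram 13 14 17)
      (.seq (forLoop (.reg 0) positionsBody) (forLoop (.reg 1) edgesBody)))))

variable {n m W : ℕ} {U V C : ℕ → ℕ}

/-- The functions `P` and `Q` number the vertices such that the ends of each edge which is not of a
color from `2` to `5` get consecutive numbers from one of them. -/
structure IsNumberingPair (n m : ℕ) (U V C P Q : ℕ → ℕ) : Prop where
  fst_mem : ∀ u < n, 1 ≤ P u ∧ P u ≤ n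
  snd_mem : ∀ u < n, 1 ≤ Q u ∧ Q u ≤ n
  fst_inj : ∀ u < n, ∀ v < n, P u = P v → u = v
  snd_inj : ∀ u < n, ∀ v < n, Q u = Q v → u = v
  consecutive : ∀ j < m, C j = 0 ∨ C j = 1 ∨ C j = 6 →
    (P (U j) = P (V j) + 1 ∨ P (V j) = P (U j) + 1) ∨
      (Q (U j) = Q (V j) + 1 ∨ Q (V j) = Q (U j) + 1)

/-- When all edges have been processed, the ends of every edge of color 1 are done and `cover_one`
covers them all. -/
theorem IsNumberingPair.of_forestPair (hI : IsInput n m U V C) {A₁ A₂ E B₁ B₂ F P Q : ℕ → ℕ}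
    (hF : ForestPair (EdgeRel U V C m) (IsDone U V C m) A₁ A₂ E B₁ B₂ F)
    (hP : IsNumbering A₁ A₂ n P) (hQ : IsNumbering B₁ B₂ n Q) : IsNumberingPair n m U V C P Q where
  fst_mem u hu := ⟨hP.pos u hu, hP.le u hu⟩
  snd_mem u hu := ⟨hQ.pos u hu, hQ.le u hu⟩
  fst_inj := hP.inj
  snd_inj := hQ.inj
  consecutive j hj hc := by
    have hu := hI.fst_lt j hj
    have hM : ∀ c, C j = c → EdgeRel U V C m c (U j) (V j) :=
      fun c h => ⟨j, hj, h, .inl ⟨rfl, rfl⟩⟩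
    have h : PathForest.Adj A₁ A₂ (U j) (V j) ∨ PathForest.Adj B₁ B₂ (U j) (V j) := by
      rcases hc with hc | hc | hc
      · exact hF.cover_zero _ _ (hM _ hc)
      · exact hF.cover_one _ _ (hM _ hc) ⟨j, hj, hc, .inl rfl⟩
      · exact .inr (hF.cover_six _ _ (hM _ hc))
    exact h.imp (hP.consecutive _ hu _) (hQ.consecutive _ hu _)

/-- There are at most seven edges per vertex. -/
theorem _root_.IsInput.le (hI : IsInput n m U V C) : m ≤ 7 * n := by
  have h : (Finset.range m).card ≤ (Finset.range 7 ×ˢ Finset.range n).card := by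
    -- A vertex has at most one edge of each color, so an edge is determined by its color and its
    -- first end.
    refine Finset.card_le_card_of_injOn (fun j => (C j, U j)) ?_ ?_
    · intro j hj
      have hj := Finset.mem_range.1 (Finset.mem_coe.1 hj)
      have := hI.color_le j hj
      have := hI.fst_lt j hj
      simp only [Finset.coe_product, Finset.coe_range, Set.mem_prod, Set.mem_Iio]
      omega
    · intro i hi j hj hij
      have hi := Finset.mem_range.1 (Finset.mem_coe.1 hi)
      have hj := Finset.mem_range.1 (Finset.mem_coe.1 hj)
      obtain ⟨hc, hu⟩ := Prod.mk.inj hij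
      exact hI.inj i hi j hj (.inl ⟨hu, hI.colored.unique (C i) (U i) _ _
        ⟨i, hi, rfl, .inl ⟨rfl, rfl⟩⟩ ⟨j, hj, hc.symm, .inl ⟨hu.symm, rfl⟩⟩⟩)
  simpa using h

/-- The costs of the loop bodies are fixed numbers, so `K` can be chosen before `n`; `m ≤ 7 * n` and
`0 < n` absorb the numbers of rounds and the additive constants. -/
theorem exists_runsTo_drawGraph : ∃ K : ℕ, ∀ (n m W : ℕ) (U V C : ℕ → ℕ) (σ : State), 0 < n →
    IsInput n m U V C → 16 * n + 16 ≤ W → MatchingsInv n m U V C 0 σ →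
    RunsTo W drawGraph σ (K * n) (fun τ => ∃ P Q, IsNumberingPair n m U V C P Q ∧
      (∀ v < n, τ.arr 3 v = 8 * P v - 4 ∧ τ.arr 4 v = 8 * Q v - 4) ∧
      EdgesInv n m U V C (τ.arr 3) (τ.arr 4) m τ) := by
  have hcost : ∀ c, ∃ K, ∀ n m, 0 < n → m ≤ 7 * n → (m + 1) * c ≤ K * n :=
    fun c => ⟨8 * c, fun n m hn hm => by nlinarith⟩
  have hcost' : ∀ c, ∃ K, ∀ n, 0 < n → 6 + (2 * n + 2) * c ≤ K * n :=
    fun c => ⟨6 + 4 * c, fun n hn => by nlinarith⟩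
  obtain ⟨K₁, hK₁⟩ := hcost (matchingsBody.cost + 11)
  obtain ⟨K₂, hK₂⟩ := hcost (forestsBody.cost + 11)
  obtain ⟨K₃, hK₃⟩ := hcost' ((traverseBody 10 11 16).cost + 15)
  obtain ⟨K₄, hK₄⟩ := hcost' ((traverseBody 13 14 17).cost + 15)
  obtain ⟨K₅, hK₅⟩ := hcost (positionsBody.cost + 11)
  obtain ⟨K₆, hK₆⟩ := hcost (edgesBody.cost + 11)
  refine ⟨K₁ + (K₂ + (K₃ + (K₄ + (K₅ + K₆)))), fun n m W U V C σ hn hI hW hσ => ?_⟩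
  have hm7 := hI.le
  have hm : m ≤ W := by omega
  simp only [Nat.add_mul, drawGraph]
  refine ((runsTo_matchings hI hW hm hσ).mono (hK₁ n m hn hm7) fun _ h => h).seq fun τ₁ h₁ => ?_
  refine ((runsTo_forests hI hW hm (h₁.forestsInv hI)).mono (hK₂ n m hn hm7)
    fun _ h => h).seq fun τ₂ h₂ => ?_
  obtain ⟨⟨hr0, hr1, ha0, ha1, ha2⟩, hF, h10, h11, h12, h13, h14, h15, h16, h17⟩ := h₂
  refine ((runsTo_traverse hW (by norm_num) (by norm_num) hF.left hF.ne_left h10 h11 hr0 h16).mono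
    (hK₃ n hn) fun _ h => h).seq fun τ₃ h₃ => ?_
  obtain ⟨⟨hr0', hr1', ha⟩, hP⟩ := h₃
  refine ((runsTo_traverse (E := τ₂.arr 15) hW (by norm_num) (by norm_num)
    (by rw [ha 13 (by norm_num), ha 14 (by norm_num)]; exact hF.right)
    (by rw [ha 13 (by norm_num), ha 14 (by norm_num)]; exact hF.ne_right)
    (by rwa [ha 13 (by norm_num)]) (by rwa [ha 14 (by norm_num)]) hr0'
    (by rwa [ha 17 (by norm_num)])).mono (hK₄ n hn) fun _ h => h).seq fun τ₄ h₄ => ?_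
  obtain ⟨⟨hr0'', hr1'', ha'⟩, hQ⟩ := h₄
  rw [ha 13 (by norm_num), ha 14 (by norm_num)] at hQ
  refine ((runsTo_positions (m := m) (U := U) (V := V) (C := C) hW hP.le hQ.le
    ⟨⟨hr0'', by rw [hr1'', hr1', hr1], ?_, ?_, ?_⟩, ?_, rfl, by simp⟩).mono
    (hK₅ n n hn (by omega)) fun _ h => h).seq fun τ₅ h₅ => ?_
  · rw [ha' 0 (by norm_num), ha 0 (by norm_num), ha0]
  · rw [ha' 1 (by norm_num), ha 1 (by norm_num), ha1]
  · rw [ha' 2 (by norm_num), ha 2 (by norm_num), ha2]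
  · exact ha' 16 (by norm_num)
  obtain ⟨hin, -, -, hpos⟩ := h₅
  have hNP := IsNumberingPair.of_forestPair hI hF hP hQ
  refine (runsTo_edges hI hW hm (X := τ₅.arr 3) (Y := τ₅.arr 4) ?_ ?_
    ⟨hin, rfl, rfl, by simp⟩).mono (hK₆ n m hn hm7) fun τ₆ h₆ => ?_
  · intro u hu
    have := hpos u hu
    have := hNP.fst_mem u hu
    omega
  · intro u hu
    have := hpos u hu
    have := hNP.snd_mem u hu
    omega
  · have h3 := h₆.2.1
    have h4 := h₆.2.2.1
    refine ⟨_, _, hNP, ?_, ?_⟩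
    · rw [h3, h4]; exact hpos
    · rw [h3, h4]; exact h₆

end WordRAM

/-! ### Edge-colored graphs as inputs -/

open WordRAM

section Input

variable {V : Type*} {G : SimpleGraph V}

theorem SimpleGraph.Coloring.edge_eq (κ : G.lineGraph.Coloring (Fin 7)) {x y : G.edgeSet} {v : V}
    (hx : v ∈ (x : Sym2 V)) (hy : v ∈ (y : Sym2 V)) (h : κ x = κ y) : x = y := by
  by_contra hne
  exact κ.valid (SimpleGraph.lineGraph_adj_iff_exists.2 ⟨hne, v, hx, hy⟩) h

variable {m n : ℕ} (φ : V → ℕ) (κ : G.lineGraph.Coloring (Fin 7)) (e : Fin m → G.Dart)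

/-- The numbering `φ` admits arbitrary vertex types, so that the existence statement can use the
program too; the default 0 agrees with unused memory. -/
def edgeFst (j : ℕ) : ℕ := if h : j < m then φ (e ⟨j, h⟩).fst else 0

def edgeSnd (j : ℕ) : ℕ := if h : j < m then φ (e ⟨j, h⟩).snd else 0

def edgeColor (j : ℕ) : ℕ :=
  if h : j < m then (κ ⟨(e ⟨j, h⟩).edge, (e ⟨j, h⟩).edge_mem⟩ : ℕ) else 0

variable {φ κ e}

theorem exists_adj_of_edgeRel {c u v : ℕ}
    (h : EdgeRel (edgeFst φ e) (edgeSnd φ e) (edgeColor κ e) m c u v) :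
    ∃ (a b : V) (hab : G.Adj a b), φ a = u ∧ φ b = v ∧ (κ ⟨s(a, b), hab⟩ : ℕ) = c := by
  obtain ⟨j, hj, hc, h⟩ := h
  simp only [edgeFst, edgeSnd, edgeColor, dif_pos hj] at hc h
  rcases h with ⟨hu, hv⟩ | ⟨hv, hu⟩
  · exact ⟨_, _, (e ⟨j, hj⟩).adj, hu, hv, hc⟩
  · refine ⟨_, _, (e ⟨j, hj⟩).adj.symm, hu, hv, ?_⟩
    rw [← hc]
    congr 3
    exact Sym2.eq_swap

theorem isInput (hφ : Function.Injective φ) (hn : ∀ v, φ v < n) (he : IsEdgeList e) :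
    IsInput n m (edgeFst φ e) (edgeSnd φ e) (edgeColor κ e) where
  fst_lt j hj := by rw [edgeFst, dif_pos hj]; exact hn _
  snd_lt j hj := by rw [edgeSnd, dif_pos hj]; exact hn _
  color_le j hj := by rw [edgeColor, dif_pos hj]; omega
  inj i hi j hj h := by
    simp only [edgeFst, edgeSnd, dif_pos hi, dif_pos hj, hφ.eq_iff] at h
    have hij : (e ⟨i, hi⟩).edge = (e ⟨j, hj⟩).edge := Sym2.eq_iff.2 h
    have := (he _ (e ⟨j, hj⟩).edge_mem).unique hij rfl
    simpa using this
  colored := by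
    refine ⟨?_, ?_, ?_, ?_⟩
    · rintro c u v ⟨j, hj, hc, h⟩
      exact ⟨j, hj, hc, h.symm⟩
    · intro c u v w h h'
      obtain ⟨a, b, hab, rfl, rfl, hc⟩ := exists_adj_of_edgeRel h
      obtain ⟨a', b', hab', ha, rfl, hc'⟩ := exists_adj_of_edgeRel h'
      obtain rfl := hφ ha
      have := κ.edge_eq (x := ⟨s(a', b), hab⟩) (y := ⟨s(a', b'), hab'⟩) (v := a') (by simp)
        (by simp) (Fin.ext (hc.trans hc'.symm))
      rw [Sym2.congr_right.1 (congrArg Subtype.val this)]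
    · intro c u v h huv
      obtain ⟨a, b, hab, rfl, rfl, -⟩ := exists_adj_of_edgeRel h
      exact hab.ne (hφ huv)
    · intro c d u v h h'
      obtain ⟨a, b, hab, rfl, rfl, hc⟩ := exists_adj_of_edgeRel h
      obtain ⟨a', b', hab', ha, hb, hc'⟩ := exists_adj_of_edgeRel h'
      obtain rfl := hφ ha
      obtain rfl := hφ hb
      exact hc.symm.trans hc'

end Input

/-! ### From two orders of the vertices to the drawing -/

/-- The functions `px` and `py` order the vertices such that the ends of each edge which is not of a
color from `2` to `5` are consecutive in one of the two orders. -/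
structure IsOrderPair {V : Type*} {G : SimpleGraph V} (κ : G.lineGraph.Coloring (Fin 7)) (n : ℕ)
    (px py : V → ℕ) : Prop where
  fst_lt : ∀ v, px v < n
  snd_lt : ∀ v, py v < n
  fst_inj : Function.Injective px
  snd_inj : Function.Injective py
  consecutive : ∀ u v (h : G.Adj u v), (κ ⟨s(u, v), h⟩ : ℕ) < 2 ∨ 5 < (κ ⟨s(u, v), h⟩ : ℕ) →
    (px u = px v + 1 ∨ px v = px u + 1) ∨ (py u = py v + 1 ∨ py v = py u + 1)

section Orders

variable {V : Type*} {G : SimpleGraph V} {m n : ℕ} {φ : V → ℕ} {κ : G.lineGraph.Coloring (Fin 7)}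
  {e : Fin m → G.Dart}

theorem WordRAM.IsNumberingPair.isOrderPair {P Q : ℕ → ℕ}
    (h : IsNumberingPair n m (edgeFst φ e) (edgeSnd φ e) (edgeColor κ e) P Q)
    (hφ : Function.Injective φ) (hn : ∀ v, φ v < n) (he : IsEdgeList e) :
    IsOrderPair κ n (fun v => P (φ v) - 1) (fun v => Q (φ v) - 1) where
  fst_lt v := by have := h.fst_mem _ (hn v); omega
  snd_lt v := by have := h.snd_mem _ (hn v); omega
  fst_inj u v huv := hφ (h.fst_inj _ (hn u) _ (hn v) (by
    have := h.fst_mem _ (hn u); have := h.fst_mem _ (hn v); dsimp only at huv; omega))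
  snd_inj u v huv := hφ (h.snd_inj _ (hn u) _ (hn v) (by
    have := h.snd_mem _ (hn u); have := h.snd_mem _ (hn v); dsimp only at huv; omega))
  consecutive u v huv hc := by
    have hPu := h.fst_mem _ (hn u)
    have hPv := h.fst_mem _ (hn v)
    have hQu := h.snd_mem _ (hn u)
    have hQv := h.snd_mem _ (hn v)
    obtain ⟨j, hj, -⟩ := he s(u, v) huv
    have hcol : edgeColor κ e j = κ ⟨s(u, v), huv⟩ := by
      rw [edgeColor, dif_pos j.2]
      congr 3
    have := h.consecutive j j.2 (by omega)
    simp only [edgeFst, edgeSnd, dif_pos j.2] at this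
    rcases Sym2.eq_iff.1 (show s((e j).fst, (e j).snd) = s(u, v) from hj) with ⟨h1, h2⟩ | ⟨h1, h2⟩
    · rw [show e ⟨j, j.2⟩ = e j from rfl, h1, h2] at this
      omega
    · rw [show e ⟨j, j.2⟩ = e j from rfl, h1, h2] at this
      omega

theorem kindOf_comm (c x y : ℕ) : kindOf c x y = kindOf c y x := by
  simp only [kindOf, and_comm]

theorem kindOf_lt (c x y : ℕ) : kindOf c x y < 6 := by
  unfold kindOf; split_ifs <;> omega

/-- The first four kinds correspond to the colors from 2 to 5 and inherit from them that they are
matchings. -/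
theorem color_eq_of_kindOf_eq {c d x y z w : ℕ} (h : kindOf c x y = kindOf d z w)
    (h4 : kindOf c x y < 4) : c = d := by
  unfold kindOf at *; split_ifs at * <;> omega

variable {px py : V → ℕ}

open Classical in
/-- The layout for two orders of the vertices of an edge-colored graph. -/
noncomputable def IsOrderPair.layout (h : IsOrderPair κ n px py) : Layout V where
  px v := px v
  py v := py v
  edges := G.edgeSet
  -- The default 0 for pairs that are not edges is never inspected.
  kind x := if hx : x ∈ G.edgeSet then
    x.lift ⟨fun u v => kindOf (κ ⟨x, hx⟩) (8 * px u + 4) (8 * px v + 4),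
      fun _ _ => kindOf_comm _ _ _⟩ else 0
  px_inj u v huv := h.fst_inj (Int.ofNat.inj huv)
  py_inj u v huv := h.snd_inj (Int.ofNat.inj huv)
  proper x hx y hy v hvx hvy hk hk4 := by
    rw [dif_pos hx] at hk hk4
    rw [dif_pos hy] at hk
    refine congrArg Subtype.val (κ.edge_eq (x := ⟨x, hx⟩) (y := ⟨y, hy⟩) hvx hvy (Fin.ext ?_))
    induction x with | _ a b =>
    induction y with | _ c d =>
    exact color_eq_of_kindOf_eq hk hk4

theorem IsOrderPair.layout_kind (h : IsOrderPair κ n px py) {u v : V} (huv : G.Adj u v) :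
    h.layout.kind s(u, v) = kindOf (κ ⟨s(u, v), huv⟩) (8 * px u + 4) (8 * px v + 4) := by
  simp only [layout]
  rw [dif_pos (show s(u, v) ∈ G.edgeSet from huv)]
  rfl

/-- For the colors 0, 1 and 6, kind 4 is chosen exactly when the first coordinates differ by 8, that
is, for neighbors in `px`; failing that, `consecutive` makes the ends neighbors in `py`. -/
theorem IsOrderPair.valid (h : IsOrderPair κ n px py) : h.layout.Valid where
  ne u v huv := SimpleGraph.Adj.ne huv
  kind_lt x hx := by
    induction x with | _ a b =>
    rw [h.layout_kind hx]
    exact kindOf_lt _ _ _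
  kind_four u v huv hk hlt := by
    replace huv : G.Adj u v := huv
    rw [h.layout_kind huv] at hk
    simp only [layout] at hlt ⊢
    unfold kindOf at hk
    split_ifs at hk <;> omega
  kind_five u v huv hk hlt := by
    replace huv : G.Adj u v := huv
    rw [h.layout_kind huv] at hk
    have := h.consecutive u v huv
    simp only [layout] at hlt ⊢
    unfold kindOf at hk
    split_ifs at hk <;> omega

/-- The drawing for two orders of the vertices of an edge-colored graph. -/
noncomputable def IsOrderPair.drawing (h : IsOrderPair κ n px py) : GridDrawing G :=
  h.layout.drawing h.valid rfl

theorem IsOrderPair.drawing_isBend (h : IsOrderPair κ n px py) : h.drawing.IsBend 2 :=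
  h.layout.drawing_isBend h.valid rfl

theorem IsOrderPair.drawing_isRAC (h : IsOrderPair κ n px py) : h.drawing.IsRAC :=
  h.layout.drawing_isRAC h.valid rfl

theorem IsOrderPair.drawing_areaLE (h : IsOrderPair κ n px py) (hn : 0 < n) :
    h.drawing.AreaLE (81 * n ^ 2) :=
  h.layout.drawing_areaLE h.valid rfl hn
    (fun v => ⟨Int.natCast_nonneg _, Int.ofNat_lt.2 (h.fst_lt v)⟩)
    (fun v => ⟨Int.natCast_nonneg _, Int.ofNat_lt.2 (h.snd_lt v)⟩)

end Orders

/-! ### Encoding of the input and the main theorem -/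

theorem exists_isEdgeList {V : Type*} [Finite V] (G : SimpleGraph V) :
    ∃ (m : ℕ) (e : Fin m → G.Dart), IsEdgeList e := by
  classical
  have : Fintype G.edgeSet := Fintype.ofFinite _
  have hd : ∀ x : G.edgeSet, ∃ d : G.Dart, d.edge = x := by
    rintro ⟨x, hx⟩
    induction x with | _ a b => exact ⟨⟨(a, b), hx⟩, rfl⟩
  choose d hd using hd
  refine ⟨_, fun i => d ((Fintype.equivFin G.edgeSet).symm i), fun x hx =>
    ⟨Fintype.equivFin _ ⟨x, hx⟩, by simp [hd], fun i hi => ?_⟩⟩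
  rw [← Equiv.symm_apply_eq]
  exact Subtype.ext ((hd _).symm.trans hi)

/-- The initial memory. -/
def encodedInput (n m : ℕ) (U V C : ℕ → ℕ) : State where
  reg x := if x = 0 then n else if x = 1 then m else 0
  arr a := if a = 0 then U else if a = 1 then V else if a = 2 then C else fun _ => 0

theorem matchingsInv_encodedInput (n m : ℕ) (U V C : ℕ → ℕ) :
    MatchingsInv n m U V C 0 (encodedInput n m U V C) := by
  simp [MatchingsInv, HoldsInput, encodedInput, EdgeRel]

theorem inputState_eq {n m : ℕ} {G : SimpleGraph (Fin n)} (κ : G.lineGraph.Coloring (Fin 7))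
    (e : Fin m → G.Dart) : inputState κ e =
      encodedInput n m (edgeFst Fin.val e) (edgeSnd Fin.val e) (edgeColor κ e) := by
  refine congrArg (State.mk _) ?_
  funext a i
  by_cases h : i < m
  · rw [dif_pos h]
    split_ifs <;> simp [edgeFst, edgeSnd, edgeColor, h]
  · rw [dif_neg h]
    split_ifs <;> simp [edgeFst, edgeSnd, edgeColor, h]

theorem mainTheorem7 :
    (∃ C : ℕ, ∀ (V : Type*) [Fintype V] [Nonempty V] (G : SimpleGraph V) [DecidableRel G.Adj],
      G.maxDegree ≤ 7 → G.lineGraph.Colorable 7 →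
        ∃ Γ : GridDrawing G, Γ.IsBend 2 ∧ Γ.IsRAC ∧ Γ.AreaLE (C * Fintype.card V ^ 2)) ∧
    (∃ (P : WordRAM.Program) (C k : ℕ), ∀ n : ℕ, 0 < n →
      ∀ (G : SimpleGraph (Fin n)) [DecidableRel G.Adj], G.maxDegree ≤ 7 →
        ∀ (κ : G.lineGraph.Coloring (Fin 7)) (m : ℕ) (e : Fin m → G.Dart), IsEdgeList e →
          ∃ (t : ℕ) (τ : WordRAM.State) (Γ : GridDrawing G),
            WordRAM.Runs ((n + 2) ^ k) P (inputState κ e) t τ ∧ t ≤ C * n ∧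
            OutputsDrawing e τ Γ ∧
            Γ.IsBend 2 ∧ Γ.IsRAC ∧ Γ.AreaLE (C * n ^ 2)) := by
  obtain ⟨K, hK⟩ := exists_runsTo_drawGraph
  refine ⟨⟨81, fun V _ _ G _ _ ⟨κ⟩ => ?_⟩, drawGraph, K + 81, 5, ?_⟩
  · obtain ⟨m, e, he⟩ := exists_isEdgeList G
    have hφ : Function.Injective fun v => (Fintype.equivFin V v : ℕ) :=
      Fin.val_injective.comp (Fintype.equivFin V).injective
    have hn : ∀ v, (Fintype.equivFin V v : ℕ) < Fintype.card V := fun v => Fin.is_lt _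
    -- Of the run on an enumeration of `V`, only the numberings `P` and `Q` are used; `le_rfl` picks
    -- the least admissible word bound.
    obtain ⟨-, -, -, -, P, Q, h, -⟩ := hK _ _ _ _ _ _ _ (Fintype.card_pos (α := V))
      (isInput (κ := κ) hφ hn he) le_rfl (matchingsInv_encodedInput _ _ _ _ _)
    have hO := h.isOrderPair hφ hn he
    exact ⟨hO.drawing, hO.drawing_isBend, hO.drawing_isRAC, hO.drawing_areaLE Fintype.card_pos⟩
  · intro n hn G _ _ κ m e he
    -- The exponent 5 comes from `16 = 2 ^ 4 ≤ (n + 2) ^ 4` and one more factor for `n + 1 ≤ n + 2`.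
    have hW : 16 * n + 16 ≤ (n + 2) ^ 5 := by
      have h16 : 2 ^ 4 ≤ (n + 2) ^ 4 := Nat.pow_le_pow_left (by omega) 4
      calc 16 * n + 16 ≤ 2 ^ 4 * (n + 2) := by omega
        _ ≤ (n + 2) ^ 4 * (n + 2) := Nat.mul_le_mul_right _ h16
        _ = (n + 2) ^ 5 := (pow_succ _ _).symm
    obtain ⟨t, τ, hr, ht, P, Q, h, hpos, hE⟩ := hK _ _ _ _ _ _ _ hn
      (isInput (κ := κ) Fin.val_injective Fin.is_lt he) hW (matchingsInv_encodedInput _ _ _ _ _)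
    rw [← inputState_eq] at hr
    have hO := h.isOrderPair Fin.val_injective Fin.is_lt he
    have hcenter : ∀ v : Fin n, hO.layout.center v = point (τ.arr 3 v) (τ.arr 4 v) := by
      intro v
      have := hpos v v.2
      have := h.fst_mem v v.2
      have := h.snd_mem v v.2
      simp only [Layout.center, IsOrderPair.layout, point, Prod.mk.injEq]
      omega
    refine ⟨t, τ, hO.drawing, hr, ht.trans (Nat.mul_le_mul_right _ (Nat.le_add_right _ _)),
      ⟨hcenter, fun i => ?_⟩, hO.drawing_isBend, hO.drawing_isRAC, ?_⟩
    · obtain ⟨h5, hb⟩ := hE.2.2.2 i i.2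
      have hx : ∀ v : Fin n, τ.arr 3 v = 8 * (P v - 1) + 4 := by
        intro v
        have := hpos v v.2
        have := h.fst_mem v v.2
        omega
      change bendsBetween (hO.layout.kind s((e i).fst, (e i).snd)) (hO.layout.center _)
        (hO.layout.center _) = _
      rw [hcenter, hcenter, hO.layout_kind (e i).adj, h5]
      simp only [edgeFst, edgeSnd, edgeColor, dif_pos i.2, Fin.eta, hx] at hb
      simp only [hx]
      exact hb
    · obtain ⟨x, y, w, l, hA, hv, hb⟩ := hO.drawing_areaLE hn
      exact ⟨x, y, w, l, hA.trans (Nat.mul_le_mul_right _ (Nat.le_add_left _ _)), hv, hb⟩
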